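/- Let $\mathfrak g=\mathfrak g_{\bar 0}\oplus\mathfrak g_{\bar 1}$ be a finite-dimensional complex Lie superalgebra with $\mathfrak g_{\bar 0}$ reductive, let $\chi\in\mathfrak g_{\bar 0}^*\subset\mathfrak g^*$ be nilpotent (the closure of its coadjoint $G_{\bar 0}$-orbit contains $0$), and put $\mathfrak g^\chi=\{x\in\mathfrak g:\chi([x,\mathfrak g])=0\}$. Let $\mathfrak g=\bigoplus_{j\in\mathbb Z}\mathfrak g_j$ be a good $\mathbb Z$-grading for $\chi$, i.e. a grading of the Lie superalgebra with $\chi(\mathfrak g_j)=0$ for $j\ne-2$ and $\mathfrak g^\chi\subset\mathfrak p:=\bigoplus_{j\ge0}\mathfrak g_j$. Let $\mathfrak l\subset\mathfrak g_{-1}$ be a maximal isotropic (super) subspace for the form $\chi([\cdot,\cdot])$, and let $\mathfrak l'$ be a (super) subspace with $\mathfrak g_{-1}=\mathfrak l\oplus\mathfrak l'$ that contains a maximal isotropic subspace. Put $\mathfrak m=\bigoplus_{j\le-2}\mathfrak g_j\oplus\mathfrak l$, let $I_\chi$ be the left ideal of $U(\mathfrak g)$ generated by all $a-\chi(a)$,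 $a\in\mathfrak m$, let $\pi:U(\mathfrak g)\to Q_\chi=U(\mathfrak g)/I_\chi$ be the projection, and let $W_\chi=\mathrm{End}_{U(\mathfrak g)}(Q_\chi)^{op}$, identified with a subspace of $Q_\chi$ by $f\mapsto f(\pi(1))$. The Kazhdan filtration of $U(\mathfrak g)$ is defined by giving $x\in\mathfrak g_j$ the degree $j+2$; it induces filtrations of $Q_\chi$ and $W_\chi$, with associated graded spaces $\mathrm{Gr}_K$. By the PBW theorem $\mathrm{Gr}_K Q_\chi$ is identified with the symmetric superalgebra $S(\mathfrak p\oplus\mathfrak l')$. For $X\in W_\chi$ let $\mathrm{Gr}_K X\in S(\mathfrak p\oplus\mathfrak l')$ be its symbol, and let $\overline{\mathrm{Gr}_K X}$ be the component of $\mathrm{Gr}_K X$ of highest degree in the grading of $S(\mathfrak p\oplus\mathfrak l')$ induced by the good grading of $\mathfrak g$. Let $y_1,\dots,y_r$ be a basis of $\mathfrak g^\chi$ homogeneous in the good grading, and suppose that there are $Y_1,\dots,Y_r\in W_\chi$ with $\overline{\mathrm{Gr}_K Y_i}=y_i$ for all $i$. 1. If $\dim(\mathfrak g_{-1})_{\bar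 1}$ is even, then (a) $Y_1,\dots,Y_r$ generate the algebra $W_\chi$, and (b) $\mathrm{Gr}_K W_\chi\cong S(\mathfrak g^\chi)$. 2. If $\dim(\mathfrak g_{-1})_{\bar 1}$ is odd, then (a) for every $\theta\in\mathfrak l'$ with $\chi([\theta,\mathfrak l])=0$ and $\chi([\theta,\theta])=2$, the element $\pi(\theta)$ lies in $W_\chi$, and $Y_1,\dots,Y_r$ and $\pi(\theta)$ generate the algebra $W_\chi$, and (b) $\mathrm{Gr}_K W_\chi\cong S(\mathfrak g^\chi)\otimes\mathbb C[\xi]$, where $\mathbb C[\xi]$ is the exterior algebra on one odd generator $\xi$ and $\otimes$ is the tensor product of superalgebras. The isomorphisms in (b) are isomorphisms of superalgebras that preserve the Kazhdan grading, where $x\in\mathfrak g^\chi\cap\mathfrak g_j$ has degree $j+2$ and $\xi$ has degree $1$. -/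

import Mathlib

open scoped DirectSum TensorProduct

noncomputable section

namespace FinW

/-! ### The graded algebra associated with a filtration indexed by the integers -/

section AssociatedGraded

variable {A : Type*} [Ring A] [Algebra ℂ A] (F : ℤ → Submodule ℂ A)

/-- An increasing multiplicative filtration `F` of a unital algebra, indexed by `ℤ`. -/
class IsMulFiltration : Prop where
  mono : Monotone F
  one_mem : (1 : A) ∈ F 0
  mul_mem : ∀ {i j : ℤ} {a b : A}, a ∈ F i → b ∈ F j → a * b ∈ F (i + j)

/-- The `n`-th graded piece `F n / F (n - 1)`. -/
def GrPiece (n : ℤ) : Type _ := F n ⧸ (F (n - 1)).submoduleOf (F n)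

instance (n : ℤ) : AddCommGroup (GrPiece F n) :=
  inferInstanceAs (AddCommGroup (F n ⧸ (F (n - 1)).submoduleOf (F n)))

instance (n : ℤ) : Module ℂ (GrPiece F n) :=
  inferInstanceAs (Module ℂ (F n ⧸ (F (n - 1)).submoduleOf (F n)))

/-- The class in `F n / F (n - 1)` of an element of `F n`. -/
def GrPiece.cls (n : ℤ) : F n →ₗ[ℂ] GrPiece F n :=
  ((F (n - 1)).submoduleOf (F n)).mkQ

theorem GrPiece.cls_surjective (n : ℤ) : Function.Surjective (GrPiece.cls F n) :=
  Submodule.mkQ_surjective _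

variable {F} in
theorem GrPiece.cls_eq {n : ℤ} {a b : F n} (h : (a : A) - b ∈ F (n - 1)) :
    GrPiece.cls F n a = GrPiece.cls F n b :=
  (Submodule.Quotient.eq ((F (n - 1)).submoduleOf (F n))).2 h

variable {F} in
theorem GrPiece.mk_eq {i j : ℤ} (h : i = j) {a : F i} {b : F j} (hab : (a : A) = b) :
    GradedMonoid.mk (A := GrPiece F) i (GrPiece.cls F i a) =
      GradedMonoid.mk j (GrPiece.cls F j b) := by
  subst h
  rw [Subtype.ext hab]

variable [hF : IsMulFiltration F]

/-- The multiplication `[a] [b] = [a b]` of classes. -/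
def GrPiece.mul {i j : ℤ} (x : GrPiece F i) (y : GrPiece F j) : GrPiece F (i + j) :=
  Quotient.map₂ (fun (a : F i) (b : F j) => (⟨a * b, hF.mul_mem a.2 b.2⟩ : F (i + j)))
    (by
      intro a a' haa b b' hbb
      have h1' : a - a' ∈ (F (i - 1)).submoduleOf (F i) := (Submodule.quotientRel_def _).1 haa
      have h2' : b - b' ∈ (F (j - 1)).submoduleOf (F j) := (Submodule.quotientRel_def _).1 hbb
      have h1 : (a : A) - a' ∈ F (i - 1) := h1'
      have h2 : (b : A) - b' ∈ F (j - 1) := h2'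
      refine (Submodule.quotientRel_def _).2 ?_
      change (a : A) * b - a' * b' ∈ F (i + j - 1)
      have e : (a : A) * b - a' * b' = (a - a') * b + a' * (b - b') := by noncomm_ring
      rw [e]
      refine Submodule.add_mem _ ?_ ?_
      · have := hF.mul_mem h1 b.2
        rwa [show i - 1 + j = i + j - 1 by ring] at this
      · have := hF.mul_mem a'.2 h2
        rwa [show i + (j - 1) = i + j - 1 by ring] at this) x y

theorem GrPiece.mul_cls {i j : ℤ} (a : F i) (b : F j) :
    GrPiece.mul F (GrPiece.cls F i a) (GrPiece.cls F j b) =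
      GrPiece.cls F (i + j) ⟨a * b, hF.mul_mem a.2 b.2⟩ := rfl

instance : GradedMonoid.GMul (GrPiece F) := ⟨fun x y => GrPiece.mul F x y⟩

instance : GradedMonoid.GOne (GrPiece F) := ⟨GrPiece.cls F 0 ⟨1, hF.one_mem⟩⟩

instance : DirectSum.GRing (GrPiece F) where
  mul_zero := by
    intro i j a
    obtain ⟨a, rfl⟩ := GrPiece.cls_surjective F _ a
    exact GrPiece.cls_eq (b := 0) (by simp)
  zero_mul := by
    intro i j b
    obtain ⟨b, rfl⟩ := GrPiece.cls_surjective F _ b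
    exact GrPiece.cls_eq (b := 0) (by simp)
  mul_add := by
    intro i j a b c
    obtain ⟨a, rfl⟩ := GrPiece.cls_surjective F _ a
    obtain ⟨b, rfl⟩ := GrPiece.cls_surjective F _ b
    obtain ⟨c, rfl⟩ := GrPiece.cls_surjective F _ c
    exact GrPiece.cls_eq (by simp [mul_add])
  add_mul := by
    intro i j a b c
    obtain ⟨a, rfl⟩ := GrPiece.cls_surjective F _ a
    obtain ⟨b, rfl⟩ := GrPiece.cls_surjective F _ b
    obtain ⟨c, rfl⟩ := GrPiece.cls_surjective F _ c
    exact GrPiece.cls_eq (by simp [add_mul])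
  one_mul := by
    rintro ⟨i, a⟩
    obtain ⟨a, rfl⟩ := GrPiece.cls_surjective F _ a
    exact GrPiece.mk_eq (zero_add i) (by simp)
  mul_one := by
    rintro ⟨i, a⟩
    obtain ⟨a, rfl⟩ := GrPiece.cls_surjective F _ a
    exact GrPiece.mk_eq (add_zero i) (by simp)
  mul_assoc := by
    rintro ⟨i, a⟩ ⟨j, b⟩ ⟨k, c⟩
    obtain ⟨a, rfl⟩ := GrPiece.cls_surjective F _ a
    obtain ⟨b, rfl⟩ := GrPiece.cls_surjective F _ b
    obtain ⟨c, rfl⟩ := GrPiece.cls_surjective F _ c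
    exact GrPiece.mk_eq (add_assoc i j k) (by simp [mul_assoc])
  natCast n := n • GrPiece.cls F 0 ⟨1, hF.one_mem⟩
  natCast_zero := zero_smul _ _
  natCast_succ n := by rw [add_smul, one_smul]; rfl
  intCast n := n • GrPiece.cls F 0 ⟨1, hF.one_mem⟩
  intCast_ofNat n := natCast_zsmul _ _
  intCast_negSucc_ofNat n := negSucc_zsmul _ _

instance : DirectSum.GAlgebra ℂ (GrPiece F) where
  toFun :=
    { toFun := fun c => c • GrPiece.cls F 0 ⟨1, hF.one_mem⟩
      map_zero' := zero_smul _ _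
      map_add' := fun _ _ => add_smul _ _ _ }
  map_one := one_smul _ _
  map_mul r s := by
    exact GrPiece.mk_eq (a := (r * s) • ⟨1, hF.one_mem⟩)
      (b := ⟨(r • (1 : A)) * (s • (1 : A)), hF.mul_mem
        (Submodule.smul_mem _ _ hF.one_mem) (Submodule.smul_mem _ _ hF.one_mem)⟩)
      (zero_add 0).symm (by simp [smul_smul, mul_comm])
  commutes r := by
    rintro ⟨i, a⟩
    obtain ⟨a, rfl⟩ := GrPiece.cls_surjective F _ a
    exact GrPiece.mk_eq (a := ⟨(r • (1 : A)) * a, hF.mul_mem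
        (Submodule.smul_mem _ _ hF.one_mem) a.2⟩)
      (b := ⟨a * (r • (1 : A)), hF.mul_mem a.2 (Submodule.smul_mem _ _ hF.one_mem)⟩)
      ((zero_add i).trans (add_zero i).symm) (by simp)
  smul_def r := by
    rintro ⟨i, a⟩
    obtain ⟨a, rfl⟩ := GrPiece.cls_surjective F _ a
    exact GrPiece.mk_eq (a := r • a) (b := ⟨(r • (1 : A)) * a, hF.mul_mem
        (Submodule.smul_mem _ _ hF.one_mem) a.2⟩)
      (zero_add i).symm (by simp)

end AssociatedGraded

/-! ### Spans of monomials -/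

section Monomials

variable {κ V A : Type*} [AddCommGroup V] [Module ℂ V] [Ring A] [Algebra ℂ A]

/-- The span of all products `f x₁ ⋯ f xₖ` (`k ≥ 0`), where each `xᵢ` lies in the piece of `V`
of index `jᵢ` and the list of indices `[j₁, …, jₖ]` satisfies `P`. -/
def monomialSpan (f : V →ₗ[ℂ] A) (piece : κ → Submodule ℂ V) (P : List κ → Prop) :
    Submodule ℂ A :=
  Submodule.span ℂ {a | ∃ l : List (κ × V), (∀ q ∈ l, q.2 ∈ piece q.1) ∧
    P (l.map Prod.fst) ∧ a = (l.map fun q => f q.2).prod}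

theorem monomialSpan_mono {f : V →ₗ[ℂ] A} {piece : κ → Submodule ℂ V} {P Q : List κ → Prop}
    (h : ∀ l, P l → Q l) : monomialSpan f piece P ≤ monomialSpan f piece Q := by
  refine Submodule.span_mono ?_
  rintro a ⟨l, h1, h2, h3⟩
  exact ⟨l, h1, h _ h2, h3⟩

theorem one_mem_monomialSpan {f : V →ₗ[ℂ] A} {piece : κ → Submodule ℂ V} {P : List κ → Prop}
    (h : P []) : (1 : A) ∈ monomialSpan f piece P :=
  Submodule.subset_span ⟨[], by simp, h, by simp⟩

theorem mul_mem_monomialSpan {f : V →ₗ[ℂ] A} {piece : κ → Submodule ℂ V}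
    {P Q R : List κ → Prop} (h : ∀ l m, P l → Q m → R (l ++ m)) {a b : A}
    (ha : a ∈ monomialSpan f piece P) (hb : b ∈ monomialSpan f piece Q) :
    a * b ∈ monomialSpan f piece R := by
  have : monomialSpan f piece P * monomialSpan f piece Q ≤ monomialSpan f piece R := by
    rw [monomialSpan, monomialSpan, Submodule.span_mul_span]
    refine Submodule.span_mono ?_
    rintro _ ⟨_, ⟨l, h1, h2, rfl⟩, _, ⟨m, h4, h5, rfl⟩, rfl⟩
    refine ⟨l ++ m, ?_, ?_, ?_⟩
    · intro q hq
      rcases List.mem_append.1 hq with hq | hq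
      · exact h1 q hq
      · exact h4 q hq
    · rw [List.map_append]; exact h _ _ h2 h5
    · simp
  exact this (Submodule.mul_mem_mul ha hb)

theorem map_mem_monomialSpan {f : V →ₗ[ℂ] A} {piece : κ → Submodule ℂ V} {P : List κ → Prop}
    {j : κ} (h : P [j]) {x : V} (hx : x ∈ piece j) : f x ∈ monomialSpan f piece P :=
  Submodule.subset_span ⟨[(j, x)], by simpa using hx, by simpa using h, by simp⟩

end Monomials

/-! ### The symmetric superalgebra of a super vector space -/

/-- The sign `(-1)^(i j)` of the rule of signs. -/
def superSign (i j : ZMod 2) : ℂ := (-1) ^ (i.val * j.val)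

section SuperSym

variable {V : Type*} [AddCommGroup V] [Module ℂ V] (P : ZMod 2 → Submodule ℂ V)

/-- The relations `x y = (-1)^(|x| |y|) y x`. -/
inductive SuperSymRel : TensorAlgebra ℂ V → TensorAlgebra ℂ V → Prop
  | comm {i j : ZMod 2} {x y : V} (hx : x ∈ P i) (hy : y ∈ P j) :
      SuperSymRel (TensorAlgebra.ι ℂ x * TensorAlgebra.ι ℂ y)
        (superSign i j • (TensorAlgebra.ι ℂ y * TensorAlgebra.ι ℂ x))

/-- The symmetric superalgebra `S(V)` of the super vector space `V = P 0 ⊕ P 1`. -/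
abbrev SuperSym : Type _ := RingQuot (SuperSymRel P)

/-- The projection `T(V) → S(V)`. -/
def SuperSym.proj : TensorAlgebra ℂ V →ₐ[ℂ] SuperSym P := RingQuot.mkAlgHom ℂ _

/-- The inclusion `V → S(V)`. -/
def SuperSym.ι : V →ₗ[ℂ] SuperSym P := (SuperSym.proj P).toLinearMap ∘ₗ TensorAlgebra.ι ℂ

/-- The subspace of `S(V)` of elements of parity `i`. -/
def SuperSym.parity (i : ZMod 2) : Submodule ℂ (SuperSym P) :=
  monomialSpan (SuperSym.ι P) P fun js => js.sum = i

theorem SuperSym.ι_mul_ι {i j : ZMod 2} {x y : V} (hx : x ∈ P i) (hy : y ∈ P j) :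
    SuperSym.ι P x * SuperSym.ι P y = superSign i j • (SuperSym.ι P y * SuperSym.ι P x) := by
  have := RingQuot.mkAlgHom_rel ℂ (SuperSymRel.comm (P := P) hx hy)
  simpa [SuperSym.ι, SuperSym.proj] using this

instance : SetLike.GradedMonoid (SuperSym.parity P) where
  one_mem := one_mem_monomialSpan (by simp)
  mul_mem := fun _ _ _ _ ha hb =>
    mul_mem_monomialSpan (fun l m h1 h2 => by rw [List.sum_append, h1, h2]) ha hb

theorem SuperSym.ι_mem_parity {i : ZMod 2} {x : V} (hx : x ∈ P i) :
    SuperSym.ι P x ∈ SuperSym.parity P i := map_mem_monomialSpan (by simp) hx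

variable [DirectSum.Decomposition P]

/-- Auxiliary map: the inclusion of `V` into the direct sum of the two parts of `S(V)`. -/
def SuperSym.gradedι : V →ₗ[ℂ] ⨁ i, SuperSym.parity P i :=
  DirectSum.toModule ℂ (ZMod 2) _
      (fun i => DirectSum.lof ℂ (ZMod 2) (fun i => SuperSym.parity P i) i ∘ₗ
        ((SuperSym.ι P).restrict fun _ hx => SuperSym.ι_mem_parity P hx)) ∘ₗ
    (DirectSum.decomposeLinearEquiv P).toLinearMap

theorem SuperSym.gradedι_of_mem {i : ZMod 2} {x : V} (hx : x ∈ P i) :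
    SuperSym.gradedι P x = DirectSum.of (fun i => SuperSym.parity P i) i
      ⟨SuperSym.ι P x, SuperSym.ι_mem_parity P hx⟩ := by
  simp only [SuperSym.gradedι, LinearMap.comp_apply, LinearEquiv.coe_coe,
    DirectSum.decomposeLinearEquiv_apply, DirectSum.decompose_of_mem P hx]
  rw [← DirectSum.lof_eq_of ℂ, DirectSum.toModule_lof]
  rfl

/-- Auxiliary map: the decomposition of `S(V)` into its two parts. -/
def SuperSym.gradedLift : SuperSym P →ₐ[ℂ] ⨁ i, SuperSym.parity P i :=
  RingQuot.liftAlgHom ℂ ⟨TensorAlgebra.lift ℂ (SuperSym.gradedι P), by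
    rintro _ _ ⟨hx, hy⟩
    rename_i i j x y
    rw [map_mul, map_smul, map_mul, TensorAlgebra.lift_ι_apply, TensorAlgebra.lift_ι_apply,
      SuperSym.gradedι_of_mem P hx, SuperSym.gradedι_of_mem P hy, DirectSum.of_mul_of,
      DirectSum.of_mul_of, ← DirectSum.lof_eq_of ℂ, ← DirectSum.lof_eq_of ℂ,
      ← LinearMap.map_smul, DirectSum.lof_eq_of, DirectSum.lof_eq_of]
    refine DirectSum.of_eq_of_gradedMonoid_eq (Sigma.subtype_ext (add_comm i j) ?_)
    exact SuperSym.ι_mul_ι P hx hy⟩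

theorem SuperSym.gradedLift_ι (x : V) :
    SuperSym.gradedLift P (SuperSym.ι P x) = SuperSym.gradedι P x := by
  simp [SuperSym.gradedLift, SuperSym.ι, SuperSym.proj]

/-- `S(V)` is a superalgebra. -/
instance SuperSym.gradedAlgebra : GradedAlgebra (SuperSym.parity P) :=
  GradedAlgebra.ofAlgHom _ (SuperSym.gradedLift P)
    (by
      apply RingQuot.ringQuot_ext'
      apply TensorAlgebra.hom_ext
      refine LinearMap.ext fun x => ?_
      change DirectSum.coeAlgHom (SuperSym.parity P)
        (SuperSym.gradedLift P (SuperSym.ι P x)) = SuperSym.ι P x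
      rw [SuperSym.gradedLift_ι]
      induction x using DirectSum.Decomposition.inductionOn P with
      | zero => simp
      | homogeneous x =>
        rw [SuperSym.gradedι_of_mem P x.2, DirectSum.coeAlgHom_of]
      | add x y hx hy => rw [map_add, map_add, hx, hy, map_add])
    (by
      rintro i ⟨x, hx⟩
      induction hx using Submodule.span_induction with
      | mem x h =>
        obtain ⟨l, h1, h2, rfl⟩ := h
        dsimp only
        clear * -
        subst h2
        induction l with
        | nil =>
          change SuperSym.gradedLift P 1 = _
          rw [map_one]; rfl
        | cons q l ih =>
          have hq := h1 q (by simp)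
          have hl : ∀ q ∈ l, q.2 ∈ P q.1 := fun q' h' => h1 q' (by simp [h'])
          simp only [List.map_cons, List.prod_cons, map_mul]
          rw [ih hl, SuperSym.gradedLift_ι, SuperSym.gradedι_of_mem P hq, DirectSum.of_mul_of]
          exact DirectSum.of_eq_of_gradedMonoid_eq (Sigma.subtype_ext rfl rfl)
      | zero => rw [map_zero]; exact (map_zero (DirectSum.of _ i)).symm
      | add x y hx hy ihx ihy =>
        rw [map_add, ihx, ihy, ← map_add]; rfl
      | smul c x hx ih =>
        rw [map_smul, ih, ← DirectSum.lof_eq_of ℂ, ← LinearMap.map_smul]; rfl)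

end SuperSym

/-! ### Lie superalgebras -/

/-- A complex Lie superalgebra: a vector space `g = part 0 ⊕ part 1` with an even bilinear
bracket that is super skew-symmetric and satisfies the super Jacobi identity. -/
class LieSuperalgebra (g : Type*) [AddCommGroup g] [Module ℂ g] where
  /-- the even part `part 0` and the odd part `part 1` -/
  part : ZMod 2 → Submodule ℂ g
  isInternal : DirectSum.IsInternal part
  /-- the bracket -/
  br : g →ₗ[ℂ] g →ₗ[ℂ] g
  br_mem : ∀ {i j : ZMod 2} {x y : g}, x ∈ part i → y ∈ part j → br x y ∈ part (i + j)
  br_skew : ∀ {i j : ZMod 2} {x y : g}, x ∈ part i → y ∈ part j →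
    br x y = -(superSign i j • br y x)
  br_jacobi : ∀ {i j : ZMod 2} {x y : g} (z : g), x ∈ part i → y ∈ part j →
    br x (br y z) = br (br x y) z + superSign i j • br y (br x z)

open LieSuperalgebra (part br)

variable {g : Type*} [AddCommGroup g] [Module ℂ g] [LieSuperalgebra g]

theorem univ_zmod_two : (Set.univ : Set (ZMod 2)) = {0, 1} := by
  ext i
  have h : ∀ i : ZMod 2, i = 0 ∨ i = 1 := by decide
  simpa using h i

/-- `N` is a super subspace: it is the sum of its even and odd parts. -/
def IsSuperSubspace (N : Submodule ℂ g) : Prop :=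
  N ≤ (N ⊓ part 0) ⊔ (N ⊓ part 1)

/-- The even and odd parts of a super subspace `N`. -/
def partOn (N : Submodule ℂ g) (i : ZMod 2) : Submodule ℂ N := (part i).comap N.subtype

theorem isCompl_part : IsCompl (part 0 : Submodule ℂ g) (part 1) :=
  LieSuperalgebra.isInternal.isCompl (by decide) univ_zmod_two

theorem exists_even_add_odd (x : g) : ∃ x₀ ∈ part 0, ∃ x₁ ∈ part 1, x₀ + x₁ = x :=
  Submodule.mem_sup.1 ((isCompl_part (g := g)).sup_eq_top ▸ Submodule.mem_top)

theorem IsSuperSubspace.isInternal_partOn {N : Submodule ℂ g} (hN : IsSuperSubspace N) :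
    DirectSum.IsInternal (partOn N) := by
  refine (DirectSum.isInternal_submodule_iff_isCompl (partOn N) (i := 0) (j := 1) (by decide)
    univ_zmod_two).2 (IsCompl.of_eq ?_ ?_)
  · refine (Submodule.eq_bot_iff _).2 fun x hx => Subtype.ext ?_
    exact (Submodule.eq_bot_iff _).1 (isCompl_part (g := g)).inf_eq_bot _ ⟨hx.1, hx.2⟩
  · refine eq_top_iff.2 fun x _ => ?_
    obtain ⟨a, ha, b, hb, hab⟩ := Submodule.mem_sup.1 (hN x.2)
    exact Submodule.mem_sup.2 ⟨⟨a, ha.1⟩, ha.2, ⟨b, hb.1⟩, hb.2, Subtype.ext hab⟩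

/-- The even part of `g` is a reductive Lie algebra: every ideal has a complementary ideal. -/
def EvenPartReductive (g : Type*) [AddCommGroup g] [Module ℂ g] [LieSuperalgebra g] : Prop :=
  ∀ I : Submodule ℂ g, I ≤ part 0 → (∀ x ∈ part (g := g) 0, ∀ y ∈ I, br x y ∈ I) →
    ∃ J : Submodule ℂ g, J ≤ part 0 ∧ (∀ x ∈ part (g := g) 0, ∀ y ∈ J, br x y ∈ J) ∧
      I ⊓ J = ⊥ ∧ I ⊔ J = part 0

/-- A linear functional on the even part of `g`, extended to `g` by zero on the odd part. -/
structure EvenFunctional (g : Type*) [AddCommGroup g] [Module ℂ g] [LieSuperalgebra g] where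
  toLin : g →ₗ[ℂ] ℂ
  map_odd : ∀ x ∈ part (g := g) 1, toLin x = 0

namespace EvenFunctional

/-- The closure of the coadjoint orbit of `χ` contains `0`. The functional is written as a row
vector of values on a basis of `g`; the group is generated by the `exp (ad x)`, `x` even. -/
def IsNilpotent [FiniteDimensional ℂ g] (χ : EvenFunctional g) : Prop :=
  let b := Module.finBasis ℂ g
  (0 : Fin (Module.finrank ℂ g) → ℂ) ∈ closure
    {v | ∃ M ∈ Submonoid.closure
        {M : Matrix (Fin (Module.finrank ℂ g)) (Fin (Module.finrank ℂ g)) ℂ |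
          ∃ x ∈ part (g := g) 0, M = NormedSpace.exp (LinearMap.toMatrix b b (br x))},
      v = Matrix.vecMul (fun i => χ.toLin (b i)) M}

/-- The annihilator `g^χ = {x | χ([x, g]) = 0}`. -/
def annihilator (χ : EvenFunctional g) : Submodule ℂ g :=
  LinearMap.ker ((br (g := g)).compr₂ χ.toLin)

theorem mem_annihilator {χ : EvenFunctional g} {x : g} :
    x ∈ χ.annihilator ↔ ∀ y, χ.toLin (br x y) = 0 := by
  simp [annihilator, LinearMap.ext_iff]

theorem isSuperSubspace_annihilator (χ : EvenFunctional g) :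
    IsSuperSubspace χ.annihilator := by
  intro x hx
  obtain ⟨x₀, h₀, x₁, h₁, rfl⟩ := exists_even_add_odd x
  have key : x₀ ∈ χ.annihilator := by
    refine mem_annihilator.2 fun y => ?_
    obtain ⟨y₀, k₀, y₁, k₁, rfl⟩ := exists_even_add_odd y
    have e1 : χ.toLin (br x₀ y₁) = 0 := χ.map_odd _ (LieSuperalgebra.br_mem h₀ k₁)
    have e2 : χ.toLin (br x₁ y₀) = 0 := χ.map_odd _ (LieSuperalgebra.br_mem h₁ k₀)
    have e3 := mem_annihilator.1 hx y₀
    rw [map_add, LinearMap.add_apply, map_add, e2, add_zero] at e3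
    rw [map_add, map_add, e1, e3, add_zero]
  have key' : x₁ ∈ χ.annihilator := by simpa using Submodule.sub_mem _ hx key
  exact Submodule.add_mem_sup ⟨key, h₀⟩ ⟨key', h₁⟩

instance (χ : EvenFunctional g) : DirectSum.Decomposition (partOn χ.annihilator) :=
  χ.isSuperSubspace_annihilator.isInternal_partOn.chooseDecomposition

/-- The symmetric superalgebra `S(g^χ)`. -/
abbrev SymAnnihilator (χ : EvenFunctional g) : Type _ := SuperSym (partOn χ.annihilator)

end EvenFunctional

/-! ### The universal enveloping superalgebra -/

/-- The relations `x y - (-1)^(|x| |y|) y x = [x, y]`. -/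
inductive EnvRel (g : Type*) [AddCommGroup g] [Module ℂ g] [LieSuperalgebra g] :
    TensorAlgebra ℂ g → TensorAlgebra ℂ g → Prop
  | comm {i j : ZMod 2} {x y : g} (hx : x ∈ part i) (hy : y ∈ part j) :
      EnvRel g (TensorAlgebra.ι ℂ x * TensorAlgebra.ι ℂ y
        - superSign i j • (TensorAlgebra.ι ℂ y * TensorAlgebra.ι ℂ x))
        (TensorAlgebra.ι ℂ (br x y))

/-- The universal enveloping superalgebra `U(g)`. -/
abbrev Env (g : Type*) [AddCommGroup g] [Module ℂ g] [LieSuperalgebra g] : Type _ :=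
  RingQuot (EnvRel g)

/-- The canonical map `g → U(g)`. -/
def Env.ι : g →ₗ[ℂ] Env g :=
  (RingQuot.mkAlgHom ℂ (EnvRel g)).toLinearMap ∘ₗ TensorAlgebra.ι ℂ

/-! ### Good gradings -/

/-- A good `ℤ`-grading of the Lie superalgebra `g` for `χ`. -/
structure GoodGrading (χ : EvenFunctional g) where
  /-- the subspace of degree `j` -/
  gr : ℤ → Submodule ℂ g
  isInternal : DirectSum.IsInternal gr
  isSuperSubspace : ∀ j, IsSuperSubspace (gr j)
  br_mem : ∀ {i j : ℤ} {x y : g}, x ∈ gr i → y ∈ gr j → br x y ∈ gr (i + j)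
  map_eq_zero : ∀ j, j ≠ -2 → ∀ x ∈ gr j, χ.toLin x = 0
  annihilator_le : χ.annihilator ≤ ⨆ j : ℤ, ⨆ _ : 0 ≤ j, gr j

namespace GoodGrading

variable {χ : EvenFunctional g} (G : GoodGrading χ)

/-- `l` is a super subspace of `g₋₁` isotropic for the form `χ([x, y])`. -/
def IsIsotropic (l : Submodule ℂ g) : Prop :=
  l ≤ G.gr (-1) ∧ IsSuperSubspace l ∧ ∀ x ∈ l, ∀ y ∈ l, χ.toLin (br x y) = 0

/-- `l` is a maximal isotropic subspace of `g₋₁`. -/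
def IsMaximalIsotropic (l : Submodule ℂ g) : Prop := Maximal G.IsIsotropic l

/-- `g₋₁ = l ⊕ l'`, and `l'` contains a maximal isotropic subspace. -/
structure IsAdmissibleComplement (l l' : Submodule ℂ g) : Prop where
  isSuperSubspace : IsSuperSubspace l'
  inf_eq_bot : l ⊓ l' = ⊥
  sup_eq : l ⊔ l' = G.gr (-1)
  exists_isotropic : ∃ k ≤ l', G.IsMaximalIsotropic k

/-- `m`, the sum of all `g_j` with `j ≤ -2` and of `l`. -/
def m (l : Submodule ℂ g) : Submodule ℂ g := (⨆ j : ℤ, ⨆ _ : j ≤ -2, G.gr j) ⊔ l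

/-- `p`, the sum of all `g_j` with `j ≥ 0`. -/
def p : Submodule ℂ g := ⨆ j : ℤ, ⨆ _ : 0 ≤ j, G.gr j

/-- The left ideal of `U(g)` generated by all `a - χ(a)`, `a ∈ m`. -/
def I (l : Submodule ℂ g) : Submodule (Env g) (Env g) :=
  Submodule.span (Env g)
    {u | ∃ a ∈ G.m l, u = Env.ι a - algebraMap ℂ (Env g) (χ.toLin a)}

/-- The generalized Whittaker module `Q_χ = U(g) / I_χ`. -/
abbrev Q (l : Submodule ℂ g) : Type _ := Env g ⧸ G.I l

/-- The projection `π : U(g) → Q_χ`. -/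
def π (l : Submodule ℂ g) : Env g →ₗ[Env g] G.Q l := (G.I l).mkQ

/-- The finite `W`-algebra `W_χ`: the opposite of the algebra of `U(g)`-linear endomorphisms
of `Q_χ` (linear in the ordinary sense, without signs). Under `f ↦ f (π 1)` the product becomes
`π(y₁) π(y₂) = π(y₁ y₂)`. -/
def W (l : Submodule ℂ g) : Type _ := (Module.End (Env g) (G.Q l))ᵐᵒᵖ

instance (l : Submodule ℂ g) : Ring (G.W l) :=
  inferInstanceAs (Ring (Module.End (Env g) (G.Q l))ᵐᵒᵖ)

instance (l : Submodule ℂ g) : Algebra ℂ (G.W l) :=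
  inferInstanceAs (Algebra ℂ (Module.End (Env g) (G.Q l))ᵐᵒᵖ)

variable {G} in
/-- The endomorphism of `Q_χ` underlying an element of `W_χ`. -/
def W.toEnd {l : Submodule ℂ g} (f : G.W l) : Module.End (Env g) (G.Q l) := MulOpposite.unop f

/-- The inclusion of `W_χ` into `Q_χ`, sending an endomorphism to its value at `π(1)`; its image
consists of the `π(y)` with `(a - χ(a)) y ∈ I_χ` for all `a ∈ m`. -/
def toQ (l : Submodule ℂ g) : G.W l →ₗ[ℂ] G.Q l where
  toFun f := f.toEnd (G.π l 1)
  map_add' _ _ := rfl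
  map_smul' _ _ := rfl

/-! ### The Kazhdan filtration -/

/-- The Kazhdan degree of a product of homogeneous elements of degrees `j₁, …, jₖ` in the good
grading: the sum of the `jᵢ + 2`. -/
def kazhdanDegree (js : List ℤ) : ℤ := (js.map (· + 2)).sum

/-- The Kazhdan filtration of `U(g)`. -/
def kazhdanU (n : ℤ) : Submodule ℂ (Env g) :=
  monomialSpan Env.ι G.gr fun js => kazhdanDegree js ≤ n

/-- The Kazhdan filtration of `Q_χ = U(g) / I_χ`. -/
def kazhdanQ (l : Submodule ℂ g) (n : ℤ) : Submodule ℂ (G.Q l) :=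
  (G.kazhdanU n).map ((G.π l).restrictScalars ℂ)

/-- The Kazhdan filtration of `W_χ`, induced from `Q_χ`. -/
def kazhdanW (l : Submodule ℂ g) (n : ℤ) : Submodule ℂ (G.W l) :=
  (G.kazhdanQ l n).comap (G.toQ l)

instance (l : Submodule ℂ g) : IsMulFiltration (G.kazhdanW l) where
  mono i j hij := Submodule.comap_mono (Submodule.map_mono
    (monomialSpan_mono fun _ h => le_trans h hij))
  one_mem := ⟨1, one_mem_monomialSpan (by simp [kazhdanDegree]), rfl⟩
  mul_mem := by
    rintro i j a b ⟨u, hu, hu'⟩ ⟨v, hv, hv'⟩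
    change G.π l u = a.toEnd (G.π l 1) at hu'
    change G.π l v = b.toEnd (G.π l 1) at hv'
    refine ⟨u * v, mul_mem_monomialSpan (fun s t h1 h2 => ?_) hu hv, ?_⟩
    · have : kazhdanDegree (s ++ t) = kazhdanDegree s + kazhdanDegree t := by
        simp [kazhdanDegree]
      rw [this]; exact add_le_add h1 h2
    · change G.π l (u * v) = b.toEnd (a.toEnd (G.π l 1))
      have h1 : G.π l u = u • G.π l 1 := by rw [← map_smul, smul_eq_mul, mul_one]
      rw [← hu', h1, map_smul, ← hv', ← map_smul, smul_eq_mul]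

/-- The associated graded algebra `Gr_K W_χ`. -/
abbrev GrW (l : Submodule ℂ g) : Type _ := ⨁ n : ℤ, GrPiece (G.kazhdanW l) n

/-- The elements of `W_χ` of parity `i`, that is those whose image in `Q_χ` is the image of an
element of `U(g)` of parity `i`. -/
def parityW (l : Submodule ℂ g) (i : ZMod 2) : Submodule ℂ (G.W l) :=
  ((monomialSpan (Env.ι (g := g)) part fun js => js.sum = i).map
    ((G.π l).restrictScalars ℂ)).comap (G.toQ l)

/-- The homogeneous elements of Kazhdan degree `n` of `Gr_K W_χ`. -/
def GrW.degree (l : Submodule ℂ g) (n : ℤ) : Submodule ℂ (G.GrW l) :=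
  LinearMap.range (DirectSum.lof ℂ ℤ (GrPiece (G.kazhdanW l)) n)

/-- The elements of `Gr_K W_χ` of parity `i`: sums of classes of elements of parity `i`. -/
def GrW.parity (l : Submodule ℂ g) (i : ZMod 2) : Submodule ℂ (G.GrW l) :=
  ⨆ n : ℤ, ((G.parityW l i).comap (G.kazhdanW l n).subtype).map
    (DirectSum.lof ℂ ℤ (GrPiece (G.kazhdanW l)) n ∘ₗ GrPiece.cls (G.kazhdanW l) n)

/-- The homogeneous elements of `S(g^χ)` of Kazhdan degree `n`. -/
def symDegree (n : ℤ) : Submodule ℂ χ.SymAnnihilator :=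
  monomialSpan (SuperSym.ι _) (fun j => (G.gr j).comap χ.annihilator.subtype)
    fun js => kazhdanDegree js = n

/-- The linear map `φ` preserves Kazhdan degree and parity. -/
def PreservesGradings (l : Submodule ℂ g) (φ : χ.SymAnnihilator →ₗ[ℂ] G.GrW l) : Prop :=
  (∀ n, ∀ s ∈ G.symDegree n, φ s ∈ GrW.degree G l n) ∧
    ∀ i, ∀ s ∈ SuperSym.parity _ i, φ s ∈ GrW.parity G l i

/-! ### Symbols -/

/-- The symmetric superalgebra `S(p ⊕ l')`. -/
abbrev SymPL (l' : Submodule ℂ g) : Type _ := SuperSym (partOn (G.p ⊔ l'))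

/-- The homogeneous components of `p ⊕ l'` in the good grading. -/
def grPL (l' : Submodule ℂ g) (j : ℤ) : Submodule ℂ (G.p ⊔ l' : Submodule ℂ g) :=
  (G.gr j).comap (G.p ⊔ l').subtype

/-- The homogeneous component of weight `w` of `S(p ⊕ l')` in the good grading. -/
def symWeight (l' : Submodule ℂ g) (w : ℤ) : Submodule ℂ (G.SymPL l') :=
  monomialSpan (SuperSym.ι _) (G.grPL l') fun js => js.sum = w

/-- The class of `X` in the piece of degree `n` of `Gr_K Q_χ` corresponds to `s` under the
identification of `Gr_K Q_χ` with `S(p ⊕ l')`: for some tensor `t` over `p ⊕ l'`, homogeneous of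
Kazhdan degree `n`, the image of `t` in `S(p ⊕ l')` is `s`, and the image of `t` in `Q_χ` is `X`
up to terms of smaller Kazhdan degree. -/
def IsSymbol (l l' : Submodule ℂ g) (n : ℤ) (X : G.Q l) (s : G.SymPL l') : Prop :=
  ∃ t ∈ monomialSpan (TensorAlgebra.ι ℂ) (G.grPL l') (fun js => kazhdanDegree js = n),
    SuperSym.proj _ t = s ∧
    X - G.π l (TensorAlgebra.lift ℂ (Env.ι ∘ₗ (G.p ⊔ l').subtype) t) ∈ G.kazhdanQ l (n - 1)

/-- The nonzero element `v` of `S(p ⊕ l')` is the component of highest weight, in the good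
grading, of the symbol `Gr_K X`. As `v ≠ 0` the symbol `s` is nonzero, so that `n` is the Kazhdan
degree of `X`. -/
def HasTopSymbol (l l' : Submodule ℂ g) (X : G.Q l) (v : G.SymPL l') : Prop :=
  ∃ (n w : ℤ) (s : G.SymPL l'), G.IsSymbol l l' n X s ∧ v ≠ 0 ∧ v ∈ G.symWeight l' w ∧
    s - v ∈ ⨆ w' : ℤ, ⨆ _ : w' < w, G.symWeight l' w'

/-- The inclusion of `g^χ` into `S(p ⊕ l')`. -/
def annihilatorToSym (l' : Submodule ℂ g) : χ.annihilator →ₗ[ℂ] G.SymPL l' :=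
  SuperSym.ι _ ∘ₗ Submodule.inclusion (le_trans G.annihilator_le le_sup_left)

end GoodGrading

/-! ### The exterior algebra on one generator -/

/-- The exterior algebra `ℂ[ξ]` on one odd generator, with its even and odd parts. -/
abbrev extParity : ZMod 2 → Submodule ℂ (ExteriorAlgebra ℂ ℂ) :=
  CliffordAlgebra.evenOdd (0 : QuadraticForm ℂ ℂ)

/-- The generator `ξ`. -/
def ξ : ExteriorAlgebra ℂ ℂ := ExteriorAlgebra.ι ℂ 1

/-- The superalgebra `S(g^χ) ⊗ ℂ[ξ]`, with multiplication following the rule of signs. -/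
abbrev SymTensorExt (χ : EvenFunctional g) : Type _ :=
  SuperSym.parity (partOn χ.annihilator) ᵍ⊗[ℂ] extParity

end FinW

end

open scoped DirectSum TensorProduct
noncomputable section
namespace FinW

/-! ### Signs -/

/-! Put V = p ⊕ l'. Then g = V ⊕ m, where m is a subalgebra of which χ is a character, and W_χ is
the space of vectors of Q_χ on which every a in m acts by χ(a). The proof determines the leading
terms of such vectors in S(V). A monomial of S(V) has a Kazhdan degree and a polynomial degree, and
its weight in the good grading is the Kazhdan degree minus twice the polynomial degree. So in a
fixed Kazhdan degree the component of highest weight is the component of lowest polynomial degree.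

The identification of Gr_K Q_χ with S(V) is realised by an action of g on S(V): x acts as
multiplication by its V-component plus χ(x), up to terms at least two Kazhdan degrees lower that do
not raise the polynomial degree. The action is built one polynomial degree at a time. The failure of
the current operators to form a representation satisfies a cyclic identity, and contracting it with
derivations and using Euler's identity yields the next correction
(`Polarization.Good.corr_sub_corr`, `Polarization.Good.defect_eq`, `Polarization.rep_comm`). Acting
on 1 gives the map `symbQ` from Q_χ to S(V), which detects the Kazhdan degree
(`mem_kazhdanQ_of_symbQ`).

For a in m the operator a - χ(a) is, to leading order, the superderivation of S(V) that extends v ↦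
χ([a, v]) (`rep_sub_der`). Hence the leading component of an element of W_χ is killed by all these
derivations and lies in S(N), for N the orthogonal of m in V (`exists_of_invariant`). This N is
contained in the sum of g^χ and the part of l' orthogonal to l (`mem_annihilator_sup_orthIn`). By
maximality of l that part has no nonzero homogeneous null vector, so it is purely odd and at most a
line; comparing dimensions, it is zero if dim (g₋₁)₁ is even and a line ℂθ if it is odd
(`finrank_odd_part`).

Let elements of W_χ be given whose leading terms form a basis of N. Subtracting a combination of
their products raises the polynomial degree of the leading component of an invariant. As V lives in
degrees at least -1, the polynomial degree is at most the Kazhdan degree, so after finitely many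
steps the Kazhdan degree drops; it is never negative. This gives generation and the surjectivity of
S(N) → Gr_K W_χ. The map exists because supercommutators lower the Kazhdan degree by two, and it is
injective because the leading component of a combination of products is the same combination of
monomials. In the odd case π(θ) is itself in W_χ, and S(g^χ ⊕ ℂθ) = S(g^χ) ⊗ ℂ[ξ]
(`exists_equiv_adjoin_odd`). -/

theorem zmod_two_cases (i : ZMod 2) : i = 0 ∨ i = 1 := by
  revert i; decide

@[simp] theorem superSign_zero_left (i : ZMod 2) : superSign 0 i = 1 := by simp [superSign]

@[simp] theorem superSign_zero_right (i : ZMod 2) : superSign i 0 = 1 := by simp [superSign]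

@[simp] theorem superSign_one_one : superSign 1 1 = -1 := by
  simp [superSign, ZMod.val_one]

theorem superSign_comm (i j : ZMod 2) : superSign i j = superSign j i := by
  simp [superSign, mul_comm]

theorem superSign_mul_self (i j : ZMod 2) : superSign i j * superSign i j = 1 := by
  rcases zmod_two_cases i with rfl | rfl <;> rcases zmod_two_cases j with rfl | rfl <;> simp

theorem superSign_add_right (i j k : ZMod 2) :
    superSign i (j + k) = superSign i j * superSign i k := by
  have h : (1 + 1 : ZMod 2) = 0 := by decide
  rcases zmod_two_cases i with rfl | rfl <;> rcases zmod_two_cases j with rfl | rfl <;>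
    rcases zmod_two_cases k with rfl | rfl <;> simp [h]

theorem superSign_add_left (i j k : ZMod 2) :
    superSign (i + j) k = superSign i k * superSign j k := by
  rw [superSign_comm, superSign_add_right, superSign_comm k, superSign_comm k]

/-! ### Maps out of the symmetric superalgebra -/

section Lift

variable {V : Type*} [AddCommGroup V] [Module ℂ V] {P : ZMod 2 → Submodule ℂ V}
  {A : Type*} [Ring A] [Algebra ℂ A]

/-- The universal property of the symmetric superalgebra. -/
def SuperSym.lift (f : V →ₗ[ℂ] A)
    (hf : ∀ i j, ∀ x ∈ P i, ∀ y ∈ P j, f x * f y = superSign i j • (f y * f x)) :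
    SuperSym P →ₐ[ℂ] A :=
  RingQuot.liftAlgHom ℂ ⟨TensorAlgebra.lift ℂ f, by
    rintro _ _ ⟨hx, hy⟩
    simpa using hf _ _ _ hx _ hy⟩

@[simp] theorem SuperSym.lift_ι (f : V →ₗ[ℂ] A) (hf) (x : V) :
    SuperSym.lift (P := P) f hf (SuperSym.ι P x) = f x := by
  simp [SuperSym.lift, SuperSym.ι, SuperSym.proj]

theorem SuperSym.proj_ι (x : V) : SuperSym.proj P (TensorAlgebra.ι ℂ x) = SuperSym.ι P x := rfl

theorem SuperSym.algHom_ext {f h : SuperSym P →ₐ[ℂ] A}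
    (H : ∀ x, f (SuperSym.ι P x) = h (SuperSym.ι P x)) : f = h := by
  apply RingQuot.ringQuot_ext'
  apply TensorAlgebra.hom_ext
  exact LinearMap.ext H

theorem SuperSym.proj_surjective : Function.Surjective (SuperSym.proj P) :=
  RingQuot.mkAlgHom_surjective ℂ _

end Lift

/-! ### Homogeneous bases -/

/-- A finite basis of a super vector space consisting of elements homogeneous for the parity, with
prescribed integral weights. -/
structure HomBasis {V : Type*} [AddCommGroup V] [Module ℂ V] (P : ZMod 2 → Submodule ℂ V) where
  dim : ℕ
  e : Module.Basis (Fin dim) ℂ V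
  par : Fin dim → ZMod 2
  wt : Fin dim → ℤ
  mem_par : ∀ k, e k ∈ P (par k)
  repr_par : ∀ {i x}, x ∈ P i → ∀ k, par k ≠ i → e.repr x k = 0

namespace HomBasis

variable {V : Type*} [AddCommGroup V] [Module ℂ V] {P : ZMod 2 → Submodule ℂ V} (B : HomBasis P)

/-- The bidegree of a monomial: its Kazhdan degree and its polynomial degree. -/
def deg (w : List (Fin B.dim)) : ℤ × ℤ := (w.map fun k => (B.wt k + 2, (1 : ℤ))).sum

/-- The generators of the symmetric superalgebra. -/
def X (k : Fin B.dim) : SuperSym P := SuperSym.ι P (B.e k)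

/-- The monomials in the generators. -/
def mon (w : List (Fin B.dim)) : SuperSym P := (w.map B.X).prod

@[simp] theorem deg_nil : B.deg [] = 0 := rfl
@[simp] theorem deg_cons (k w) : B.deg (k :: w) = (B.wt k + 2, 1) + B.deg w := by simp [deg]
@[simp] theorem mon_nil : B.mon [] = 1 := rfl
@[simp] theorem mon_cons (k w) : B.mon (k :: w) = B.X k * B.mon w := by simp [mon]
theorem mon_append (v w) : B.mon (v ++ w) = B.mon v * B.mon w := by simp [mon]
theorem deg_append (v w) : B.deg (v ++ w) = B.deg v + B.deg w := by simp [deg]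

theorem ι_eq_sum (v : V) : SuperSym.ι P v = ∑ k, B.e.repr v k • B.X k := by
  conv_lhs => rw [← B.e.sum_repr v, map_sum]
  simp only [map_smul, X]

/-- Left multiplication by any tensor preserves the span. Independence of the monomials is not
required: the decomposition into bidegrees comes from the universal property, through `gradeHom`. -/
theorem span_mon : Submodule.span ℂ (Set.range B.mon) = ⊤ := by
  refine eq_top_iff.2 fun f hf => ?_
  clear hf
  obtain ⟨t, rfl⟩ := SuperSym.proj_surjective f
  suffices h : ∀ f ∈ Submodule.span ℂ (Set.range B.mon),
      SuperSym.proj P t * f ∈ Submodule.span ℂ (Set.range B.mon) by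
    simpa using h 1 (Submodule.subset_span ⟨[], rfl⟩)
  induction t using TensorAlgebra.induction with
  | algebraMap r =>
    intro f hf
    rw [AlgHom.commutes, ← Algebra.smul_def]
    exact Submodule.smul_mem _ _ hf
  | ι v =>
    intro f hf
    rw [SuperSym.proj_ι, B.ι_eq_sum, Finset.sum_mul]
    refine Submodule.sum_mem _ fun k _ => ?_
    rw [smul_mul_assoc]
    refine Submodule.smul_mem _ _ ?_
    induction hf using Submodule.span_induction with
    | mem x h => obtain ⟨w, rfl⟩ := h; exact Submodule.subset_span ⟨k :: w, by simp⟩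
    | zero => simp
    | add x y _ _ hx hy => rw [mul_add]; exact Submodule.add_mem _ hx hy
    | smul c x _ hx => rw [mul_smul_comm]; exact Submodule.smul_mem _ _ hx
  | mul a b ha hb => intro f hf; rw [map_mul, mul_assoc]; exact ha _ (hb _ hf)
  | add a b ha hb => intro f hf; rw [map_add, add_mul]; exact Submodule.add_mem _ (ha _ hf) (hb _ hf)

theorem linearMap_ext {M : Type*} [AddCommGroup M] [Module ℂ M] {f h : SuperSym P →ₗ[ℂ] M}
    (H : ∀ w, f (B.mon w) = h (B.mon w)) : f = h :=
  LinearMap.ext_on B.span_mon (by rintro _ ⟨w, rfl⟩; exact H w)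

theorem X_mul_X (k m) : B.X k * B.X m = superSign (B.par k) (B.par m) • (B.X m * B.X k) :=
  SuperSym.ι_mul_ι P (B.mem_par k) (B.mem_par m)

/-! #### Maps defined on a homogeneous basis -/

/-- Maps out of the symmetric superalgebra, defined on a homogeneous basis. -/
def constr {A : Type*} [Ring A] [Algebra ℂ A] (a : Fin B.dim → A)
    (ha : ∀ k m, a k * a m = superSign (B.par k) (B.par m) • (a m * a k)) : SuperSym P →ₐ[ℂ] A :=
  SuperSym.lift (B.e.constr ℂ a) (by
    intro i j x hx y hy
    simp only [Module.Basis.constr_apply_fintype, Module.Basis.equivFun_apply]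
    rw [Finset.sum_mul_sum, Finset.sum_mul_sum, Finset.sum_comm, Finset.smul_sum]
    refine Finset.sum_congr rfl fun m _ => ?_
    rw [Finset.smul_sum]
    refine Finset.sum_congr rfl fun k _ => ?_
    by_cases h1 : B.par k = i
    · by_cases h2 : B.par m = j
      · subst h1 h2
        rw [smul_mul_smul_comm, ha, smul_mul_smul_comm, smul_comm, mul_comm]
      · rw [B.repr_par hy m h2]; simp
    · rw [B.repr_par hx k h1]; simp)

@[simp] theorem constr_X {A : Type*} [Ring A] [Algebra ℂ A] (a : Fin B.dim → A) (ha) (k) :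
    B.constr a ha (B.X k) = a k := by
  simp [constr, X]

theorem constr_mon {A : Type*} [Ring A] [Algebra ℂ A] (a : Fin B.dim → A) (ha) (w) :
    B.constr a ha (B.mon w) = (w.map a).prod := by
  induction w with
  | nil => simp
  | cons k w ih => simp [ih]

/-! #### Bihomogeneous components -/

/-- The homomorphism recording the bidegrees. -/
def gradeHom : SuperSym P →ₐ[ℂ] AddMonoidAlgebra (SuperSym P) (ℤ × ℤ) :=
  B.constr (fun k => AddMonoidAlgebra.single (B.wt k + 2, (1 : ℤ)) (B.X k)) (by
    intro k m
    rw [AddMonoidAlgebra.single_mul_single, AddMonoidAlgebra.single_mul_single, X_mul_X, add_comm,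
      AddMonoidAlgebra.smul_single])

theorem gradeHom_mon (w) : B.gradeHom (B.mon w) = AddMonoidAlgebra.single (B.deg w) (B.mon w) := by
  rw [gradeHom, constr_mon]
  induction w with
  | nil => simp [AddMonoidAlgebra.one_def]
  | cons k w ih => simp [ih, AddMonoidAlgebra.single_mul_single]

/-- The sum of the components with bidegree in `R`. -/
def projOn (R : Set (ℤ × ℤ)) : SuperSym P →ₗ[ℂ] SuperSym P :=
  open Classical in
  (Finsupp.lsum ℂ fun a => if a ∈ R then LinearMap.id else 0) ∘ₗ
    { toFun := fun f => (B.gradeHom f).coeff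
      map_add' := by simp
      map_smul' := by simp }

open Classical in
theorem projOn_mon (R w) : B.projOn R (B.mon w) = if B.deg w ∈ R then B.mon w else 0 := by
  simp only [projOn, LinearMap.comp_apply, LinearMap.coe_mk, AddHom.coe_mk, gradeHom_mon,
    AddMonoidAlgebra.coeff_single, Finsupp.lsum_single]
  split_ifs <;> rfl

/-- The span of the monomials with bidegree in `R`. -/
def reg (R : Set (ℤ × ℤ)) : Submodule ℂ (SuperSym P) :=
  Submodule.span ℂ (B.mon '' {w | B.deg w ∈ R})

theorem mon_mem_reg {R w} (h : B.deg w ∈ R) : B.mon w ∈ B.reg R :=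
  Submodule.subset_span ⟨w, h, rfl⟩

theorem reg_mono {R R' : Set (ℤ × ℤ)} (h : R ⊆ R') : B.reg R ≤ B.reg R' :=
  Submodule.span_mono (Set.image_mono fun _ hw => h hw)

/-- To prove that a linear map sends `reg R` to `M` it suffices to consider monomials. -/
theorem reg_le {R : Set (ℤ × ℤ)} {M : Submodule ℂ (SuperSym P)}
    (h : ∀ w, B.deg w ∈ R → B.mon w ∈ M) : B.reg R ≤ M :=
  Submodule.span_le.2 (by rintro _ ⟨w, hw, rfl⟩; exact h w hw)

theorem projOn_mem (R f) : B.projOn R f ∈ B.reg R := by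
  suffices h : (⊤ : Submodule ℂ (SuperSym P)) ≤ (B.reg R).comap (B.projOn R) from h trivial
  rw [← B.span_mon, Submodule.span_le]
  rintro _ ⟨w, rfl⟩
  change B.projOn R _ ∈ B.reg R
  rw [projOn_mon]
  split_ifs with h
  · exact B.mon_mem_reg h
  · exact Submodule.zero_mem _

theorem projOn_of_mem {R R' f} (hR : R ⊆ R') (hf : f ∈ B.reg R) : B.projOn R' f = f := by
  have : B.reg R ≤ LinearMap.eqLocus (B.projOn R') LinearMap.id := B.reg_le fun w hw => by
    change B.projOn R' _ = _
    rw [projOn_mon, if_pos (hR hw)]; rfl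
  exact this hf

theorem projOn_eq_zero {R R' f} (hR : Disjoint R R') (hf : f ∈ B.reg R) : B.projOn R' f = 0 := by
  have : B.reg R ≤ LinearMap.ker (B.projOn R') := B.reg_le fun w hw => by
    change B.projOn R' _ = _
    rw [projOn_mon, if_neg (Set.disjoint_left.1 hR hw)]
  exact this hf

theorem projOn_projOn (R R' f) : B.projOn R (B.projOn R' f) = B.projOn (R ∩ R') f := by
  have : B.projOn R ∘ₗ B.projOn R' = B.projOn (R ∩ R') := B.linearMap_ext fun w => by
    classical
    simp only [LinearMap.comp_apply, projOn_mon]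
    by_cases h1 : B.deg w ∈ R' <;> by_cases h2 : B.deg w ∈ R <;> simp [h1, h2, projOn_mon]
  exact LinearMap.congr_fun this f

theorem projOn_add_compl (R f) : B.projOn R f + B.projOn Rᶜ f = f := by
  have : B.projOn R + B.projOn Rᶜ = LinearMap.id := B.linearMap_ext fun w => by
    by_cases h : B.deg w ∈ R <;> simp [h, projOn_mon]
  exact LinearMap.congr_fun this f

theorem reg_inf (R R') : B.reg R ⊓ B.reg R' = B.reg (R ∩ R') := by
  refine le_antisymm ?_ (le_inf (B.reg_mono Set.inter_subset_left) (B.reg_mono Set.inter_subset_right))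
  rintro f ⟨h1, h2⟩
  rw [← B.projOn_of_mem subset_rfl h1, ← B.projOn_of_mem subset_rfl h2, projOn_projOn]
  exact B.projOn_mem _ _

theorem reg_empty : B.reg ∅ = ⊥ := by simp [reg]

theorem eq_zero_of_mem_reg_of_disjoint {R R' f} (h : Disjoint R R') (h1 : f ∈ B.reg R)
    (h2 : f ∈ B.reg R') : f = 0 := by
  have : f ∈ B.reg R ⊓ B.reg R' := ⟨h1, h2⟩
  rw [reg_inf, Set.disjoint_iff_inter_eq_empty.1 h, reg_empty] at this
  simpa using this

theorem mul_mem_reg {R R' R'' : Set (ℤ × ℤ)} (h : ∀ a ∈ R, ∀ b ∈ R', a + b ∈ R'') {f f'}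
    (hf : f ∈ B.reg R) (hf' : f' ∈ B.reg R') : f * f' ∈ B.reg R'' := by
  have := Submodule.mul_mem_mul hf hf'
  rw [reg, reg, Submodule.span_mul_span] at this
  refine Submodule.span_mono ?_ this
  rintro _ ⟨_, ⟨v, hv, rfl⟩, _, ⟨w, hw, rfl⟩, rfl⟩
  exact ⟨v ++ w, by simpa [deg_append] using h _ hv _ hw, by simp [mon_append]⟩

theorem one_mem_reg {R : Set (ℤ × ℤ)} (h : 0 ∈ R) : (1 : SuperSym P) ∈ B.reg R :=
  B.mon_mem_reg (w := []) h

/-- The vectors of weight `j`. -/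
def gr (j : ℤ) : Submodule ℂ V where
  carrier := {v | ∀ k, B.wt k ≠ j → B.e.repr v k = 0}
  add_mem' := by intro a b ha hb k hk; simp [ha k hk, hb k hk]
  zero_mem' := by simp
  smul_mem' := by intro c a ha k hk; simp [ha k hk]

theorem e_mem_gr (k) : B.e k ∈ B.gr (B.wt k) := by
  intro m hm
  rw [Module.Basis.repr_self, Finsupp.single_apply, if_neg]
  rintro rfl; exact hm rfl

theorem ι_mem_reg {R : Set (ℤ × ℤ)} {j : ℤ} (h : (j + 2, 1) ∈ R) {v} (hv : v ∈ B.gr j) :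
    SuperSym.ι P v ∈ B.reg R := by
  rw [B.ι_eq_sum]
  refine Submodule.sum_mem _ fun k _ => ?_
  by_cases hk : B.wt k = j
  · refine Submodule.smul_mem _ _ ?_
    have := B.mon_mem_reg (R := R) (w := [k]) (by simpa [hk] using h)
    simpa using this
  · rw [hv k hk, zero_smul]; exact zero_mem _

theorem deg_snd_nonneg (w) : 0 ≤ (B.deg w).2 := by
  induction w with
  | nil => simp
  | cons k w ih => simp; omega

theorem deg_snd (w) : (B.deg w).2 = w.length := by
  induction w with
  | nil => simp
  | cons k w ih => simp [ih]; ring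

end HomBasis

end FinW
end

open scoped DirectSum TensorProduct
noncomputable section
namespace FinW
namespace HomBasis

variable {V : Type*} [AddCommGroup V] [Module ℂ V] {P : ZMod 2 → Submodule ℂ V} (B : HomBasis P)

/-! #### Superderivations -/

/-- `φ` is a functional of parity `p`. -/
def IsOfParity (P : ZMod 2 → Submodule ℂ V) (p : ZMod 2) (φ : V →ₗ[ℂ] ℂ) : Prop :=
  ∀ i, i ≠ p → ∀ x ∈ P i, φ x = 0

variable {B} in
theorem IsOfParity.apply_e {p} {φ : V →ₗ[ℂ] ℂ} (hφ : IsOfParity P p φ) {k} (hk : B.par k ≠ p) :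
    φ (B.e k) = 0 := hφ _ hk _ (B.mem_par k)

/-- Auxiliary homomorphism, whose upper right entry is a superderivation. -/
def derHom {p : ZMod 2} {φ : V →ₗ[ℂ] ℂ} (hφ : IsOfParity P p φ) :
    SuperSym P →ₐ[ℂ] Matrix (Fin 2) (Fin 2) (SuperSym P) :=
  B.constr (fun k => !![superSign p (B.par k) • B.X k, φ (B.e k) • 1; 0, B.X k]) (by
    intro k m
    have h1 := B.X_mul_X k m
    rw [Matrix.mul_fin_two, Matrix.mul_fin_two, Matrix.smul_of]
    congr 1
    ext a b
    -- A term with the factor φ(e k) survives only if e k has parity p, and then the twist by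
    -- `superSign p` cancels the sign of the commutation; likewise for φ(e m).
    have key : superSign p (B.par k) • B.X k * φ (B.e m) • (1 : SuperSym P) +
        φ (B.e k) • (1 : SuperSym P) * B.X m = superSign (B.par k) (B.par m) •
          (superSign p (B.par m) • B.X m * φ (B.e k) • (1 : SuperSym P) +
            φ (B.e m) • (1 : SuperSym P) * B.X k) := by
      simp only [smul_mul_assoc, mul_smul_comm, one_mul, mul_one, smul_add, smul_smul]
      rw [add_comm]
      congr 2
      · by_cases hk : B.par k = p
        · rw [hk, mul_left_comm, superSign_mul_self, mul_one]
        · rw [hφ.apply_e hk]; simp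
      · by_cases hm : B.par m = p
        · rw [hm, superSign_comm, mul_comm]
        · rw [hφ.apply_e hm]; simp
    fin_cases a <;> fin_cases b
    · simp [h1, smul_smul]
      ring_nf
    · simpa using key
    · simp
    · simp [h1])

/-- The superderivation extending the functional `φ` of parity `p`. -/
def der {p : ZMod 2} {φ : V →ₗ[ℂ] ℂ} (hφ : IsOfParity P p φ) : SuperSym P →ₗ[ℂ] SuperSym P where
  toFun f := B.derHom hφ f 0 1
  map_add' := by simp
  map_smul' := by simp

variable {p : ZMod 2} {φ : V →ₗ[ℂ] ℂ} (hφ : IsOfParity P p φ)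

theorem derHom_X (k) : B.derHom hφ (B.X k) =
    !![superSign p (B.par k) • B.X k, φ (B.e k) • 1; 0, B.X k] := by
  simp [derHom]

/-- With the lower right entry equal to the argument itself, multiplication of upper triangular
matrices becomes the Leibniz rule for the upper right entry. -/
theorem derHom_one_one (f) : B.derHom hφ f 1 1 = f := by
  have : (Matrix.entryLinearMap ℂ (SuperSym P) (1 : Fin 2) (1 : Fin 2)) ∘ₗ
      (B.derHom hφ).toLinearMap = LinearMap.id := B.linearMap_ext fun w => by
    induction w with
    | nil => simp
    | cons k w ih =>
      simp only [LinearMap.comp_apply, AlgHom.toLinearMap_apply, Matrix.entryLinearMap_apply,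
        LinearMap.id_apply, mon_cons, map_mul, Matrix.mul_apply, derHom_X] at ih ⊢
      simp [ih]
  exact LinearMap.congr_fun this f

theorem der_one : B.der hφ 1 = 0 := by simp [der]

theorem der_X_mul (k f) :
    B.der hφ (B.X k * f) = φ (B.e k) • f + superSign p (B.par k) • (B.X k * B.der hφ f) := by
  simp only [der, LinearMap.coe_mk, AddHom.coe_mk, map_mul, Matrix.mul_apply, Fin.sum_univ_two,
    derHom_one_one, derHom_X]
  simp [add_comm]

theorem der_ι_mul {i v} (hv : v ∈ P i) (f) :
    B.der hφ (SuperSym.ι P v * f) =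
      φ v • f + superSign p i • (SuperSym.ι P v * B.der hφ f) := by
  rw [B.ι_eq_sum, Finset.sum_mul, map_sum]
  have e1 : φ v = ∑ k, B.e.repr v k • φ (B.e k) := by
    conv_lhs => rw [← B.e.sum_repr v, map_sum]
    simp only [map_smul]
  rw [e1, Finset.sum_smul, Finset.sum_mul, Finset.smul_sum, ← Finset.sum_add_distrib]
  refine Finset.sum_congr rfl fun k _ => ?_
  by_cases hk : B.par k = i
  · rw [smul_mul_assoc, map_smul, der_X_mul, hk, smul_add, smul_assoc, smul_mul_assoc,
      smul_comm (superSign p i)]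
  · rw [B.repr_par hv k hk]; simp

/-- A superderivation is determined by its values on V, so the basis used to construct it is
irrelevant. This allows passing to a basis adapted to a subspace. -/
theorem der_congr (B' : HomBasis P) : B.der hφ = B'.der hφ := B.linearMap_ext fun w => by
  induction w with
  | nil => rw [mon_nil, der_one, der_one]
  | cons k w ih => rw [mon_cons, der_X_mul, ih]; exact (B'.der_ι_mul hφ (B.mem_par k) _).symm

theorem der_add {ψ : V →ₗ[ℂ] ℂ} (hψ : IsOfParity P p ψ) (h : IsOfParity P p (φ + ψ)) (f) :
    B.der h f = B.der hφ f + B.der hψ f := by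
  have : B.der h = B.der hφ + B.der hψ := B.linearMap_ext fun w => by
    induction w with
    | nil => simp [der_one]
    | cons k w ih =>
      rw [LinearMap.add_apply] at ih ⊢
      rw [mon_cons, der_X_mul, der_X_mul, der_X_mul, ih, LinearMap.add_apply, add_smul, mul_add,
        smul_add]
      abel
  exact LinearMap.congr_fun this f

theorem der_smul (c : ℂ) (h : IsOfParity P p (c • φ)) (f) : B.der h f = c • B.der hφ f := by
  have : B.der h = c • B.der hφ := B.linearMap_ext fun w => by
    induction w with
    | nil => simp [der_one]
    | cons k w ih =>
      rw [LinearMap.smul_apply] at ih ⊢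
      rw [mon_cons, der_X_mul, der_X_mul, ih, LinearMap.smul_apply, smul_add, mul_smul_comm,
        smul_assoc,
        smul_comm c (φ (B.e k)), smul_comm c (superSign _ _)]
  exact LinearMap.congr_fun this f

theorem der_zero (h : IsOfParity P p (0 : V →ₗ[ℂ] ℂ)) (f) : B.der h f = 0 := by
  have : B.der h = 0 := B.linearMap_ext fun w => by
    induction w with
    | nil => simp [der_one]
    | cons k w ih => rw [mon_cons, der_X_mul, ih]; simp
  exact LinearMap.congr_fun this f

/-- A functional supported in weight j strips off one factor of that weight, so it shifts every
bidegree by -(j + 2, 1). -/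
theorem der_mem_reg {j : ℤ} (hj : ∀ k, B.wt k ≠ j → φ (B.e k) = 0) {R R' : Set (ℤ × ℤ)}
    (hR : ∀ a ∈ R, a - (j + 2, 1) ∈ R') {f} (hf : f ∈ B.reg R) : B.der hφ f ∈ B.reg R' := by
  have : B.reg R ≤ (B.reg R').comap (B.der hφ) := B.reg_le fun w hw => by
    suffices h : B.der hφ (B.mon w) ∈ B.reg {B.deg w - (j + 2, 1)} from
      B.reg_mono (Set.singleton_subset_iff.2 (hR _ hw)) h
    clear hR hw
    induction w with
    | nil => rw [mon_nil, der_one]; exact Submodule.zero_mem _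
    | cons k w ih =>
      rw [mon_cons, der_X_mul]
      refine Submodule.add_mem _ ?_ (Submodule.smul_mem _ _ ?_)
      · by_cases hk : B.wt k = j
        · have h2 : B.deg w = B.deg (k :: w) - (j + 2, 1) := by
            rw [deg_cons, hk, add_sub_cancel_left]
          rw [← h2]
          have h3 : B.mon w ∈ B.reg {B.deg w} := B.mon_mem_reg (Set.mem_singleton _)
          exact Submodule.smul_mem _ _ h3
        · rw [hj k hk, zero_smul]; exact Submodule.zero_mem _
      · have h1 : B.X k ∈ B.reg {(B.wt k + 2, 1)} := 
          B.ι_mem_reg (Set.mem_singleton _) (B.e_mem_gr k)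
        refine B.mul_mem_reg ?_ h1 ih
        intro a ha b hb
        rw [Set.mem_singleton_iff] at ha hb ⊢
        rw [ha, hb, deg_cons, add_sub_assoc]
  exact this hf

/-- The coordinate functionals are homogeneous. -/
theorem isOfParity_coord (k) : IsOfParity P (B.par k) (B.e.coord k) := by
  intro i hi x hx
  exact B.repr_par hx k (Ne.symm hi)

/-- The superderivation dual to the basis vector `e k`. -/
def d (k : Fin B.dim) : SuperSym P →ₗ[ℂ] SuperSym P := B.der (B.isOfParity_coord k)

theorem d_ι_mul (k) {i v} (hv : v ∈ P i) (f) : B.d k (SuperSym.ι P v * f) =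
    B.e.repr v k • f + superSign (B.par k) i • (SuperSym.ι P v * B.d k f) :=
  B.der_ι_mul _ hv f

theorem d_one (k) : B.d k 1 = 0 := B.der_one _

theorem d_mem_reg (k) {R R' : Set (ℤ × ℤ)}
    (hR : ∀ a ∈ R, a - (B.wt k + 2, 1) ∈ R') {f} (hf : f ∈ B.reg R) : B.d k f ∈ B.reg R' := by
  refine B.der_mem_reg _ ?_ hR hf
  intro m hm
  rw [Module.Basis.coord_apply, Module.Basis.repr_self, Finsupp.single_apply, if_neg]
  rintro rfl; exact hm rfl

/-- Euler's identity. -/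
theorem sum_X_mul_d_mon (c : Fin B.dim → ℂ) (w) :
    ∑ k, c k • (B.X k * B.d k (B.mon w)) = (w.map c).sum • B.mon w := by
  induction w with
  | nil => simp [d_one]
  | cons m w ih =>
    have h : ∀ k, c k • (B.X k * B.d k (B.mon (m :: w))) =
        (if m = k then c k else 0) • B.mon (m :: w) +
          B.X m * (c k • (B.X k * B.d k (B.mon w))) := by
      intro k
      rw [mon_cons]
      have := B.d_ι_mul k (B.mem_par m) (B.mon w)
      rw [Module.Basis.repr_self, Finsupp.single_apply] at this
      change B.d k (B.X m * _) = _ • _ + _ • (B.X m * _) at this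
      rw [this, mul_add, smul_add]
      congr 1
      · split_ifs with hk
        · rw [hk, one_smul]
        · simp
      -- Moving the derivation past `X m` and moving `X k` past `X m` give the same sign, and the
      -- two cancel.
      · rw [mul_smul_comm, ← mul_assoc, X_mul_X, smul_mul_assoc, smul_smul (superSign _ _),
          superSign_mul_self, one_smul, mul_smul_comm, mul_assoc]
    rw [Finset.sum_congr rfl fun k _ => h k, Finset.sum_add_distrib, ← Finset.sum_smul,
      ← Finset.mul_sum, ih, mul_smul_comm, List.map_cons, List.sum_cons, add_smul, mon_cons]
    simp

theorem sum_X_mul_d {d : ℤ} {f} (hf : f ∈ B.reg {a | a.2 = d}) :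
    ∑ k, B.X k * B.d k f = (d : ℂ) • f := by
  have : B.reg {a | a.2 = d} ≤ LinearMap.eqLocus (∑ k, LinearMap.mulLeft ℂ (B.X k) ∘ₗ B.d k)
      ((d : ℂ) • LinearMap.id) := B.reg_le fun w hw => by
    have := B.sum_X_mul_d_mon (fun _ => 1) w
    simp only [one_smul, List.map_const', List.sum_replicate, nsmul_eq_mul, mul_one] at this
    change (B.deg w).2 = d at hw
    rw [B.deg_snd] at hw
    simp [LinearMap.sum_apply, this, ← hw]
  simpa [LinearMap.sum_apply] using this hf

end HomBasis
end FinW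
end

open scoped DirectSum TensorProduct
noncomputable section
namespace FinW

open LieSuperalgebra (part br)

theorem superSign_eq (i j : ZMod 2) : superSign i j = 1 ∨ superSign i j = -1 := by
  rcases zmod_two_cases i with rfl | rfl <;> rcases zmod_two_cases j with rfl | rfl <;> simp

/-! ### Parity components -/

section ParityProj

variable {g : Type*} [AddCommGroup g] [Module ℂ g] [LieSuperalgebra g]

/-- The component of parity `i`. -/
def parityProj (i : ZMod 2) : g →ₗ[ℂ] g :=
  letI := (LieSuperalgebra.isInternal (g := g)).chooseDecomposition
  (part i).subtype ∘ₗ DirectSum.component ℂ _ _ i ∘ₗ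
    (DirectSum.decomposeLinearEquiv (part (g := g))).toLinearMap

theorem parityProj_mem (i : ZMod 2) (x : g) : parityProj i x ∈ part i := Subtype.property _

theorem parityProj_of_mem {i : ZMod 2} {x : g} (hx : x ∈ part i) : parityProj i x = x := by
  let := (LieSuperalgebra.isInternal (g := g)).chooseDecomposition
  exact DirectSum.decompose_of_mem_same _ hx

theorem parityProj_of_mem_ne {i j : ZMod 2} (h : i ≠ j) {x : g} (hx : x ∈ part i) :
    parityProj j x = 0 := by
  let := (LieSuperalgebra.isInternal (g := g)).chooseDecomposition
  exact DirectSum.decompose_of_mem_ne _ hx h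

theorem parityProj_add (x : g) : parityProj 0 x + parityProj 1 x = x := by
  obtain ⟨a, ha, b, hb, rfl⟩ := exists_even_add_odd x
  rw [map_add, map_add, parityProj_of_mem ha, parityProj_of_mem hb,
    parityProj_of_mem_ne (by decide) ha, parityProj_of_mem_ne (by decide) hb]
  abel

theorem IsSuperSubspace.parityProj_mem {N : Submodule ℂ g} (hN : IsSuperSubspace N) (i) {x : g}
    (hx : x ∈ N) : parityProj i x ∈ N := by
  obtain ⟨a, ha, b, hb, rfl⟩ := Submodule.mem_sup.1 (hN hx)
  rcases zmod_two_cases i with rfl | rfl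
  · rw [map_add, parityProj_of_mem ha.2, parityProj_of_mem_ne (by decide) hb.2, add_zero]
    exact ha.1
  · rw [map_add, parityProj_of_mem hb.2, parityProj_of_mem_ne (by decide) ha.2, zero_add]
    exact hb.1

theorem br_skew' {i j : ZMod 2} {x y : g} (hx : x ∈ part i) (hy : y ∈ part j) :
    br x y + superSign i j • br y x = 0 := by
  rw [LieSuperalgebra.br_skew hx hy]; simp

end ParityProj

/-! ### A relative Poincaré–Birkhoff–Witt theorem -/

/-- A graded Lie superalgebra `g` together with a graded projection `q` onto a super vector space
`V`, split by `sec`, whose kernel is a subalgebra, and a functional `χ` of weight `2`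
which is a character of the kernel. -/
structure Polarization (g : Type*) [AddCommGroup g] [Module ℂ g] [LieSuperalgebra g]
    {V : Type*} [AddCommGroup V] [Module ℂ V] {P : ZMod 2 → Submodule ℂ V} (B : HomBasis P) where
  gr : ℤ → Submodule ℂ g
  br_mem_gr : ∀ {i j : ℤ} {x y : g}, x ∈ gr i → y ∈ gr j → br x y ∈ gr (i + j)
  part_le : ∀ i, part i ≤ ⨆ a, part i ⊓ gr a
  q : g →ₗ[ℂ] V
  sec : V →ₗ[ℂ] g
  q_sec : ∀ v, q (sec v) = v
  q_part : ∀ {i x}, x ∈ part i → q x ∈ P i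
  sec_part : ∀ {i v}, v ∈ P i → sec v ∈ part i
  q_gr : ∀ {j x}, x ∈ gr j → q x ∈ B.gr j
  sec_gr : ∀ {j v}, v ∈ B.gr j → sec v ∈ gr j
  χ : g →ₗ[ℂ] ℂ
  χ_odd : ∀ x ∈ part (g := g) 1, χ x = 0
  χ_gr : ∀ j, j ≠ -2 → ∀ x ∈ gr j, χ x = 0
  q_br : ∀ {i j x y}, x ∈ part i → y ∈ part j → q x = 0 → q y = 0 → q (br x y) = 0
  χ_br : ∀ {i j x y}, x ∈ part i → y ∈ part j → q x = 0 → q y = 0 → χ (br x y) = 0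

namespace Polarization

variable {g : Type*} [AddCommGroup g] [Module ℂ g] [LieSuperalgebra g]
  {V : Type*} [AddCommGroup V] [Module ℂ V] {P : ZMod 2 → Submodule ℂ V} {B : HomBasis P}
  (D : Polarization g B)

/-- Multiplication by `q x + χ x`. -/
def tl : g →ₗ[ℂ] Module.End ℂ (SuperSym P) :=
  LinearMap.mul ℂ (SuperSym P) ∘ₗ SuperSym.ι P ∘ₗ D.q + D.χ.smulRight 1

theorem tl_apply (x f) : D.tl x f = SuperSym.ι P (D.q x) * f + D.χ x • f := by
  simp [tl]

theorem χ_sign {i : ZMod 2} {x} (hx : x ∈ part i) (j : ZMod 2) :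
    superSign i j * D.χ x = D.χ x := by
  rcases zmod_two_cases i with rfl | rfl
  · simp
  · simp [D.χ_odd x hx]

/-- These multiplications are the leading terms of the representation to be built. Since they
supercommute, the highest terms of a supercommutator of approximate operators cancel. -/
theorem tl_comm {i j : ZMod 2} {x y} (hx : x ∈ part i) (hy : y ∈ part j) (f) :
    D.tl x (D.tl y f) = superSign i j • D.tl y (D.tl x f) := by
  have h := SuperSym.ι_mul_ι P (D.q_part hx) (D.q_part hy)
  have h1 := D.χ_sign hx j
  have h2 := D.χ_sign hy i
  rw [superSign_comm] at h2
  simp only [tl_apply, mul_add, smul_add, ← mul_assoc, h, smul_mul_assoc, mul_smul_comm, smul_smul,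
    ← mul_assoc, h1, h2]
  rw [mul_comm (D.χ x)]
  abel

theorem tl_mem {j : ℤ} {x} (hx : x ∈ D.gr j) {R R' : Set (ℤ × ℤ)}
    (h1 : ∀ a ∈ R, (j + 2, 1) + a ∈ R') (h2 : j = -2 → R ⊆ R') {f} (hf : f ∈ B.reg R) :
    D.tl x f ∈ B.reg R' := by
  rw [tl_apply]
  refine Submodule.add_mem _ (B.mul_mem_reg (R := {(j + 2, 1)}) ?_
    (B.ι_mem_reg (Set.mem_singleton _) (D.q_gr hx)) hf) ?_
  · intro a ha b hb
    rw [Set.mem_singleton_iff] at ha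
    rw [ha]; exact h1 b hb
  · by_cases hj : j = -2
    · exact Submodule.smul_mem _ _ (B.reg_mono (h2 hj) hf)
    · rw [D.χ_gr j hj x hx, zero_smul]; exact Submodule.zero_mem _

/-- The failure of `ρ` to be a representation, for arguments of parities `i` and `j`. -/
def defect (ρ : g →ₗ[ℂ] Module.End ℂ (SuperSym P)) (i j : ZMod 2) (x y : g) :
    Module.End ℂ (SuperSym P) :=
  ρ x * ρ y - superSign i j • (ρ y * ρ x) - ρ (br x y)

variable (ρ : g →ₗ[ℂ] Module.End ℂ (SuperSym P))

theorem defect_apply (i j : ZMod 2) (x y : g) (f) : defect ρ i j x y f =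
    ρ x (ρ y f) - superSign i j • ρ y (ρ x f) - ρ (br x y) f := rfl

theorem defect_add_left (i j : ZMod 2) (x x' y : g) :
    defect ρ i j (x + x') y = defect ρ i j x y + defect ρ i j x' y := by
  simp only [defect, map_add, add_mul, mul_add, LinearMap.add_apply, smul_add]; abel

theorem defect_add_right (i j : ZMod 2) (x y y' : g) :
    defect ρ i j x (y + y') = defect ρ i j x y + defect ρ i j x y' := by
  simp only [defect, map_add, add_mul, mul_add, smul_add]; abel

theorem defect_smul_left (i j : ZMod 2) (c : ℂ) (x y : g) :
    defect ρ i j (c • x) y = c • defect ρ i j x y := by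
  refine LinearMap.ext fun f => ?_
  simp only [defect_apply, map_smul, LinearMap.smul_apply]
  module

theorem defect_smul_right (i j : ZMod 2) (c : ℂ) (x y : g) :
    defect ρ i j x (c • y) = c • defect ρ i j x y := by
  refine LinearMap.ext fun f => ?_
  simp only [defect_apply, map_smul, LinearMap.smul_apply]
  module

theorem defect_swap {i j : ZMod 2} {x y : g} (hx : x ∈ part i) (hy : y ∈ part j) :
    superSign i j • defect ρ j i y x = -defect ρ i j x y := by
  have h : ρ (br x y) = -(superSign i j • ρ (br y x)) := by
    rw [LieSuperalgebra.br_skew hx hy]; simp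
  refine LinearMap.ext fun f => ?_
  simp only [defect_apply, LinearMap.smul_apply, LinearMap.neg_apply, h, superSign_comm j i]
  linear_combination (norm := module) (-superSign_mul_self i j) • (ρ x (ρ y f)) 

/-- The candidate representation `ρ` is correct on polynomials of degree less than `n`. -/
structure Good (n : ℕ) : Prop where
  comm : ∀ {i j : ZMod 2} {a b : ℤ} {x y}, x ∈ part i → x ∈ D.gr a → y ∈ part j → y ∈ D.gr b →
    ∀ {f}, f ∈ B.reg {c | c.2 < n} → defect ρ i j x y f = 0
  low : ∀ {a : ℤ} {x}, x ∈ D.gr a → ∀ w,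
    ρ x (B.mon w) - D.tl x (B.mon w) ∈ B.reg {c | c.1 ≤ (B.deg w).1 + a ∧ c.2 ≤ (B.deg w).2}
  one : ∀ x, ρ x 1 = D.tl x 1

namespace Good

variable {D ρ} {n : ℕ} (H : D.Good ρ n)
include H

theorem low_mem {a : ℤ} {x} (hx : x ∈ D.gr a) {R R' : Set (ℤ × ℤ)}
    (h : ∀ c ∈ R, ∀ c' : ℤ × ℤ, c'.1 ≤ c.1 + a → c'.2 ≤ c.2 → c' ∈ R') {f} (hf : f ∈ B.reg R) :
    ρ x f - D.tl x f ∈ B.reg R' := by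
  have : B.reg R ≤ (B.reg R').comap (ρ x - D.tl x) := B.reg_le fun w hw =>
    B.reg_mono (fun c hc => h _ hw _ hc.1 hc.2) (H.low hx w)
  exact this hf

theorem mem {a : ℤ} {x} (hx : x ∈ D.gr a) {R R' : Set (ℤ × ℤ)}
    (h : ∀ c ∈ R, ∀ c' : ℤ × ℤ, c'.1 ≤ c.1 + a + 2 → c'.2 ≤ c.2 + 1 → c' ∈ R') {f}
    (hf : f ∈ B.reg R) : ρ x f ∈ B.reg R' := by
  have h1 := H.low_mem hx (R' := R') (fun c hc c' h1 h2 => h c hc c' (by omega) (by omega)) hf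
  have h2 := D.tl_mem hx (R' := R') (fun c hc => h c hc _ (by simp; omega) (by simp; omega))
    (fun e c hc => h c hc c (by omega) (by omega)) hf
  simpa using Submodule.add_mem _ h1 h2

/-- A product of two operators may raise the bidegree by (a + b + 4, 2), but that contribution comes
from the supercommuting leading terms `tl`. What is left has the size of the bracket, (a + b + 2,
1). -/
theorem defect_mem {i j : ZMod 2} {a b : ℤ} {x y} (hx : x ∈ part i) (hxa : x ∈ D.gr a)
    (hy : y ∈ part j) (hyb : y ∈ D.gr b) {R R' : Set (ℤ × ℤ)}
    (h : ∀ c ∈ R, ∀ c' : ℤ × ℤ, c'.1 ≤ c.1 + a + b + 2 → c'.2 ≤ c.2 + 1 → c' ∈ R') {f}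
    (hf : f ∈ B.reg R) : defect ρ i j x y f ∈ B.reg R' := by
  have key : ∀ {i j : ZMod 2} {a b : ℤ} {x y}, x ∈ part i → x ∈ D.gr a →
      y ∈ part j → y ∈ D.gr b →
      (∀ c ∈ R, ∀ c' : ℤ × ℤ, c'.1 ≤ c.1 + a + b + 2 → c'.2 ≤ c.2 + 1 → c' ∈ R') →
      ρ x (ρ y f) - D.tl x (D.tl y f) ∈ B.reg R' := by
    intro i j a b x y hx hxa hy hyb h
    have h1 := H.low_mem hyb (R' := {c' | ∃ c ∈ R, c'.1 ≤ c.1 + b ∧ c'.2 ≤ c.2})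
      (fun c hc c' h1 h2 => ⟨c, hc, h1, h2⟩) hf
    have h2 := H.mem hxa (R' := R') (by
      rintro c ⟨c₀, hc₀, h1, h2⟩ c' h3 h4
      exact h c₀ hc₀ c' (by omega) (by omega)) h1
    have h3 := D.tl_mem hyb (R' := {c' | ∃ c ∈ R, c'.1 ≤ c.1 + b + 2 ∧ c'.2 ≤ c.2 + 1})
      (fun c hc => ⟨c, hc, by simp; omega, by simp; omega⟩)
      (fun e c hc => ⟨c, hc, by omega, by omega⟩) hf
    have h4 := H.low_mem hxa (R' := R') (by
      rintro c ⟨c₀, hc₀, h1, h2⟩ c' h3 h4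
      exact h c₀ hc₀ c' (by omega) (by omega)) h3
    have := Submodule.add_mem _ h2 h4
    rwa [map_sub, sub_add_sub_cancel] at this
  have h1 := key hx hxa hy hyb h
  have h2 := key hy hyb hx hxa fun c hc c' h1 h2 => h c hc c' (by omega) h2
  have h3 := H.mem (D.br_mem_gr hxa hyb) (R' := R')
    (fun c hc c' h1 h2 => h c hc c' (by omega) h2) hf
  have := Submodule.sub_mem _ (Submodule.sub_mem _ h1
    (Submodule.smul_mem _ (superSign i j) h2)) h3
  rw [D.tl_comm hx hy] at this
  rw [defect_apply]
  convert this using 1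
  module

/-- The Jacobi identity holds both for supercommutators of operators and in g, so the cyclic sum of
the supercommutators of defects with the third operator is a sum of defects having a bracket as
argument. Below degree n the defects vanish, and only the terms in which a defect is applied last
remain. -/
theorem cyclic {i j k : ZMod 2} {a b c : ℤ} {x y z} (hx : x ∈ part i) (hxa : x ∈ D.gr a)
    (hy : y ∈ part j) (hyb : y ∈ D.gr b) (hz : z ∈ part k) (hzc : z ∈ D.gr c) {f}
    (hf : f ∈ B.reg {c | c.2 < n}) :
    superSign i k • defect ρ i j x y (ρ z f) + superSign i j • defect ρ j k y z (ρ x f) +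
      superSign j k • defect ρ k i z x (ρ y f) = 0 := by
  have e1 := H.comm hx hxa hy hyb hf
  have e2 := H.comm hy hyb hz hzc hf
  have e3 := H.comm hz hzc hx hxa hf
  have e4 := H.comm hx hxa (LieSuperalgebra.br_mem hy hz) (D.br_mem_gr hyb hzc) hf
  have e5 := H.comm hy hyb (LieSuperalgebra.br_mem hz hx) (D.br_mem_gr hzc hxa) hf
  have e6 := H.comm hz hzc (LieSuperalgebra.br_mem hx hy) (D.br_mem_gr hxa hyb) hf
  have j1 := congrArg (fun u => ρ u f) (LieSuperalgebra.br_jacobi z hx hy)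
  have j2 := congrArg (fun u => ρ u f) (br_skew' (LieSuperalgebra.br_mem hx hy) hz)
  have j3 := congrArg (fun u => ρ (br y u) f) (br_skew' hx hz)
  simp only [defect_apply] at e1 e2 e3 e4 e5 e6 ⊢
  replace e1 := congrArg (ρ z) e1
  replace e2 := congrArg (ρ x) e2
  replace e3 := congrArg (ρ y) e3
  simp only [map_sub, map_smul, map_add, map_zero, LinearMap.add_apply, LinearMap.smul_apply,
    LinearMap.zero_apply] at e1 e2 e3 j1 j2 j3
  simp only [superSign_add_left, superSign_add_right, superSign_comm k, superSign_comm j i]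
    at e1 e2 e3 e4 e5 e6 j1 j2 j3 ⊢
  have ha := superSign_eq i j
  have hb := superSign_eq j k
  have hc := superSign_eq i k
  generalize superSign i j = s at *
  generalize superSign j k = t at *
  generalize superSign i k = u at *
  -- All signs are products of three independent ones, so the identity is a linear combination of
  -- the relations in each of the eight cases.
  rcases ha with ha | ha <;> rcases hb with hb | hb <;> rcases hc with hc | hc <;>
  linear_combination (norm := (simp only [ha, hb, hc]; module))
    u • e2 + s • e3 + t • e1 + u • e4 + s • e5 + t • e6 + u • j1 + u • j2 + (u * s) • j3

end Good

end Polarization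
end FinW
end

/-! ### The homotopy that inverts the failure to be a representation -/

open scoped DirectSum TensorProduct
noncomputable section
namespace FinW
open LieSuperalgebra (part br)
namespace Polarization

variable {g : Type*} [AddCommGroup g] [Module ℂ g] [LieSuperalgebra g]
  {V : Type*} [AddCommGroup V] [Module ℂ V] {P : ZMod 2 → Submodule ℂ V} {B : HomBasis P}
  (D : Polarization g B) (ρ : g →ₗ[ℂ] Module.End ℂ (SuperSym P))

/-- The contraction of the defect with the superderivations of the symmetric superalgebra. -/
def corr (i : ZMod 2) : g →ₗ[ℂ] Module.End ℂ (SuperSym P) where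
  toFun x := ∑ k, defect ρ i (B.par k) x (D.sec (B.e k)) ∘ₗ B.d k
  map_add' x y := by
    simp only [defect_add_left, LinearMap.add_comp, Finset.sum_add_distrib]
  map_smul' c x := by
    simp only [defect_smul_left, LinearMap.smul_comp, RingHom.id_apply, Finset.smul_sum]

theorem corr_apply (i : ZMod 2) (x f) : D.corr ρ i x f =
    ∑ k, defect ρ i (B.par k) x (D.sec (B.e k)) (B.d k f) := by
  simp [corr, LinearMap.sum_apply]

/-- Coordinates of v at basis vectors of the wrong parity vanish, so each term may carry the parity
of its own basis vector. -/
theorem defect_sec {i j : ZMod 2} (x : g) {v : V} (hv : v ∈ P j) (f) :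
    defect ρ i j x (D.sec v) f =
      ∑ k, B.e.repr v k • defect ρ i (B.par k) x (D.sec (B.e k)) f := by
  let L : g →ₗ[ℂ] SuperSym P :=
    { toFun := fun y => defect ρ i j x y f
      map_add' := fun y y' => by rw [defect_add_right]; rfl
      map_smul' := fun c y => by rw [defect_smul_right]; rfl }
  change L (D.sec v) = _
  conv_lhs => rw [← B.e.sum_repr v, map_sum, map_sum]
  refine Finset.sum_congr rfl fun k _ => ?_
  rw [map_smul, map_smul]
  by_cases hk : B.par k = j
  · rw [hk]; rfl
  · rw [B.repr_par hv k hk]; simp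

theorem corr_ι_mul {i j : ZMod 2} (x : g) {v : V} (hv : v ∈ P j) (f) :
    D.corr ρ i x (SuperSym.ι P v * f) = defect ρ i j x (D.sec v) f +
      ∑ k, superSign (B.par k) j •
        defect ρ i (B.par k) x (D.sec (B.e k)) (SuperSym.ι P v * B.d k f) := by
  rw [corr_apply, D.defect_sec ρ x hv, ← Finset.sum_add_distrib]
  refine Finset.sum_congr rfl fun k _ => ?_
  rw [B.d_ι_mul k hv, map_add, map_smul, map_smul]

namespace Good

variable {D ρ} {n : ℕ} (H : D.Good ρ n)
include H

/-- Replacing the innermost `ρ z` by multiplication by `q z` changes the argument by a lower term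
and a multiple of f. Both have polynomial degree less than n, where the defect vanishes. -/
theorem cyclic_ι {i j k : ZMod 2} {a b c : ℤ} {x y z} (hx : x ∈ part i) (hxa : x ∈ D.gr a)
    (hy : y ∈ part j) (hyb : y ∈ D.gr b) (hz : z ∈ part k) (hzc : z ∈ D.gr c) {f}
    (hf : f ∈ B.reg {c | c.2 < n}) :
    superSign i k • defect ρ i j x y (SuperSym.ι P (D.q z) * f) +
      superSign i j • defect ρ j k y z (SuperSym.ι P (D.q x) * f) +
      superSign j k • defect ρ k i z x (SuperSym.ι P (D.q y) * f) = 0 := by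
  have key : ∀ {i j k : ZMod 2} {a b c : ℤ} {x y z}, x ∈ part i → x ∈ D.gr a →
      y ∈ part j → y ∈ D.gr b → z ∈ part k → z ∈ D.gr c →
      defect ρ i j x y (ρ z f) = defect ρ i j x y (SuperSym.ι P (D.q z) * f) := by
    intro i j k a b c x y z hx hxa hy hyb hz hzc
    have h1 := H.comm hx hxa hy hyb
      (H.low_mem hzc (R' := {c | c.2 < n}) (fun c hc c' _ h => lt_of_le_of_lt h hc) hf)
    have h2 := H.comm hx hxa hy hyb hf
    rw [tl_apply, map_sub, map_add, map_smul, h2, smul_zero, add_zero, sub_eq_zero] at h1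
    exact h1
  rw [← key hx hxa hy hyb hz hzc, ← key hy hyb hz hzc hx hxa, ← key hz hzc hx hxa hy hyb]
  exact H.cyclic hx hxa hy hyb hz hzc hf

/-- A Koszul homotopy. The derivatives in `corr` that hit the new factor give the first two defects
on the right. In the other terms the cyclic identity collects everything into the defect of x and y
applied to the sum of the X_k ∂_k f, which is n f by Euler's identity. -/
theorem corr_sub_corr {i j : ZMod 2} {a b : ℤ} {x y} (hx : x ∈ part i) (hxa : x ∈ D.gr a)
    (hy : y ∈ part j) (hyb : y ∈ D.gr b) {f} (hf : f ∈ B.reg {c | c.2 = n}) :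
    D.corr ρ i x (SuperSym.ι P (D.q y) * f) -
      superSign i j • D.corr ρ j y (SuperSym.ι P (D.q x) * f) =
    defect ρ i j x (D.sec (D.q y)) f + defect ρ i j (D.sec (D.q x)) y f +
      (n : ℂ) • defect ρ i j x y f := by
  have e1 : (n : ℂ) • defect ρ i j x y f =
      ∑ k, defect ρ i j x y (B.X k * B.d k f) := by
    rw [← map_sum, B.sum_X_mul_d (d := n) hf, map_smul]; simp
  have e2 : defect ρ i j (D.sec (D.q x)) y f =
      -(superSign i j • defect ρ j i y (D.sec (D.q x)) f) := by
    have := LinearMap.congr_fun (defect_swap ρ (D.sec_part (D.q_part hx)) hy) f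
    rw [LinearMap.smul_apply, LinearMap.neg_apply] at this
    rw [this, neg_neg]
  rw [D.corr_ι_mul ρ x (D.q_part hy), D.corr_ι_mul ρ y (D.q_part hx), e1, e2]
  -- The cyclic identity for x, y and e_k may be applied to ∂_k f, whose degree is n - 1.
  have e3 : ∀ k, superSign (B.par k) j •
        defect ρ i (B.par k) x (D.sec (B.e k)) (SuperSym.ι P (D.q y) * B.d k f) -
      superSign i j • superSign (B.par k) i •
        defect ρ j (B.par k) y (D.sec (B.e k)) (SuperSym.ι P (D.q x) * B.d k f) =
      defect ρ i j x y (B.X k * B.d k f) := by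
    intro k
    have hd : B.d k f ∈ B.reg {c | c.2 < n} := B.d_mem_reg k (by
      intro c hc
      simp only [Set.mem_ofPred_eq, Prod.snd_sub] at hc ⊢
      omega) hf
    have hz := D.sec_part (B.mem_par k)
    have hzc := D.sec_gr (B.e_mem_gr k)
    have h := H.cyclic_ι hx hxa hy hyb hz hzc hd
    have h1 := LinearMap.congr_fun (defect_swap ρ hx hz) (SuperSym.ι P (D.q y) * B.d k f)
    rw [D.q_sec] at h
    rw [LinearMap.smul_apply, LinearMap.neg_apply] at h1
    simp only [superSign_comm (B.par k)] at h h1 ⊢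
    change superSign i (B.par k) • defect ρ i j x y (B.X k * B.d k f) + _ + _ = 0 at h
    have ha := superSign_eq i j
    have hb := superSign_eq j (B.par k)
    have hc := superSign_eq i (B.par k)
    generalize superSign i j = s at *
    generalize superSign j (B.par k) = t at *
    generalize superSign i (B.par k) = u at *
    rcases ha with ha | ha <;> rcases hb with hb | hb <;> rcases hc with hc | hc <;>
    linear_combination (norm := (simp only [ha, hb, hc]; module)) (t * u) • u • h1 - u • h
  rw [← Finset.sum_congr rfl fun k _ => e3 k, Finset.sum_sub_distrib, smul_add, Finset.smul_sum]
  abel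

end Good

end Polarization
end FinW
end

/-! ### Correcting the operators in one more polynomial degree -/

open scoped DirectSum TensorProduct
noncomputable section
namespace FinW
open LieSuperalgebra (part br)
namespace Polarization

variable {g : Type*} [AddCommGroup g] [Module ℂ g] [LieSuperalgebra g]
  {V : Type*} [AddCommGroup V] [Module ℂ V] {P : ZMod 2 → Submodule ℂ V} {B : HomBasis P}
  (D : Polarization g B) (ρ : g →ₗ[ℂ] Module.End ℂ (SuperSym P)) (n : ℕ)

/-- The correction of `ρ` in polynomial degree `n + 1`, for an argument of parity `i`. -/
def corrAt (i : ZMod 2) : g →ₗ[ℂ] Module.End ℂ (SuperSym P) :=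
  -- On polynomials of degree n, `corr_sub_corr` reproduces the defect n + 2 times if both arguments
  -- lie in V and n + 1 times if exactly one does and the other lies in the kernel of q. The two
  -- coefficients undo these multiplicities.
  (n + 2 : ℂ)⁻¹ • (D.corr ρ i ∘ₗ D.sec ∘ₗ D.q) +
    (n + 1 : ℂ)⁻¹ • (D.corr ρ i ∘ₗ (LinearMap.id - D.sec ∘ₗ D.q))

/-- The corrected operators. -/
def step : g →ₗ[ℂ] Module.End ℂ (SuperSym P) where
  toFun x := ρ x - ∑ i, D.corrAt ρ n i (parityProj i x) ∘ₗ B.projOn {c | c.2 = n + 1}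
  map_add' x y := by
    simp only [map_add, LinearMap.add_comp, Finset.sum_add_distrib]
    abel
  map_smul' c x := by
    refine LinearMap.ext fun f => ?_
    simp [LinearMap.sum_apply, smul_sub, Finset.smul_sum]

theorem step_apply {i : ZMod 2} {x} (hx : x ∈ part i) (f) : D.step ρ n x f =
    ρ x f - D.corrAt ρ n i x (B.projOn {c | c.2 = n + 1} f) := by
  have h : ∀ j, j ≠ i → (parityProj j x : g) = 0 := fun j hj =>
    parityProj_of_mem_ne (Ne.symm hj) hx
  change (ρ x - ∑ i, D.corrAt ρ n i (parityProj i x) ∘ₗ B.projOn {c | c.2 = n + 1}) f = _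
  rw [LinearMap.sub_apply, LinearMap.sum_apply, Finset.sum_eq_single i]
  · rw [parityProj_of_mem hx]; rfl
  · intro j _ hj
    simp [h j hj]
  · simp

theorem step_apply_of_lt {f} (hf : f ∈ B.reg {c | c.2 < n + 1}) (x) :
    D.step ρ n x f = ρ x f := by
  have h : B.projOn {c | c.2 = n + 1} f = 0 := B.projOn_eq_zero
    (Set.disjoint_left.2 fun c (h1 : c.2 < n + 1) (h2 : c.2 = n + 1) => by omega) hf
  simp [step, LinearMap.sum_apply, h]

theorem corrAt_apply (i : ZMod 2) (x f) : D.corrAt ρ n i x f =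
    (n + 2 : ℂ)⁻¹ • D.corr ρ i (D.sec (D.q x)) f +
      (n + 1 : ℂ)⁻¹ • D.corr ρ i (x - D.sec (D.q x)) f := rfl

theorem defect_zero_left (i j : ZMod 2) (y : g) : defect ρ i j 0 y = 0 := by
  have := defect_smul_left ρ i j 0 0 y
  rwa [zero_smul, zero_smul] at this

theorem defect_zero_right (i j : ZMod 2) (x : g) : defect ρ i j x 0 = 0 := by
  have := defect_smul_right ρ i j 0 x 0
  rwa [zero_smul, zero_smul] at this

theorem sec_q_part {i : ZMod 2} {x} (hx : x ∈ part i) : D.sec (D.q x) ∈ part i :=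
  D.sec_part (D.q_part hx)

theorem sec_q_gr {j} {x} (hx : x ∈ D.gr j) : D.sec (D.q x) ∈ D.gr j := D.sec_gr (D.q_gr hx)

namespace Good

variable {D ρ n} (H : D.Good ρ n)
include H

/-- The derivation lowers the bidegree by (wt k + 2, 1) and the defect gives at most (a + wt k + 2,
1) back. So a correction does not raise the polynomial degree, and it respects the bound demanded by
`Good.low`. -/
theorem corr_mem {i : ZMod 2} {a : ℤ} {x} (hx : x ∈ part i) (hxa : x ∈ D.gr a)
    {R R' : Set (ℤ × ℤ)}
    (h : ∀ c ∈ R, ∀ c' : ℤ × ℤ, c'.1 ≤ c.1 + a → c'.2 ≤ c.2 → c' ∈ R') {f}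
    (hf : f ∈ B.reg R) : D.corr ρ i x f ∈ B.reg R' := by
  rw [corr_apply]
  refine Submodule.sum_mem _ fun k _ => ?_
  refine H.defect_mem hx hxa (D.sec_part (B.mem_par k)) (D.sec_gr (B.e_mem_gr k)) ?_
    (B.d_mem_reg k (R' := {c | ∃ c' ∈ R, c = c' - (B.wt k + 2, 1)}) (fun c hc => ⟨c, hc, rfl⟩) hf)
  rintro _ ⟨c, hc, rfl⟩ c' h1 h2
  simp only [Prod.fst_sub, Prod.snd_sub] at h1 h2
  exact h c hc c' (by omega) (by omega)

theorem corrAt_mem {i : ZMod 2} {a : ℤ} {x} (hx : x ∈ part i) (hxa : x ∈ D.gr a)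
    {R R' : Set (ℤ × ℤ)}
    (h : ∀ c ∈ R, ∀ c' : ℤ × ℤ, c'.1 ≤ c.1 + a → c'.2 ≤ c.2 → c' ∈ R') {f}
    (hf : f ∈ B.reg R) : D.corrAt ρ n i x f ∈ B.reg R' :=
  Submodule.add_mem _
    (Submodule.smul_mem _ _ (H.corr_mem (D.sec_q_part hx) (D.sec_q_gr hxa) h hf))
    (Submodule.smul_mem _ _ (H.corr_mem (Submodule.sub_mem _ hx (D.sec_q_part hx))
      (Submodule.sub_mem _ hxa (D.sec_q_gr hxa)) h hf))

/-- Both arguments are split along g = V ⊕ ker q and `corr_sub_corr` is used for each pair of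
components. The kernel-kernel part has to vanish by itself, since corrections attached to `q x` and
`q y` cannot affect it. -/
theorem defect_eq {i j : ZMod 2} {a b : ℤ} {x y} (hx : x ∈ part i) (hxa : x ∈ D.gr a)
    (hy : y ∈ part j) (hyb : y ∈ D.gr b) {f} (hf : f ∈ B.reg {c | c.2 = n}) :
    defect ρ i j x y f = D.corrAt ρ n i x (SuperSym.ι P (D.q y) * f) -
      superSign i j • D.corrAt ρ n j y (SuperSym.ι P (D.q x) * f) := by
  have hx' := D.sec_q_part hx
  have hxa' := D.sec_q_gr hxa
  have hy' := D.sec_q_part hy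
  have hyb' := D.sec_q_gr hyb
  have hx'' := Submodule.sub_mem _ hx hx'
  have hxa'' := Submodule.sub_mem _ hxa hxa'
  have hy'' := Submodule.sub_mem _ hy hy'
  have hyb'' := Submodule.sub_mem _ hyb hyb'
  have e1 := H.corr_sub_corr hx' hxa' hy' hyb' hf
  have e2 := H.corr_sub_corr hx'' hxa'' hy' hyb' hf
  have e3 := H.corr_sub_corr hx' hxa' hy'' hyb'' hf
  -- For n = 0 the polynomial is a constant, on which the kernel acts through χ; the defect vanishes
  -- because the kernel is a subalgebra and χ is a character of it.
  have e4 : defect ρ i j (x - D.sec (D.q x)) (y - D.sec (D.q y)) f = 0 := by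
    rcases Nat.eq_zero_or_pos n with rfl | hn
    · have hf1 : ∃ c : ℂ, f = c • 1 := by
        have : B.reg {c | c.2 = ((0 : ℕ) : ℤ)} ≤ Submodule.span ℂ {1} := B.reg_le fun w hw => by
          change (B.deg w).2 = 0 at hw
          rw [B.deg_snd] at hw
          obtain rfl := List.length_eq_zero_iff.1 (Int.ofNat_eq_zero.1 hw)
          exact Submodule.subset_span rfl
        obtain ⟨c, hc⟩ := Submodule.mem_span_singleton.1 (this hf)
        exact ⟨c, hc.symm⟩
      obtain ⟨c, rfl⟩ := hf1
      have hq : ∀ z, D.q (z - D.sec (D.q z)) = 0 := fun z => by rw [map_sub, D.q_sec, sub_self]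
      have h1 := D.q_br hx'' hy'' (hq x) (hq y)
      have h2 := D.χ_br hx'' hy'' (hq x) (hq y)
      have h3 : ∀ z, ρ (z - D.sec (D.q z)) 1 = D.χ (z - D.sec (D.q z)) • 1 := fun z => by
        rw [H.one, tl_apply, hq]; simp
      have h4 := D.χ_sign hx'' j
      rw [map_smul, defect_apply, h3, h3, map_smul, map_smul, h3, h3, H.one, tl_apply, h1, h2,
        map_zero, zero_mul, zero_smul, smul_smul, smul_smul, smul_smul, h4,
        mul_comm (D.χ (y - _))]
      simp
    -- For n > 0 the homotopy has no source terms, as both q-components are zero, so n times the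
    -- defect is zero.
    · have e := H.corr_sub_corr hx'' hxa'' hy'' hyb'' hf
      simp only [map_sub, D.q_sec, sub_self, map_zero, zero_mul, smul_zero] at e
      rw [defect_zero_left, defect_zero_right, LinearMap.zero_apply, zero_add, zero_add] at e
      exact (smul_eq_zero.1 e.symm).resolve_left (by exact_mod_cast hn.ne')
  have ex : x = D.sec (D.q x) + (x - D.sec (D.q x)) := by abel
  have ey : y = D.sec (D.q y) + (y - D.sec (D.q y)) := by abel
  have e5 : defect ρ i j x y f = defect ρ i j (D.sec (D.q x)) (D.sec (D.q y)) f +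
      defect ρ i j (x - D.sec (D.q x)) (D.sec (D.q y)) f +
      defect ρ i j (D.sec (D.q x)) (y - D.sec (D.q y)) f := by
    conv_lhs => rw [ex, ey, defect_add_left, defect_add_right, defect_add_right]
    simp only [LinearMap.add_apply, e4]
    abel
  rw [e5, corrAt_apply, corrAt_apply]
  simp only [map_sub, D.q_sec, sub_self, map_zero, zero_mul, smul_zero, sub_zero, zero_sub]
    at e1 e2 e3
  rw [defect_zero_left, LinearMap.zero_apply, add_zero] at e2
  rw [defect_zero_right, LinearMap.zero_apply, zero_add] at e3
  have h1 : (n + 1 : ℂ)⁻¹ * (n + 1) = 1 := inv_mul_cancel₀ (by exact_mod_cast n.succ_ne_zero)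
  have h2 : (n + 2 : ℂ)⁻¹ * (n + 2) = 1 :=
    inv_mul_cancel₀ (by exact_mod_cast (n + 1).succ_ne_zero)
  simp only [map_sub, LinearMap.sub_apply] at e2 e3 ⊢
  generalize (n + 1 : ℂ)⁻¹ = p at *
  generalize (n + 2 : ℂ)⁻¹ = r at *
  linear_combination (norm := module) (-r) • e1 - p • e2 - p • e3 -
    h2 • defect ρ i j (D.sec (D.q x)) (D.sec (D.q y)) f -
    h1 • defect ρ i j (x - D.sec (D.q x)) (D.sec (D.q y)) f -
    h1 • defect ρ i j (D.sec (D.q x)) (y - D.sec (D.q y)) f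

/-- Only operators on degree n + 1 are changed, so nothing is lost below degree n. On degree n the
outer operator meets a component of degree n + 1, and the correction there cancels the defect by
`defect_eq`. -/
theorem step_good (hgr : ∀ a, IsSuperSubspace (D.gr a)) : D.Good (D.step ρ n) (n + 1) where
  comm := by
    intro i j a b x y hx hxa hy hyb f hf
    have : B.reg {c | c.2 < ((n + 1 : ℕ) : ℤ)} ≤ LinearMap.ker (defect (D.step ρ n) i j x y) :=
      B.reg_le fun w hw => by
        replace hw : (B.deg w).2 < n + 1 := by simpa using hw
        have hw0 : B.mon w ∈ B.reg {c | c.2 < n + 1} := B.mon_mem_reg hw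
        have hw1 : B.mon w ∈ B.reg {c | c.2 = (B.deg w).2} := B.mon_mem_reg rfl
        rw [LinearMap.mem_ker, defect_apply, D.step_apply_of_lt ρ n hw0,
          D.step_apply_of_lt ρ n hw0, D.step_apply_of_lt ρ n hw0, D.step_apply ρ n hx,
          D.step_apply ρ n hy]
        -- The only component of degree n + 1 is the product with `q y`, and it occurs only when the
        -- monomial has degree exactly n; the lower terms and the scalar χ y do not reach it.
        have key : ∀ {b : ℤ} {y}, y ∈ D.gr b → B.projOn {c | c.2 = n + 1} (ρ y (B.mon w)) =
            if (B.deg w).2 = n then SuperSym.ι P (D.q y) * B.mon w else 0 := by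
          intro b y hyb
          have h1 := H.low_mem hyb (R' := {c | c.2 < n + 1})
            (fun c (hc : c.2 = _) c' _ h => lt_of_le_of_lt h (hc ▸ hw)) hw1
          have h2 : B.projOn {c | c.2 = n + 1} (ρ y (B.mon w)) =
              B.projOn {c | c.2 = n + 1} (D.tl y (B.mon w)) := by
            rw [← sub_eq_zero, ← map_sub]
            exact B.projOn_eq_zero
              (Set.disjoint_left.2 fun c (h1 : c.2 < n + 1) (h2 : c.2 = n + 1) => by omega) h1
          have h3 : B.projOn {c | c.2 = n + 1} (B.mon w) = 0 := B.projOn_eq_zero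
            (Set.disjoint_left.2 fun c (h1 : c.2 < n + 1) (h2 : c.2 = n + 1) => by omega) hw0
          have h4 : SuperSym.ι P (D.q y) * B.mon w ∈ B.reg {c | c.2 = (B.deg w).2 + 1} :=
            B.mul_mem_reg (R := {(b + 2, 1)}) (fun c hc c' (hc' : c'.2 = _) => by
              rw [Set.mem_singleton_iff.1 hc]
              change 1 + c'.2 = _
              omega) (B.ι_mem_reg (Set.mem_singleton _) (D.q_gr hyb)) hw1
          rw [h2, tl_apply, map_add, map_smul, h3, smul_zero, add_zero]
          split_ifs with hn
          · exact B.projOn_of_mem (fun c (hc : c.2 = _) => by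
              change c.2 = _
              omega) h4
          · exact B.projOn_eq_zero (Set.disjoint_left.2
              fun c (h1 : c.2 = _) (h2 : c.2 = n + 1) => by omega) h4
        rw [key hxa, key hyb]
        split_ifs with hn
        · have := H.defect_eq hx hxa hy hyb (hn ▸ hw1)
          rw [defect_apply] at this
          linear_combination (norm := module) this
        · rw [map_zero, map_zero, sub_zero, sub_zero]
          exact H.comm hx hxa hy hyb (B.mon_mem_reg (by
            change (B.deg w).2 < n
            omega))
    exact this hf
  low := by
    intro a x hxa w
    have key : ∀ i, D.step ρ n (parityProj i x) (B.mon w) - D.tl (parityProj i x) (B.mon w) ∈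
        B.reg {c | c.1 ≤ (B.deg w).1 + a ∧ c.2 ≤ (B.deg w).2} := by
      intro i
      have hi := parityProj_mem i x
      have hia := (hgr a).parityProj_mem i hxa
      rw [D.step_apply ρ n hi, sub_right_comm]
      refine Submodule.sub_mem _ (H.low hia w) ?_
      rw [HomBasis.projOn_mon]
      split_ifs
      · exact H.corrAt_mem hi hia (R := {B.deg w})
          (fun c hc c' h1 h2 => by
            rw [Set.mem_singleton_iff.1 hc] at h1 h2
            exact ⟨h1, h2⟩) (B.mon_mem_reg (Set.mem_singleton _))
      · rw [map_zero]; exact Submodule.zero_mem _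
    have := Submodule.add_mem _ (key 0) (key 1)
    rwa [sub_add_sub_comm, ← LinearMap.add_apply, ← LinearMap.add_apply, ← map_add, ← map_add,
      parityProj_add] at this
  one := by
    intro x
    rw [D.step_apply_of_lt ρ n (B.one_mem_reg (by change (0 : ℤ) < n + 1; omega)), H.one]

end Good

/-! ### The limit of the corrections: a representation on S(V) -/

theorem tl_good : D.Good D.tl 0 where
  comm := by
    intro i j a b x y _ _ _ _ f hf
    have : f = 0 := by
      have h : B.reg {c | c.2 < ((0 : ℕ) : ℤ)} ≤ ⊥ := B.reg_le fun w hw =>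
        absurd (B.deg_snd_nonneg w) (not_le.2 hw)
      simpa using h hf
    rw [this, map_zero]
  low := by intro a x _ w; rw [sub_self]; exact Submodule.zero_mem _
  one _ := rfl

/-- The successive approximations to the representation. -/
def approx : ℕ → g →ₗ[ℂ] Module.End ℂ (SuperSym P)
  | 0 => D.tl
  | n + 1 => D.step (approx n) n

theorem approx_good (hgr : ∀ a, IsSuperSubspace (D.gr a)) : ∀ n, D.Good (D.approx n) n
  | 0 => D.tl_good
  | n + 1 => (approx_good hgr n).step_good hgr

/-- Passing from stage n to stage n + 1 changes the operators in polynomial degree n + 1 alone, so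
on every polynomial the approximations are eventually constant. -/
theorem approx_eq {m n : ℕ} (hmn : m ≤ n) {f} (hf : f ∈ B.reg {c | c.2 ≤ m}) (x) :
    D.approx n x f = D.approx m x f := by
  induction n, hmn using Nat.le_induction with
  | base => rfl
  | succ n hmn ih =>
    rw [← ih]
    exact D.step_apply_of_lt _ n (B.reg_mono (fun c (hc : c.2 ≤ m) => by
      change c.2 < n + 1
      omega) hf) x

/-- The representation of `g` on the symmetric superalgebra of `V`. -/
def rep : g →ₗ[ℂ] Module.End ℂ (SuperSym P) where
  toFun x := (Finsupp.lsum ℂ fun c : ℤ × ℤ => D.approx c.2.toNat x) ∘ₗ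
    { toFun := fun f => (B.gradeHom f).coeff
      map_add' := by simp
      map_smul' := by simp }
  map_add' x y := B.linearMap_ext fun w => by simp [HomBasis.gradeHom_mon]
  map_smul' c x := B.linearMap_ext fun w => by simp [HomBasis.gradeHom_mon]

theorem rep_mon (x w) : D.rep x (B.mon w) = D.approx w.length x (B.mon w) := by
  simp [rep, HomBasis.gradeHom_mon, HomBasis.deg_snd]

theorem rep_eq (n : ℕ) {f} (hf : f ∈ B.reg {c | c.2 ≤ n}) (x) : D.rep x f = D.approx n x f := by
  have : B.reg {c | c.2 ≤ n} ≤ LinearMap.eqLocus (D.rep x) (D.approx n x) := B.reg_le fun w hw => by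
    change (B.deg w).2 ≤ n at hw
    rw [B.deg_snd] at hw
    change D.rep x _ = _
    rw [rep_mon]
    exact (D.approx_eq (by omega) (B.mon_mem_reg (by
      change (B.deg w).2 ≤ _
      rw [B.deg_snd])) x).symm
  exact this hf

variable (hgr : ∀ a, IsSuperSubspace (D.gr a))
include hgr

theorem rep_low {a : ℤ} {x} (hx : x ∈ D.gr a) {R R' : Set (ℤ × ℤ)}
    (h : ∀ c ∈ R, ∀ c' : ℤ × ℤ, c'.1 ≤ c.1 + a → c'.2 ≤ c.2 → c' ∈ R') {f} (hf : f ∈ B.reg R) :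
    D.rep x f - D.tl x f ∈ B.reg R' := by
  have : B.reg R ≤ (B.reg R').comap (D.rep x - D.tl x) := B.reg_le fun w hw => by
    change D.rep x _ - _ ∈ B.reg R'
    rw [rep_mon]
    exact B.reg_mono (fun c hc => h _ hw _ hc.1 hc.2) ((D.approx_good hgr _).low hx w)
  exact this hf

theorem rep_mem {a : ℤ} {x} (hx : x ∈ D.gr a) {R R' : Set (ℤ × ℤ)}
    (h : ∀ c ∈ R, ∀ c' : ℤ × ℤ, c'.1 ≤ c.1 + a + 2 → c'.2 ≤ c.2 + 1 → c' ∈ R') {f}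
    (hf : f ∈ B.reg R) : D.rep x f ∈ B.reg R' := by
  have h1 := D.rep_low hgr hx (R' := R') (fun c hc c' h1 h2 => h c hc c' (by omega) (by omega)) hf
  have h2 := D.tl_mem hx (R' := R') (fun c hc => h c hc _ (by simp; omega) (by simp; omega))
    (fun e c hc => h c hc c (by omega) (by omega)) hf
  simpa using Submodule.add_mem _ h1 h2

theorem rep_one (x) : D.rep x 1 = D.tl x 1 := by
  have := D.rep_mon x []
  rw [HomBasis.mon_nil] at this
  rw [this]; exact (D.approx_good hgr _).one x

/-- On a monomial of length k one application leads to degree at most k + 1, so stage k + 1 computes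
all terms of the identity, and that stage is correct on degrees below k + 1. Linearity extends the
result from bihomogeneous elements. -/
theorem rep_comm {i j : ZMod 2} {x y} (hx : x ∈ part i) (hy : y ∈ part j) :
    D.rep x * D.rep y - superSign i j • (D.rep y * D.rep x) = D.rep (br x y) := by
  rw [← sub_eq_zero]
  change defect D.rep i j x y = 0
  have key : ∀ a b, ∀ x ∈ part i ⊓ D.gr a, ∀ y ∈ part j ⊓ D.gr b, defect D.rep i j x y = 0 := by
    intro a b x hx y hy
    refine B.linearMap_ext fun w => ?_
    have hw : B.mon w ∈ B.reg {c | c.2 ≤ w.length} := B.mon_mem_reg (by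
      change (B.deg w).2 ≤ _
      rw [B.deg_snd])
    have h1 : ∀ {b} {y}, y ∈ D.gr b →
        D.rep y (B.mon w) ∈ B.reg {c | c.2 ≤ ((w.length + 1 : ℕ) : ℤ)} := fun hy =>
      D.rep_mem hgr hy (fun c (hc : c.2 ≤ _) c' _ h => by
        change c'.2 ≤ _
        push_cast
        omega) hw
    have h2 : ∀ y, D.rep y (B.mon w) = D.approx (w.length + 1) y (B.mon w) := fun y =>
      D.rep_eq _ (B.reg_mono (fun c (hc : c.2 ≤ _) => by
        change c.2 ≤ _
        push_cast
        omega) hw) y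
    have h3 := (D.approx_good hgr (w.length + 1)).comm hx.1 hx.2 hy.1 hy.2
      (B.reg_mono (R' := {c | c.2 < ((w.length + 1 : ℕ) : ℤ)}) (fun c (hc : c.2 ≤ _) => by
        change c.2 < _
        push_cast
        omega) hw)
    rw [defect_apply, D.rep_eq _ (h1 hx.2), D.rep_eq _ (h1 hy.2), h2, h2, h2, LinearMap.zero_apply]
    exact h3
  have h1 : ∀ a, ∀ x ∈ part i ⊓ D.gr a, defect D.rep i j x y = 0 := by
    intro a x hx
    let L : g →ₗ[ℂ] Module.End ℂ (SuperSym P) :=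
      { toFun := defect D.rep i j x
        map_add' := defect_add_right _ _ _ _
        map_smul' := fun c y => defect_smul_right _ _ _ c _ y }
    have : part j ≤ LinearMap.ker L :=
      (D.part_le j).trans (iSup_le fun b y hy => key a b x hx y hy)
    exact this hy
  let L : g →ₗ[ℂ] Module.End ℂ (SuperSym P) :=
    { toFun := fun x => defect D.rep i j x y
      map_add' := fun x x' => defect_add_left _ _ _ x x' y
      map_smul' := fun c x => defect_smul_left _ _ _ c x y }
  have : part i ≤ LinearMap.ker L :=
    (D.part_le i).trans (iSup_le fun a x hx => h1 a x hx)
  exact this hx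

end Polarization
end FinW
end

open scoped DirectSum TensorProduct
noncomputable section
namespace FinW
open LieSuperalgebra (part br)

/-! ### Existence of homogeneous bases -/

/-- The part of x carried by the basis vectors with other labels lies both in `A a` and in the sum
of the other subspaces. -/
theorem repr_eq_zero_of_iSupIndep {ι κ V : Type*} [AddCommGroup V] [Module ℂ V] [Fintype ι]
    (e : Module.Basis ι ℂ V) (lab : ι → κ) {A : κ → Submodule ℂ V} (hA : iSupIndep A)
    (he : ∀ k, e k ∈ A (lab k)) {a : κ} {x : V} (hx : x ∈ A a) {k : ι} (hk : lab k ≠ a) :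
    e.repr x k = 0 := by
  classical
  have e1 : x - ∑ m with lab m = a, e.repr x m • e m = ∑ m with ¬ lab m = a, e.repr x m • e m := by
    rw [sub_eq_iff_eq_add', Finset.sum_filter_add_sum_filter_not, e.sum_repr]
  have h1 : x - ∑ m with lab m = a, e.repr x m • e m ∈ A a := by
    refine Submodule.sub_mem _ hx (Submodule.sum_mem _ fun m hm => Submodule.smul_mem _ _ ?_)
    rw [← (Finset.mem_filter.1 hm).2]
    exact he m
  have h2 : ∑ m with ¬ lab m = a, e.repr x m • e m ∈ ⨆ b, ⨆ (_ : b ≠ a), A b :=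
    Submodule.sum_mem _ fun m hm => Submodule.smul_mem _ _
      (Submodule.mem_iSup_of_mem (lab m) (Submodule.mem_iSup_of_mem (Finset.mem_filter.1 hm).2
        (he m)))
  have h3 : ∑ m with ¬ lab m = a, e.repr x m • e m = 0 :=
    Submodule.disjoint_def.1 (hA a) _ (e1 ▸ h1) h2
  exact linearIndependent_iff'.1 e.linearIndependent _ _ h3 k (Finset.mem_filter.2
    ⟨Finset.mem_univ _, hk⟩)

theorem exists_homBasis {V : Type*} [AddCommGroup V] [Module ℂ V] [FiniteDimensional ℂ V]
    {P : ZMod 2 → Submodule ℂ V} (hP : iSupIndep P) {A : ℤ → Submodule ℂ V} (hA : iSupIndep A)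
    (h : ⊤ ≤ ⨆ j, ⨆ i, A j ⊓ P i) : ∃ B : HomBasis P, ∀ j, B.gr j = A j := by
  classical
  let s : Set V := {v | ∃ j i, v ∈ A j ⊓ P i}
  have hs : ⊤ ≤ Submodule.span ℂ s := h.trans
    (iSup_le fun j => iSup_le fun i v hv => Submodule.subset_span ⟨j, i, hv⟩)
  let b := Module.Basis.ofSpan hs
  have hb : ∀ k, b k ∈ s := fun k => Module.Basis.ofSpan_subset hs ⟨k, rfl⟩
  have : Finite _ := Module.Finite.finite_basis b
  let := Fintype.ofFinite ↑((linearIndepOn_empty ℂ id).extend (Set.empty_subset s))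
  let e := b.reindex (Fintype.equivFin _)
  have he : ∀ k, e k ∈ s := fun k => by rw [Module.Basis.reindex_apply]; exact hb _
  choose wt par hwp using he
  let B : HomBasis P :=
    { dim := _
      e := e
      par := par
      wt := wt
      mem_par := fun k => (hwp k).2
      repr_par := fun hx k hk => repr_eq_zero_of_iSupIndep e par hP (fun k => (hwp k).2) hx hk }
  refine ⟨B, fun j => le_antisymm ?_ ?_⟩
  · intro v hv
    rw [← e.sum_repr v]
    refine Submodule.sum_mem _ fun k _ => ?_
    by_cases hk : wt k = j
    · exact Submodule.smul_mem _ _ (hk ▸ (hwp k).1)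
    · have : e.repr v k = 0 := hv k hk
      rw [this, zero_smul]; exact Submodule.zero_mem _
  · intro v hv k hk
    exact repr_eq_zero_of_iSupIndep e wt hA (fun k => (hwp k).1) hv hk

theorem iSupIndep_comap_subtype {κ V : Type*} [AddCommGroup V] [Module ℂ V] (N : Submodule ℂ V)
    {A : κ → Submodule ℂ V} (hA : iSupIndep A) : iSupIndep fun k => (A k).comap N.subtype := by
  intro k
  refine Submodule.disjoint_def.2 fun x hx hx' => Subtype.ext ?_
  refine Submodule.disjoint_def.1 (hA k) _ hx ?_
  have : (⨆ j, ⨆ (_ : j ≠ k), (A j).comap N.subtype) ≤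
      (⨆ j, ⨆ (_ : j ≠ k), A j).comap N.subtype := iSup_le fun j => iSup_le fun hj =>
    Submodule.comap_mono (le_iSup_of_le j (le_iSup_of_le hj le_rfl))
  exact this hx'

/-! ### Subspaces compatible with the gradings -/

namespace GoodGrading

variable {g : Type*} [AddCommGroup g] [Module ℂ g] [LieSuperalgebra g]
  {χ : EvenFunctional g} (G : GoodGrading χ)

/-- The component of degree `j`. -/
def grProj (j : ℤ) : g →ₗ[ℂ] g :=
  letI := G.isInternal.chooseDecomposition
  (G.gr j).subtype ∘ₗ DirectSum.component ℂ _ _ j ∘ₗ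
    (DirectSum.decomposeLinearEquiv G.gr).toLinearMap

theorem grProj_mem (j : ℤ) (x : g) : G.grProj j x ∈ G.gr j := Subtype.property _

theorem grProj_of_mem {j : ℤ} {x : g} (hx : x ∈ G.gr j) : G.grProj j x = x := by
  let := G.isInternal.chooseDecomposition
  exact DirectSum.decompose_of_mem_same _ hx

theorem grProj_of_mem_ne {i j : ℤ} (h : i ≠ j) {x : g} (hx : x ∈ G.gr i) : G.grProj j x = 0 := by
  let := G.isInternal.chooseDecomposition
  exact DirectSum.decompose_of_mem_ne _ hx h

theorem iSup_gr : ⨆ j, G.gr j = ⊤ := G.isInternal.submodule_iSup_eq_top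

theorem iSupIndep_gr : iSupIndep G.gr := G.isInternal.submodule_iSupIndep

theorem mem_iSup_of_grProj {N : Submodule ℂ g} {x : g} (h : ∀ j, G.grProj j x ∈ N) :
    x ∈ ⨆ j, N ⊓ G.gr j := by
  classical
  let := G.isInternal.chooseDecomposition
  rw [← DirectSum.sum_support_decompose G.gr x]
  exact Submodule.sum_mem _ fun j _ => Submodule.mem_iSup_of_mem j ⟨h j, G.grProj_mem j x⟩

theorem ext_grProj {x y : g} (h : ∀ j, G.grProj j x = G.grProj j y) : x = y := by
  rw [← sub_eq_zero]
  have := G.mem_iSup_of_grProj (N := ⊥) (x := x - y) (fun j => by simp [h j])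
  simpa using this

/-- The subspace `N` is the direct sum of its bihomogeneous components. -/
structure IsBigraded (N : Submodule ℂ g) : Prop where
  grProj_mem : ∀ j, ∀ x ∈ N, G.grProj j x ∈ N
  isSuper : IsSuperSubspace N

variable {G}

theorem IsBigraded.le_iSup {N : Submodule ℂ g} (hN : G.IsBigraded N) :
    N ≤ ⨆ j, ⨆ i, N ⊓ G.gr j ⊓ part i := by
  intro x hx
  have : (⨆ j, N ⊓ G.gr j) ≤ ⨆ j, ⨆ i, N ⊓ G.gr j ⊓ part i := by
    refine iSup_mono fun j y hy => ?_
    rw [← parityProj_add y]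
    exact Submodule.add_mem _
      (Submodule.mem_iSup_of_mem 0 ⟨⟨hN.isSuper.parityProj_mem 0 hy.1,
        (G.isSuperSubspace j).parityProj_mem 0 hy.2⟩, parityProj_mem 0 y⟩)
      (Submodule.mem_iSup_of_mem 1 ⟨⟨hN.isSuper.parityProj_mem 1 hy.1,
        (G.isSuperSubspace j).parityProj_mem 1 hy.2⟩, parityProj_mem 1 y⟩)
  exact this (G.mem_iSup_of_grProj fun j => hN.grProj_mem j x hx)

theorem _root_.FinW.IsSuperSubspace.of_parityProj {N : Submodule ℂ g}
    (h : ∀ x ∈ N, parityProj 0 x ∈ N) : IsSuperSubspace N := by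
  intro x hx
  have h1 : parityProj 1 x ∈ N := by
    have := Submodule.sub_mem _ hx (h x hx)
    rwa [← eq_sub_iff_add_eq'.2 (parityProj_add x)] at this
  rw [← parityProj_add x]
  exact Submodule.add_mem_sup ⟨h x hx, parityProj_mem 0 x⟩ ⟨h1, parityProj_mem 1 x⟩

theorem IsBigraded.of_le_gr {N : Submodule ℂ g} {j : ℤ} (h : N ≤ G.gr j)
    (hN : IsSuperSubspace N) : G.IsBigraded N := by
  refine ⟨fun i x hx => ?_, hN⟩
  by_cases hij : j = i
  · subst hij; rwa [G.grProj_of_mem (h hx)]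
  · rw [G.grProj_of_mem_ne hij (h hx)]; exact Submodule.zero_mem _

theorem isBigraded_gr (j : ℤ) : G.IsBigraded (G.gr j) := .of_le_gr le_rfl (G.isSuperSubspace j)

theorem isBigraded_iSup {κ : Sort*} {N : κ → Submodule ℂ g} (h : ∀ k, G.IsBigraded (N k)) :
    G.IsBigraded (⨆ k, N k) := by
  refine ⟨fun j x hx => ?_, .of_parityProj fun x hx => ?_⟩
  · have : (⨆ k, N k) ≤ (⨆ k, N k).comap (G.grProj j) := iSup_le fun k x hx =>
      Submodule.mem_iSup_of_mem k ((h k).grProj_mem j x hx)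
    exact this hx
  · have : (⨆ k, N k) ≤ (⨆ k, N k).comap (parityProj 0) := iSup_le fun k x hx =>
      Submodule.mem_iSup_of_mem k ((h k).isSuper.parityProj_mem 0 hx)
    exact this hx

theorem IsBigraded.sup {N N' : Submodule ℂ g} (h : G.IsBigraded N) (h' : G.IsBigraded N') :
    G.IsBigraded (N ⊔ N') := by
  rw [sup_eq_iSup]
  exact isBigraded_iSup fun b => by cases b <;> assumption

theorem isBigraded_p : G.IsBigraded G.p :=
  isBigraded_iSup fun j => isBigraded_iSup fun _ => isBigraded_gr j

theorem χ_br_of_ne {i j : ℤ} (hij : i + j ≠ -2) {x y : g} (hx : x ∈ G.gr i) (hy : y ∈ G.gr j) :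
    χ.toLin (br x y) = 0 := G.map_eq_zero _ hij _ (G.br_mem hx hy)

theorem χ_br_grProj_right {j k : ℤ} (hjk : j + k = -2) {x : g} (hx : x ∈ G.gr j) (y : g) :
    χ.toLin (br x y) = χ.toLin (br x (G.grProj k y)) := by
  have : (⨆ i, G.gr i) ≤ LinearMap.eqLocus (χ.toLin ∘ₗ br x)
      (χ.toLin ∘ₗ br x ∘ₗ G.grProj k) := iSup_le fun i y hy => by
    change χ.toLin (br x y) = χ.toLin (br x (G.grProj k y))
    by_cases hik : i = k
    · subst hik; rw [G.grProj_of_mem hy]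
    · rw [G.grProj_of_mem_ne hik hy, map_zero, map_zero]
      exact χ_br_of_ne (by omega) hx hy
  exact this (G.iSup_gr ▸ Submodule.mem_top)

theorem χ_br_grProj_left {j k : ℤ} (hjk : j + k = -2) {y : g} (hy : y ∈ G.gr k) (x : g) :
    χ.toLin (br x y) = χ.toLin (br (G.grProj j x) y) := by
  have : (⨆ i, G.gr i) ≤ LinearMap.eqLocus (χ.toLin ∘ₗ (br (g := g)).flip y)
      (χ.toLin ∘ₗ (br (g := g)).flip y ∘ₗ G.grProj j) := iSup_le fun i x hx => by
    change χ.toLin (br x y) = χ.toLin (br (G.grProj j x) y)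
    by_cases hij : i = j
    · subst hij; rw [G.grProj_of_mem hx]
    · rw [G.grProj_of_mem_ne hij hx, map_zero, LinearMap.zero_apply, map_zero]
      exact χ_br_of_ne (by omega) hx hy
  exact this (G.iSup_gr ▸ Submodule.mem_top)

/-- The form χ([x, y]) pairs degree j only with degree -2 - j, so its radical contains the
homogeneous components of its elements. -/
theorem isBigraded_annihilator : G.IsBigraded χ.annihilator := by
  refine ⟨fun j x hx => EvenFunctional.mem_annihilator.2 fun y => ?_,
    χ.isSuperSubspace_annihilator⟩
  rw [χ_br_grProj_right (k := -2 - j) (by ring) (G.grProj_mem j x),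
    ← χ_br_grProj_left (by ring) (G.grProj_mem _ y)]
  exact EvenFunctional.mem_annihilator.1 hx _

/-! ### The decomposition of `g` into `p ⊕ l'` and `m` -/

section Decomposition

variable {l l' : Submodule ℂ g}

theorem isBigraded_m (hl : G.IsIsotropic l) : G.IsBigraded (G.m l) :=
  (isBigraded_iSup fun j => isBigraded_iSup fun _ => isBigraded_gr j).sup
    (.of_le_gr hl.1 hl.2.1)

theorem IsAdmissibleComplement.le (hl' : G.IsAdmissibleComplement l l') : l' ≤ G.gr (-1) :=
  hl'.sup_eq ▸ le_sup_right

theorem isBigraded_pl (hl' : G.IsAdmissibleComplement l l') : G.IsBigraded (G.p ⊔ l') :=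
  isBigraded_p.sup (.of_le_gr hl'.le hl'.isSuperSubspace)

theorem grProj_p {j : ℤ} (hj : j < 0) {x : g} (hx : x ∈ G.p) : G.grProj j x = 0 := by
  have : G.p ≤ LinearMap.ker (G.grProj j) := iSup_le fun i => iSup_le fun hi x hx =>
    G.grProj_of_mem_ne (by omega) hx
  exact this hx

theorem grProj_le_neg_two {j : ℤ} (hj : -1 ≤ j) {x : g}
    (hx : x ∈ ⨆ j : ℤ, ⨆ _ : j ≤ -2, G.gr j) : G.grProj j x = 0 := by
  have : (⨆ j : ℤ, ⨆ _ : j ≤ -2, G.gr j) ≤ LinearMap.ker (G.grProj j) :=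
    iSup_le fun i => iSup_le fun hi x hx => G.grProj_of_mem_ne (by omega) hx
  exact this hx

theorem grProj_pl (hl' : G.IsAdmissibleComplement l l') {x : g} (hx : x ∈ G.p ⊔ l') :
    G.grProj (-1) x ∈ l' ∧ ∀ j ≤ -2, G.grProj j x = 0 := by
  obtain ⟨a, ha, b, hb, rfl⟩ := Submodule.mem_sup.1 hx
  refine ⟨?_, fun j hj => ?_⟩
  · rw [map_add, grProj_p (by norm_num) ha, zero_add, G.grProj_of_mem (hl'.le hb)]; exact hb
  · rw [map_add, grProj_p (by omega) ha, zero_add, G.grProj_of_mem_ne (by omega) (hl'.le hb)]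

theorem grProj_m (hl : G.IsIsotropic l) {x : g} (hx : x ∈ G.m l) :
    G.grProj (-1) x ∈ l ∧ ∀ j, 0 ≤ j → G.grProj j x = 0 := by
  obtain ⟨a, ha, b, hb, rfl⟩ := Submodule.mem_sup.1 hx
  refine ⟨?_, fun j hj => ?_⟩
  · rw [map_add, grProj_le_neg_two (by norm_num) ha, zero_add, G.grProj_of_mem (hl.1 hb)]
    exact hb
  · rw [map_add, grProj_le_neg_two (by omega) ha, zero_add,
      G.grProj_of_mem_ne (by omega) (hl.1 hb)]

theorem gr_le_p {j : ℤ} (hj : 0 ≤ j) : G.gr j ≤ G.p := le_iSup_of_le j (le_iSup_of_le hj le_rfl)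

theorem gr_le_m (l : Submodule ℂ g) {j : ℤ} (hj : j ≤ -2) : G.gr j ≤ G.m l :=
  le_sup_of_le_left (le_iSup_of_le j (le_iSup_of_le hj le_rfl))

theorem isCompl_pl_m (hl : G.IsIsotropic l) (hl' : G.IsAdmissibleComplement l l') :
    IsCompl (G.p ⊔ l') (G.m l) := by
  refine IsCompl.of_eq ((Submodule.eq_bot_iff _).2 fun x hx => ?_) (eq_top_iff.2 ?_)
  · refine G.ext_grProj fun j => ?_
    rw [map_zero]
    have h1 := grProj_pl hl' hx.1
    have h2 := grProj_m hl hx.2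
    rcases lt_trichotomy j (-1) with hj | rfl | hj
    · exact h1.2 j (by omega)
    · have : G.grProj (-1) x ∈ l ⊓ l' := ⟨h2.1, h1.1⟩
      rw [hl'.inf_eq_bot] at this
      exact this
    · exact h2.2 j (by omega)
  · rw [← G.iSup_gr]
    refine iSup_le fun j => ?_
    rcases lt_trichotomy j (-1) with hj | rfl | hj
    · exact le_sup_of_le_right (gr_le_m l (by omega))
    · rw [← hl'.sup_eq]
      exact sup_le (le_sup_of_le_right le_sup_right) (le_sup_of_le_left le_sup_right)
    · exact le_sup_of_le_left (le_sup_of_le_left (gr_le_p (by omega)))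

end Decomposition

end GoodGrading
end FinW
end

open scoped DirectSum TensorProduct
noncomputable section
namespace FinW
open LieSuperalgebra (part br)

/-! ### The action of `U(g)` on the symmetric superalgebra -/

namespace Polarization

variable {g : Type*} [AddCommGroup g] [Module ℂ g] [LieSuperalgebra g]
  {V : Type*} [AddCommGroup V] [Module ℂ V] {P : ZMod 2 → Submodule ℂ V} {B : HomBasis P}
  (D : Polarization g B) (hgr : ∀ a, IsSuperSubspace (D.gr a))

/-- The action of the enveloping superalgebra on the symmetric superalgebra of `V`. -/
def act : Env g →ₐ[ℂ] Module.End ℂ (SuperSym P) :=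
  RingQuot.liftAlgHom ℂ ⟨TensorAlgebra.lift ℂ D.rep, by
    rintro _ _ ⟨hx, hy⟩
    simpa using D.rep_comm hgr hx hy⟩

theorem act_ι (x) : D.act hgr (Env.ι x) = D.rep x := by
  simp [act, Env.ι]

/-- The value at `1` of the action. -/
def symb : Env g →ₗ[ℂ] SuperSym P :=
  { toFun := fun u => D.act hgr u 1
    map_add' := by simp
    map_smul' := by simp }

theorem symb_mul (u v) : D.symb hgr (u * v) = D.act hgr u (D.symb hgr v) := by
  simp [symb]

theorem symb_one : D.symb hgr 1 = 1 := by simp [symb]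

end Polarization

namespace GoodGrading

variable {g : Type*} [AddCommGroup g] [Module ℂ g] [LieSuperalgebra g]
  {χ : EvenFunctional g} {G : GoodGrading χ} {l l' : Submodule ℂ g}

theorem IsBigraded.exists_homBasis [FiniteDimensional ℂ g] {N : Submodule ℂ g} (hN : G.IsBigraded N) :
    ∃ B : HomBasis (partOn N), ∀ j, B.gr j = (G.gr j).comap N.subtype := by
  refine FinW.exists_homBasis hN.isSuper.isInternal_partOn.submodule_iSupIndep
    (iSupIndep_comap_subtype N G.iSupIndep_gr) ?_
  rintro ⟨x, hx⟩ -
  have h1 : (⨆ j, ⨆ i, N ⊓ G.gr j ⊓ part i) ≤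
      (⨆ j, ⨆ i, (G.gr j).comap N.subtype ⊓ partOn N i).map N.subtype :=
    iSup_le fun j => iSup_le fun i y hy => ⟨⟨y, hy.1.1⟩, Submodule.mem_iSup_of_mem j
      (Submodule.mem_iSup_of_mem i ⟨hy.1.2, hy.2⟩), rfl⟩
  obtain ⟨y, hy, hyx⟩ := h1 (hN.le_iSup hx)
  have : y = ⟨x, hx⟩ := Subtype.ext hyx
  exact this ▸ hy

/-- A homogeneous basis of a bigraded subspace. -/
def IsBigraded.homBasis [FiniteDimensional ℂ g] {N : Submodule ℂ g} (hN : G.IsBigraded N) : HomBasis (partOn N) :=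
  hN.exists_homBasis.choose

theorem IsBigraded.mem_homBasis_gr [FiniteDimensional ℂ g] {N : Submodule ℂ g} (hN : G.IsBigraded N) {j : ℤ} {x : N} :
    x ∈ hN.homBasis.gr j ↔ (x : g) ∈ G.gr j := by
  rw [IsBigraded.homBasis, hN.exists_homBasis.choose_spec]; rfl

/-- A bracket of two elements of m lies in degrees at most -3, where χ is zero, except for brackets
of two elements of l. Those lie in degree -2, which is part of m, and χ kills them because l is
isotropic. -/
theorem br_m_m (hl : G.IsIsotropic l) {x y : g} (hx : x ∈ G.m l) (hy : y ∈ G.m l) :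
    br x y ∈ G.m l ∧ χ.toLin (br x y) = 0 := by
  obtain ⟨x, hxm, b, hb, rfl⟩ := Submodule.mem_sup.1 hx
  obtain ⟨y, hym, c, hc, rfl⟩ := Submodule.mem_sup.1 hy
  have h1 : ∀ j ≤ -3, ∀ z ∈ G.gr j, z ∈ G.m l ⊓ LinearMap.ker χ.toLin := fun j hj z hz =>
    ⟨gr_le_m l (by omega) hz, G.map_eq_zero j (by omega) z hz⟩
  have h2 : ∀ j ≤ -1, ∀ z ∈ G.gr j, br x z ∈ G.m l ⊓ LinearMap.ker χ.toLin := by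
    intro j hj z hz
    have : (⨆ j : ℤ, ⨆ _ : j ≤ -2, G.gr j) ≤
        (G.m l ⊓ LinearMap.ker χ.toLin).comap ((br (g := g)).flip z) :=
      iSup_le fun i => iSup_le fun hi x hx => h1 (i + j) (by omega) _ (G.br_mem hx hz)
    exact this hxm
  have h3 : ∀ j ≤ -1, ∀ z ∈ G.gr j, br z y ∈ G.m l ⊓ LinearMap.ker χ.toLin := by
    intro j hj z hz
    have : (⨆ j : ℤ, ⨆ _ : j ≤ -2, G.gr j) ≤
        (G.m l ⊓ LinearMap.ker χ.toLin).comap (br z) :=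
      iSup_le fun i => iSup_le fun hi y hy => h1 (j + i) (by omega) _ (G.br_mem hz hy)
    exact this hym
  have h4 : br x y ∈ G.m l ⊓ LinearMap.ker χ.toLin := by
    have : (⨆ j : ℤ, ⨆ _ : j ≤ -2, G.gr j) ≤
        (G.m l ⊓ LinearMap.ker χ.toLin).comap (br x) :=
      iSup_le fun i => iSup_le fun hi y hy => h2 i (by omega) y hy
    exact this hym
  have h5 : br b c ∈ G.m l ⊓ LinearMap.ker χ.toLin :=
    ⟨gr_le_m l (by norm_num) (G.br_mem (hl.1 hb) (hl.1 hc)), hl.2.2 b hb c hc⟩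
  rw [map_add (br (x + b)), map_add br, LinearMap.add_apply, LinearMap.add_apply]
  exact Submodule.add_mem (G.m l ⊓ LinearMap.ker χ.toLin)
    (Submodule.add_mem _ h4 (h3 _ le_rfl _ (hl.1 hb)))
    (Submodule.add_mem (G.m l ⊓ LinearMap.ker χ.toLin) (h2 _ le_rfl _ (hl.1 hc)) h5)

variable (hl : G.IsIsotropic l) (hl' : G.IsAdmissibleComplement l l')

/-- The projection onto `p ⊕ l'` along `m`. -/
def projPL : g →ₗ[ℂ] (G.p ⊔ l' : Submodule ℂ g) :=
  Submodule.projectionOnto _ _ (isCompl_pl_m hl hl')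

theorem projPL_coe (x : (G.p ⊔ l' : Submodule ℂ g)) : projPL hl hl' x = x :=
  Submodule.projectionOnto_apply_left _ x

theorem projPL_eq_zero_iff {x : g} : projPL hl hl' x = 0 ↔ x ∈ G.m l :=
  Submodule.projectionOnto_apply_eq_zero_iff _

theorem sub_projPL_mem (x : g) : x - projPL hl hl' x ∈ G.m l := by
  rw [← projPL_eq_zero_iff hl hl', map_sub, projPL_coe, sub_self]

theorem projPL_comm {f : g →ₗ[ℂ] g} (h1 : ∀ x ∈ G.p ⊔ l', f x ∈ G.p ⊔ l')
    (h2 : ∀ x ∈ G.m l, f x ∈ G.m l) (x : g) :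
    (projPL hl hl' (f x) : g) = f (projPL hl hl' x) := by
  have e : f x = f (projPL hl hl' x) + f (x - projPL hl hl' x) := by rw [← map_add]; simp
  have e1 := projPL_coe hl hl' ⟨_, h1 _ (projPL hl hl' x).2⟩
  have e2 := (projPL_eq_zero_iff hl hl').2 (h2 _ (sub_projPL_mem hl hl' x))
  rw [e, map_add, e2, add_zero]
  exact congrArg Subtype.val e1

theorem projPL_part {i : ZMod 2} {x : g} (hx : x ∈ part i) : (projPL hl hl' x : g) ∈ part i := by
  rw [← parityProj_of_mem hx, projPL_comm hl hl'
    (fun x hx => (isBigraded_pl hl').isSuper.parityProj_mem i hx)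
    (fun x hx => (isBigraded_m hl).isSuper.parityProj_mem i hx)]
  exact parityProj_mem _ _

theorem projPL_gr {j : ℤ} {x : g} (hx : x ∈ G.gr j) : (projPL hl hl' x : g) ∈ G.gr j := by
  rw [← G.grProj_of_mem hx, projPL_comm hl hl' ((isBigraded_pl hl').grProj_mem j)
    ((isBigraded_m hl).grProj_mem j)]
  exact G.grProj_mem _ _

theorem part_le_iSup (i : ZMod 2) : (part i : Submodule ℂ g) ≤ ⨆ a, part i ⊓ G.gr a := by
  have h : G.IsBigraded (⊤ : Submodule ℂ g) :=
    ⟨fun _ _ _ => trivial, .of_parityProj fun _ _ => trivial⟩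
  intro x hx
  have h1 : (⨆ j, ⨆ i, ⊤ ⊓ G.gr j ⊓ part i) ≤ (⨆ a, part i ⊓ G.gr a).comap (parityProj i) :=
    iSup_le fun j => iSup_le fun k y hy => Submodule.mem_iSup_of_mem j
      ⟨parityProj_mem i y, (G.isSuperSubspace j).parityProj_mem i hy.1.2⟩
  have := h1 (h.le_iSup (Submodule.mem_top (x := x)))
  rwa [Submodule.mem_comap, parityProj_of_mem hx] at this

/-- The polarization of `g` given by `p ⊕ l'` and `m`. -/
def polarization [FiniteDimensional ℂ g] : Polarization g (isBigraded_pl hl').homBasis where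
  gr := G.gr
  br_mem_gr := G.br_mem
  part_le := part_le_iSup
  q := projPL hl hl'
  sec := Submodule.subtype _
  q_sec := projPL_coe hl hl'
  q_part hx := projPL_part hl hl' hx
  sec_part hv := hv
  q_gr hx := (isBigraded_pl hl').mem_homBasis_gr.2 (projPL_gr hl hl' hx)
  sec_gr hv := (isBigraded_pl hl').mem_homBasis_gr.1 hv
  χ := χ.toLin
  χ_odd := χ.map_odd
  χ_gr := G.map_eq_zero
  q_br _ _ hx hy := (projPL_eq_zero_iff hl hl').2 (br_m_m hl ((projPL_eq_zero_iff hl hl').1 hx)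
    ((projPL_eq_zero_iff hl hl').1 hy)).1
  χ_br _ _ hx hy := (br_m_m hl ((projPL_eq_zero_iff hl hl').1 hx)
    ((projPL_eq_zero_iff hl hl').1 hy)).2

end GoodGrading
end FinW
end

open scoped DirectSum TensorProduct
noncomputable section
namespace FinW
open LieSuperalgebra (part br)

namespace GoodGrading

variable {g : Type*} [AddCommGroup g] [Module ℂ g] [LieSuperalgebra g]
  {χ : EvenFunctional g} (G : GoodGrading χ) {l l' : Submodule ℂ g}

/-! ### The Kazhdan filtration of the enveloping superalgebra -/

@[simp] theorem kazhdanDegree_nil : kazhdanDegree [] = 0 := rfl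

@[simp] theorem kazhdanDegree_cons (j : ℤ) (js : List ℤ) :
    kazhdanDegree (j :: js) = j + 2 + kazhdanDegree js := by simp [kazhdanDegree]

theorem kazhdanDegree_append (js ks : List ℤ) :
    kazhdanDegree (js ++ ks) = kazhdanDegree js + kazhdanDegree ks := by
  simp [kazhdanDegree]

theorem kazhdanU_mono {m n : ℤ} (h : m ≤ n) : G.kazhdanU m ≤ G.kazhdanU n :=
  monomialSpan_mono fun _ h' => h'.trans h

theorem kazhdanU_mul {m n k : ℤ} (h : m + n ≤ k) {u v : Env g} (hu : u ∈ G.kazhdanU m)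
    (hv : v ∈ G.kazhdanU n) : u * v ∈ G.kazhdanU k :=
  mul_mem_monomialSpan (fun s t h1 h2 => by rw [kazhdanDegree_append]; omega) hu hv

theorem ι_mem_kazhdanU {j n : ℤ} (h : j + 2 ≤ n) {x : g} (hx : x ∈ G.gr j) :
    Env.ι x ∈ G.kazhdanU n :=
  map_mem_monomialSpan (by simpa using h) hx

instance : IsMulFiltration G.kazhdanU where
  mono _ _ h := G.kazhdanU_mono h
  one_mem := one_mem_monomialSpan (by simp)
  mul_mem := G.kazhdanU_mul le_rfl

theorem env_ι_mul_ι {i j : ZMod 2} {x y : g} (hx : x ∈ part i) (hy : y ∈ part j) :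
    Env.ι x * Env.ι y - superSign i j • (Env.ι y * Env.ι x) = Env.ι (br x y) := by
  have := RingQuot.mkAlgHom_rel ℂ (EnvRel.comm hx hy)
  simpa [Env.ι] using this

/-- The elements of parity `i` of the `n`-th term of the Kazhdan filtration. -/
def kazhdanUPar (n : ℤ) (i : ZMod 2) : Submodule ℂ (Env g) :=
  monomialSpan Env.ι (fun κ : ℤ × ZMod 2 => G.gr κ.1 ⊓ part κ.2)
    fun js => kazhdanDegree (js.map Prod.fst) ≤ n ∧ (js.map Prod.snd).sum = i

theorem kazhdanUPar_le_kazhdanU (n i) : G.kazhdanUPar n i ≤ G.kazhdanU n := by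
  refine Submodule.span_le.2 ?_
  rintro _ ⟨w, h1, h2, rfl⟩
  refine Submodule.subset_span ⟨w.map fun q => (q.1.1, q.2), ?_, ?_, ?_⟩
  · intro q hq
    obtain ⟨q', hq', rfl⟩ := List.mem_map.1 hq
    exact (h1 q' hq').1
  · simpa [Function.comp_def] using h2.1
  · simp [Function.comp_def]

theorem kazhdanUPar_le_parity (n i) : G.kazhdanUPar n i ≤
    monomialSpan (Env.ι (g := g)) part fun js => js.sum = i := by
  refine Submodule.span_le.2 ?_
  rintro _ ⟨w, h1, h2, rfl⟩
  refine Submodule.subset_span ⟨w.map fun q => (q.1.2, q.2), ?_, ?_, ?_⟩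
  · intro q hq
    obtain ⟨q', hq', rfl⟩ := List.mem_map.1 hq
    exact (h1 q' hq').2
  · simpa [Function.comp_def] using h2.2
  · simp [Function.comp_def]

theorem kazhdanUPar_mul {m n k : ℤ} (h : m + n ≤ k) {i j s : ZMod 2} (hs : i + j = s) {u v : Env g}
    (hu : u ∈ G.kazhdanUPar m i) (hv : v ∈ G.kazhdanUPar n j) : u * v ∈ G.kazhdanUPar k s :=
  mul_mem_monomialSpan (fun s t h1 h2 => by
    rw [List.map_append, List.map_append, kazhdanDegree_append, List.sum_append]
    exact ⟨by omega, by rw [h1.2, h2.2, hs]⟩) hu hv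

theorem ι_mem_kazhdanUPar {j n : ℤ} (h : j + 2 ≤ n) {i : ZMod 2} {x : g} (hx : x ∈ G.gr j)
    (hxi : x ∈ part i) : Env.ι x ∈ G.kazhdanUPar n i :=
  map_mem_monomialSpan (j := (j, i)) (by simpa using h) ⟨hx, hxi⟩

theorem one_mem_kazhdanUPar {n : ℤ} (h : 0 ≤ n) : (1 : Env g) ∈ G.kazhdanUPar n 0 :=
  one_mem_monomialSpan (by simpa using h)

theorem kazhdanU_le_sup (n : ℤ) : G.kazhdanU n ≤ G.kazhdanUPar n 0 ⊔ G.kazhdanUPar n 1 := by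
  refine Submodule.span_le.2 ?_
  rintro _ ⟨w, h1, h2, rfl⟩
  induction w generalizing n with
  | nil => exact Submodule.mem_sup_left (by simpa using G.one_mem_kazhdanUPar (by simpa using h2))
  | cons q w ih =>
    have ih' := ih (n - (q.1 + 2)) (fun q hq => h1 q (List.mem_cons_of_mem _ hq)) (by
      simp only [List.map_cons, kazhdanDegree_cons] at h2
      omega)
    obtain ⟨u, hu, v, hv, huv⟩ := Submodule.mem_sup.1 ih'
    have hq := h1 q List.mem_cons_self
    have hq0 := (G.isSuperSubspace q.1).parityProj_mem 0 hq
    have hq1 := (G.isSuperSubspace q.1).parityProj_mem 1 hq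
    have e : (List.map (fun q => Env.ι q.2) (q :: w)).prod =
        (Env.ι (parityProj 0 q.2) * u + Env.ι (parityProj 1 q.2) * v) +
        (Env.ι (parityProj 0 q.2) * v + Env.ι (parityProj 1 q.2) * u) := by
      rw [List.map_cons, List.prod_cons, ← huv]
      conv_lhs => rw [← parityProj_add q.2, map_add]
      noncomm_ring
    change (List.map (fun q => Env.ι q.2) (q :: w)).prod ∈ _
    rw [e]
    have hn : q.1 + 2 + (n - (q.1 + 2)) ≤ n := by omega
    have m0 := G.ι_mem_kazhdanUPar le_rfl hq0 (parityProj_mem 0 q.2)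
    have m1 := G.ι_mem_kazhdanUPar le_rfl hq1 (parityProj_mem 1 q.2)
    exact Submodule.add_mem_sup
      (Submodule.add_mem _ (G.kazhdanUPar_mul hn (by decide) m0 hu)
        (G.kazhdanUPar_mul hn (by decide) m1 hv))
      (Submodule.add_mem _ (G.kazhdanUPar_mul hn (by decide) m0 hv)
        (G.kazhdanUPar_mul hn (by decide) m1 hu))

/-- The Leibniz rule for the supercommutator with x; s plays the role of the parity of v. -/
theorem ι_mul_ι_mul_sub {i j : ZMod 2} {x y : g} (hx : x ∈ part i) (hy : y ∈ part j) (s : ZMod 2)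
    (v : Env g) : Env.ι x * (Env.ι y * v) - superSign i (j + s) • (Env.ι y * v * Env.ι x) =
      Env.ι (br x y) * v +
        superSign i j • (Env.ι y * (Env.ι x * v - superSign i s • (v * Env.ι x))) := by
  rw [← env_ι_mul_ι hx hy, superSign_add_right]
  simp only [sub_mul, mul_sub, smul_sub, smul_mul_assoc, mul_smul_comm, smul_smul, mul_assoc]
  abel

/-- The supercommutator of an element of `g` and a product of elements of `g` is a combination of
products with no more factors, of Kazhdan degree smaller by two. -/
theorem ι_supercomm_list {j n : ℤ} {i : ZMod 2} {x : g} (hx : x ∈ G.gr j) (hxi : x ∈ part i)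
    (w : List ((ℤ × ZMod 2) × g)) (hw : ∀ q ∈ w, q.2 ∈ G.gr q.1.1 ⊓ part q.1.2)
    (hn : kazhdanDegree ((w.map Prod.fst).map Prod.fst) + j ≤ n) :
    Env.ι x * (w.map fun q => Env.ι q.2).prod -
      superSign i ((w.map Prod.fst).map Prod.snd).sum • ((w.map fun q => Env.ι q.2).prod * Env.ι x) ∈
    monomialSpan Env.ι G.gr fun js => kazhdanDegree js ≤ n ∧ js.length ≤ w.length := by
  induction w generalizing n with
  | nil => simp
  | cons q w ih =>
    have hq := hw q List.mem_cons_self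
    have hw' : ∀ q ∈ w, q.2 ∈ G.gr q.1.1 ⊓ part q.1.2 :=
      fun q hq => hw q (List.mem_cons_of_mem _ hq)
    simp only [List.map_cons, kazhdanDegree_cons] at hn
    have ih' := ih (n := n - (q.1.1 + 2)) hw' (by omega)
    have hv : (w.map fun q => Env.ι q.2).prod ∈ monomialSpan Env.ι G.gr fun js =>
        kazhdanDegree js ≤ n - (q.1.1 + 2) - j ∧ js.length ≤ w.length := by
      refine Submodule.subset_span ⟨w.map fun q => (q.1.1, q.2), ?_, ⟨?_, ?_⟩, ?_⟩
      · intro q hq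
        obtain ⟨q', hq', rfl⟩ := List.mem_map.1 hq
        exact (hw' q' hq').1
      · simp only [List.map_map, Function.comp_def] at hn ⊢
        omega
      · simp
      · simp [Function.comp_def]
    simp only [List.map_cons, List.prod_cons, List.sum_cons, List.length_cons]
    generalize (w.map fun q => Env.ι q.2).prod = v at *
    rw [ι_mul_ι_mul_sub hxi hq.2]
    refine Submodule.add_mem _ ?_ (Submodule.smul_mem _ _ ?_)
    · have h0 : Env.ι (br x q.2) ∈ monomialSpan Env.ι G.gr fun js => js = [j + q.1.1] :=
        map_mem_monomialSpan (P := fun js => js = [j + q.1.1]) (j := j + q.1.1) rfl (G.br_mem hx hq.1)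
      refine mul_mem_monomialSpan ?_ h0 hv
      rintro _ js rfl ⟨h2, h3⟩
      rw [List.singleton_append, kazhdanDegree_cons, List.length_cons]
      omega
    · have h0 : Env.ι q.2 ∈ monomialSpan Env.ι G.gr fun js => js = [q.1.1] :=
        map_mem_monomialSpan (P := fun js => js = [q.1.1]) (j := q.1.1) rfl hq.1
      refine mul_mem_monomialSpan ?_ h0 ih'
      rintro _ js rfl ⟨h2, h3⟩
      rw [List.singleton_append, kazhdanDegree_cons, List.length_cons]
      omega

/-- Supercommutators with elements of `g` lower the Kazhdan degree by two. -/
theorem ι_supercomm {j n k : ℤ} {i s : ZMod 2} {x : g} (hx : x ∈ G.gr j) (hxi : x ∈ part i)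
    {v : Env g} (hv : v ∈ G.kazhdanUPar n s) (hk : n + j ≤ k) :
    Env.ι x * v - superSign i s • (v * Env.ι x) ∈ G.kazhdanU k := by
  induction hv using Submodule.span_induction with
  | mem v hv =>
    obtain ⟨w, h1, ⟨h2, h3⟩, rfl⟩ := hv
    rw [← h3]
    exact monomialSpan_mono (fun _ h => h.1) (G.ι_supercomm_list hx hxi w h1 (by omega))
  | zero => simp
  | add u v _ _ hu hv =>
    rw [mul_add, add_mul, smul_add, add_sub_add_comm]
    exact Submodule.add_mem _ hu hv
  | smul c v _ hv =>
    rw [mul_smul_comm, smul_mul_assoc, smul_comm, ← smul_sub]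
    exact Submodule.smul_mem _ _ hv

/-- The Leibniz rule in the first factor reduces this to `ι_supercomm`. It says in particular that
the associated graded algebra of the Kazhdan filtration is supercommutative, which gives the
homomorphisms from symmetric superalgebras used below. -/
theorem supercomm {m n k : ℤ} {i s : ZMod 2} {u v : Env g} (hu : u ∈ G.kazhdanUPar m i)
    (hv : v ∈ G.kazhdanUPar n s) (hk : m + n - 2 ≤ k) :
    u * v - superSign i s • (v * u) ∈ G.kazhdanU k := by
  induction hu using Submodule.span_induction with
  | mem u hu =>
    obtain ⟨w, h1, ⟨h2, h3⟩, rfl⟩ := hu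
    induction w generalizing m k i with
    | nil => simp [← h3]
    | cons q w ih =>
      have hq := h1 q List.mem_cons_self
      simp only [List.map_cons, kazhdanDegree_cons, List.sum_cons] at h2 h3
      have ih' := ih (m := m - (q.1.1 + 2)) (k := k - (q.1.1 + 2)) (by omega)
        (fun q hq => h1 q (List.mem_cons_of_mem _ hq)) (by omega) rfl
      have hw : (w.map fun q => Env.ι q.2).prod ∈ G.kazhdanU (m - (q.1.1 + 2)) :=
        G.kazhdanUPar_le_kazhdanU _ _ (Submodule.subset_span
          ⟨w, fun q hq => h1 q (List.mem_cons_of_mem _ hq), ⟨by omega, rfl⟩, rfl⟩)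
      rw [List.map_cons, List.prod_cons]
      generalize (w.map fun q => Env.ι q.2).prod = u at *
      have e := G.ι_supercomm hq.1 hq.2 hv le_rfl
      have e2 : Env.ι q.2 * u * v - superSign i s • (v * (Env.ι q.2 * u)) =
          Env.ι q.2 * (u * v - superSign (List.map Prod.snd (List.map Prod.fst w)).sum s • (v * u)) +
          superSign (List.map Prod.snd (List.map Prod.fst w)).sum s •
            ((Env.ι q.2 * v - superSign q.1.2 s • (v * Env.ι q.2)) * u) := by
        rw [← h3, superSign_add_left]
        simp only [sub_mul, mul_sub, smul_sub, smul_mul_assoc, mul_smul_comm, smul_smul, mul_assoc]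
        rw [mul_comm (superSign q.1.2 s)]
        abel
      rw [e2]
      exact Submodule.add_mem _
        (G.kazhdanU_mul (m := q.1.1 + 2) (by omega) (G.ι_mem_kazhdanU le_rfl hq.1) ih')
        (Submodule.smul_mem _ _ (G.kazhdanU_mul (by omega) e hw))
  | zero => simp
  | add u v _ _ hu hv =>
    rw [mul_add, add_mul, smul_add, add_sub_add_comm]
    exact Submodule.add_mem _ hu hv
  | smul c v _ hv =>
    rw [mul_smul_comm, smul_mul_assoc, smul_comm, ← smul_sub]
    exact Submodule.smul_mem _ _ hv

end GoodGrading
end FinW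
end

/-! ### The map from Q_χ to S(p ⊕ l') and its leading terms -/

open scoped DirectSum TensorProduct
noncomputable section
namespace FinW
open LieSuperalgebra (part br)

theorem of_cls_eq {A : Type*} [Ring A] [Algebra ℂ A] {F : ℤ → Submodule ℂ A} {i j : ℤ} (h : i = j)
    {a : F i} {b : F j} (hab : (a : A) - b ∈ F (i - 1)) :
    DirectSum.of (GrPiece F) i (GrPiece.cls F i a) = DirectSum.of (GrPiece F) j (GrPiece.cls F j b) := by
  subst h
  rw [GrPiece.cls_eq hab]

theorem of_cls_mul_of_cls {A : Type*} [Ring A] [Algebra ℂ A] {F : ℤ → Submodule ℂ A}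
    [hF : IsMulFiltration F] {i j : ℤ} (a : F i) (b : F j) :
    DirectSum.of (GrPiece F) i (GrPiece.cls F i a) * DirectSum.of (GrPiece F) j (GrPiece.cls F j b) =
      DirectSum.of (GrPiece F) (i + j) (GrPiece.cls F (i + j) ⟨a * b, hF.mul_mem a.2 b.2⟩) :=
  DirectSum.of_mul_of _ _

theorem smul_of_cls {A : Type*} [Ring A] [Algebra ℂ A] {F : ℤ → Submodule ℂ A} (c : ℂ) {i : ℤ}
    (a : F i) : c • DirectSum.of (GrPiece F) i (GrPiece.cls F i a) =
      DirectSum.of (GrPiece F) i (GrPiece.cls F i (c • a)) := by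
  rw [← DirectSum.lof_eq_of ℂ, ← map_smul, ← map_smul, DirectSum.lof_eq_of]

theorem cls_eq_zero_iff {A : Type*} [Ring A] [Algebra ℂ A] {F : ℤ → Submodule ℂ A} {i : ℤ}
    {a : F i} : GrPiece.cls F i a = 0 ↔ (a : A) ∈ F (i - 1) :=
  Submodule.Quotient.mk_eq_zero _

namespace GoodGrading

variable {g : Type*} [AddCommGroup g] [Module ℂ g] [LieSuperalgebra g]
  {χ : EvenFunctional g} {G : GoodGrading χ} {l l' : Submodule ℂ g}

theorem exists_mem_kazhdanU (u : Env g) : ∃ n, u ∈ G.kazhdanU n := by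
  obtain ⟨t, rfl⟩ := RingQuot.mkAlgHom_surjective ℂ (EnvRel g) u
  induction t using TensorAlgebra.induction with
  | algebraMap c =>
    refine ⟨0, ?_⟩
    rw [AlgHom.commutes, Algebra.algebraMap_eq_smul_one]
    exact Submodule.smul_mem _ _ (one_mem_monomialSpan (by simp))
  | ι x =>
    have hx : x ∈ ⨆ j, G.gr j := G.iSup_gr ▸ Submodule.mem_top
    change ∃ n, Env.ι x ∈ G.kazhdanU n
    induction hx using Submodule.iSup_induction' with
    | mem j x hx => exact ⟨j + 2, G.ι_mem_kazhdanU le_rfl hx⟩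
    | zero => exact ⟨0, by simp⟩
    | add x y _ _ hx hy =>
      obtain ⟨m, hm⟩ := hx
      obtain ⟨n, hn⟩ := hy
      exact ⟨max m n, by
        rw [map_add]
        exact Submodule.add_mem _ (G.kazhdanU_mono (le_max_left _ _) hm)
          (G.kazhdanU_mono (le_max_right _ _) hn)⟩
  | mul s t hs ht =>
    obtain ⟨m, hm⟩ := hs
    obtain ⟨n, hn⟩ := ht
    exact ⟨m + n, by rw [map_mul]; exact G.kazhdanU_mul le_rfl hm hn⟩
  | add s t hs ht =>
    obtain ⟨m, hm⟩ := hs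
    obtain ⟨n, hn⟩ := ht
    exact ⟨max m n, by
      rw [map_add]
      exact Submodule.add_mem _ (G.kazhdanU_mono (le_max_left _ _) hm)
        (G.kazhdanU_mono (le_max_right _ _) hn)⟩

theorem π_eq_smul (l : Submodule ℂ g) (u : Env g) : G.π l u = u • G.π l 1 := by
  rw [← map_smul, smul_eq_mul, mul_one]

theorem π_mul (l : Submodule ℂ g) (u v : Env g) : G.π l (u * v) = u • G.π l v := by
  rw [← map_smul, smul_eq_mul]

theorem π_mul_ι {a : g} (ha : a ∈ G.m l) (u : Env g) :
    G.π l (u * Env.ι a) = χ.toLin a • G.π l u := by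
  have h : G.π l (Env.ι a - algebraMap ℂ (Env g) (χ.toLin a)) = 0 :=
    (Submodule.Quotient.mk_eq_zero _).2 (Submodule.subset_span ⟨a, ha, rfl⟩)
  have h2 : u * Env.ι a = u * (Env.ι a - algebraMap ℂ (Env g) (χ.toLin a)) +
      u * algebraMap ℂ (Env g) (χ.toLin a) := by
    rw [mul_sub, sub_add_cancel]
  rw [h2, map_add, π_mul, h, smul_zero, zero_add, Algebra.algebraMap_eq_smul_one, mul_smul_comm,
    mul_one]
  exact ((G.π l).restrictScalars ℂ).map_smul _ _

theorem neg_one_le_of_mem_pl (hl' : G.IsAdmissibleComplement l l') {j : ℤ} {x : g} (hx : x ∈ G.p ⊔ l') (hj : x ∈ G.gr j) (h0 : x ≠ 0) :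
    -1 ≤ j := by
  by_contra! h
  exact h0 (by rw [← G.grProj_of_mem hj]; exact (grProj_pl hl' hx).2 j (by omega))

theorem _root_.FinW.Polarization.tl_mul {V : Type*} [AddCommGroup V] [Module ℂ V]
    {P : ZMod 2 → Submodule ℂ V} {B : HomBasis P} (D : Polarization g B) (x : g) (f f') :
    D.tl x (f * f') = D.tl x f * f' := by
  simp [Polarization.tl_apply, add_mul, mul_assoc]

theorem kazhdanQ_mono {m n : ℤ} (h : m ≤ n) : G.kazhdanQ l m ≤ G.kazhdanQ l n :=
  Submodule.map_mono (G.kazhdanU_mono h)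

theorem exists_mem_kazhdanQ (q : G.Q l) : ∃ n, q ∈ G.kazhdanQ l n := by
  obtain ⟨v, rfl⟩ := Submodule.mkQ_surjective _ q
  obtain ⟨n, hn⟩ := G.exists_mem_kazhdanU v
  exact ⟨n, v, hn, rfl⟩

variable [FiniteDimensional ℂ g] (hl : G.IsIsotropic l) (hl' : G.IsAdmissibleComplement l l')

/-- A homogeneous basis of `p ⊕ l'`. -/
abbrev basisPL : HomBasis (partOn (G.p ⊔ l')) := (isBigraded_pl hl').homBasis

theorem basisPL_mem_gr (k) : ((basisPL hl').e k : g) ∈ G.gr ((basisPL hl').wt k) :=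
  (isBigraded_pl hl').mem_homBasis_gr.1 (HomBasis.e_mem_gr _ k)

theorem neg_one_le_wt (k) : -1 ≤ (basisPL hl').wt k :=
  neg_one_le_of_mem_pl hl' ((basisPL hl').e k).2 (basisPL_mem_gr hl' k) fun h =>
    (basisPL hl').e.ne_zero k (Subtype.ext h)

/-- Every vector of p ⊕ l' has degree at least -1 in the good grading, so each factor contributes at
least 1 to the Kazhdan degree. Hence Kazhdan degrees are nonnegative and bound polynomial degrees,
and this is what ends the inductions below. -/
theorem length_le_deg (w) : (w.length : ℤ) ≤ ((basisPL hl').deg w).1 := by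
  induction w with
  | nil => simp
  | cons k w ih =>
    have := neg_one_le_wt hl' k
    simp only [HomBasis.deg_cons, List.length_cons, Prod.fst_add]
    push_cast
    omega

/-- The action of `U(g)` on `S(p ⊕ l')`. -/
def actS : Env g →ₐ[ℂ] Module.End ℂ (G.SymPL l') := (polarization hl hl').act G.isSuperSubspace

/-- The value at `1` of the action of `U(g)` on `S(p ⊕ l')`. -/
def symbU : Env g →ₗ[ℂ] G.SymPL l' := (polarization hl hl').symb G.isSuperSubspace

theorem actS_ι (x) : actS hl hl' (Env.ι x) = (polarization hl hl').rep x :=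
  Polarization.act_ι _ _ _

theorem symbU_mul (u v) : symbU hl hl' (u * v) = actS hl hl' u (symbU hl hl' v) :=
  Polarization.symb_mul _ _ _ _

theorem symbU_one : symbU hl hl' 1 = 1 := Polarization.symb_one _ _

theorem actS_one (u) : actS hl hl' u 1 = symbU hl hl' u := rfl

theorem actS_ι_sub {j n k : ℤ} {x : g} (hx : x ∈ G.gr j) (hk : n + j ≤ k) {f}
    (hf : f ∈ (basisPL hl').reg {c | c.1 ≤ n}) :
    actS hl hl' (Env.ι x) f - (polarization hl hl').tl x f ∈ (basisPL hl').reg {c | c.1 ≤ k} := by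
  rw [actS_ι]
  refine (polarization hl hl').rep_low G.isSuperSubspace hx ?_ hf
  intro c (hc : c.1 ≤ n) c' h1 h2
  exact (by omega : c'.1 ≤ k)

theorem tl_mem_le {j n k : ℤ} {x : g} (hx : x ∈ G.gr j) (hk : n + j + 2 ≤ k) {f}
    (hf : f ∈ (basisPL hl').reg {c | c.1 ≤ n}) :
    (polarization hl hl').tl x f ∈ (basisPL hl').reg {c | c.1 ≤ k} :=
  (polarization hl hl').tl_mem hx (R := {c | c.1 ≤ n}) (R' := {c | c.1 ≤ k})
    (fun c (hc : c.1 ≤ n) => (by simp; omega))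
    (fun e c (hc : c.1 ≤ n) => (by omega : c.1 ≤ k)) hf

theorem actS_mem {m n k : ℤ} (hk : m + n ≤ k) {u} (hu : u ∈ G.kazhdanU m) {f}
    (hf : f ∈ (basisPL hl').reg {c | c.1 ≤ n}) :
    actS hl hl' u f ∈ (basisPL hl').reg {c | c.1 ≤ k} := by
  induction hu using Submodule.span_induction with
  | mem u hu =>
    obtain ⟨w, h1, h2, rfl⟩ := hu
    induction w generalizing m k with
    | nil =>
      simp only [List.map_nil, List.prod_nil, map_one, Module.End.one_apply]
      refine HomBasis.reg_mono _ (fun c (hc : c.1 ≤ n) => ?_) hf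
      simp only [List.map_nil, kazhdanDegree_nil] at h2
      exact (by omega : c.1 ≤ k)
    | cons q w ih =>
      simp only [List.map_cons, kazhdanDegree_cons] at h2
      have ih' := ih (m := m - (q.1 + 2)) (k := k - (q.1 + 2)) (by omega)
        (fun q hq => h1 q (List.mem_cons_of_mem _ hq)) (by omega)
      rw [List.map_cons, List.prod_cons, map_mul, Module.End.mul_apply]
      have hq := h1 q List.mem_cons_self
      rw [← sub_add_cancel (actS hl hl' (Env.ι q.2) _) ((polarization hl hl').tl q.2 _)]
      exact Submodule.add_mem _ (actS_ι_sub hl hl' hq (by omega) ih')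
        (tl_mem_le hl hl' hq (by omega) ih')
  | zero => simp
  | add u v _ _ hu hv => rw [map_add]; exact Submodule.add_mem _ hu hv
  | smul c v _ hv => rw [map_smul]; exact Submodule.smul_mem _ _ hv

theorem symbU_mem {n : ℤ} {u} (hu : u ∈ G.kazhdanU n) :
    symbU hl hl' u ∈ (basisPL hl').reg {c | c.1 ≤ n} :=
  actS_mem hl hl' (add_zero n).le hu (HomBasis.one_mem_reg _ (le_refl (0 : ℤ)))

/-- Each factor of u acts by the multiplication `tl` up to lower Kazhdan degree, and `tl` commutes
with right multiplication by f. So the action multiplies leading terms. -/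
theorem actS_sub {m n k : ℤ} (hk : m + n - 1 ≤ k) {u} (hu : u ∈ G.kazhdanU m) {f}
    (hf : f ∈ (basisPL hl').reg {c | c.1 ≤ n}) :
    actS hl hl' u f - symbU hl hl' u * f ∈ (basisPL hl').reg {c | c.1 ≤ k} := by
  induction hu using Submodule.span_induction with
  | mem u hu =>
    obtain ⟨w, h1, h2, rfl⟩ := hu
    induction w generalizing m k with
    | nil => simp [symbU_one]
    | cons q w ih =>
      simp only [List.map_cons, kazhdanDegree_cons] at h2
      have hq := h1 q List.mem_cons_self
      have hw : (w.map fun q => Env.ι q.2).prod ∈ G.kazhdanU (m - (q.1 + 2)) :=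
        Submodule.subset_span ⟨w, fun q hq => h1 q (List.mem_cons_of_mem _ hq), by omega, rfl⟩
      have ih' := ih (m := m - (q.1 + 2)) (k := k - (q.1 + 2)) (by omega)
        (fun q hq => h1 q (List.mem_cons_of_mem _ hq)) (by omega)
      rw [List.map_cons, List.prod_cons, map_mul, Module.End.mul_apply, symbU_mul]
      generalize (w.map fun q => Env.ι q.2).prod = v at *
      have e1 := actS_ι_sub hl hl' hq (k := k) (by omega) (actS_mem hl hl' le_rfl hw hf)
      have e2 := actS_ι_sub hl hl' hq (k := k - n) (by omega) (symbU_mem hl hl' hw)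
      have e3 := tl_mem_le hl hl' hq (k := k) (by omega) ih'
      have e4 := HomBasis.mul_mem_reg _ (R'' := {c | c.1 ≤ k})
        (fun a (ha : a.1 ≤ k - n) b (hb : b.1 ≤ n) => (by simp; omega)) e2 hf
      rw [map_sub, Polarization.tl_mul] at e3
      rw [sub_mul] at e4
      have := Submodule.sub_mem _ (Submodule.add_mem _ e1 e3) e4
      convert this using 1
      abel
  | zero => simp
  | add u v _ _ hu hv =>
    rw [map_add, map_add, add_mul, LinearMap.add_apply, add_sub_add_comm]
    exact Submodule.add_mem _ hu hv
  | smul c v _ hv =>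
    rw [map_smul, map_smul, smul_mul_assoc, LinearMap.smul_apply, ← smul_sub]
    exact Submodule.smul_mem _ _ hv

/-- On 1 an element of m acts by the scalar χ, since its component in p ⊕ l' is zero and `rep`
agrees with `tl` there. -/
theorem symbU_eq_zero {u} (hu : u ∈ G.I l) : symbU hl hl' u = 0 := by
  induction hu using Submodule.span_induction with
  | mem u hu =>
    obtain ⟨a, ha, rfl⟩ := hu
    have h : projPL hl hl' a = 0 := (projPL_eq_zero_iff hl hl').2 ha
    rw [map_sub, ← actS_one, actS_ι, Polarization.rep_one _ G.isSuperSubspace,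
      Polarization.tl_apply, Algebra.algebraMap_eq_smul_one, map_smul, symbU_one]
    change SuperSym.ι _ (projPL hl hl' a) * 1 + χ.toLin a • (1 : G.SymPL l') - _ = 0
    rw [h, map_zero, zero_mul, zero_add, sub_self]
  | zero => simp
  | add u v _ _ hu hv => rw [map_add, hu, hv, add_zero]
  | smul c v _ hv => rw [smul_eq_mul, symbU_mul, hv, map_zero]

/-- The map from `Q_χ` to `S(p ⊕ l')` induced by the action of `U(g)`. -/
def symbQ : G.Q l →ₗ[ℂ] G.SymPL l' :=
  ((G.I l).restrictScalars ℂ).liftQ (symbU hl hl') (fun _ hu => symbU_eq_zero hl hl' hu) ∘ₗ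
    (Submodule.Quotient.restrictScalarsEquiv ℂ (G.I l)).symm.toLinearMap

theorem symbQ_π (u) : symbQ hl hl' (G.π l u) = symbU hl hl' u := rfl

theorem symbQ_smul (u) (q : G.Q l) : symbQ hl hl' (u • q) = actS hl hl' u (symbQ hl hl' q) := by
  obtain ⟨v, rfl⟩ := Submodule.mkQ_surjective _ q
  change symbQ hl hl' (u • G.π l v) = actS hl hl' u (symbQ hl hl' (G.π l v))
  rw [← π_mul, symbQ_π, symbQ_π, symbU_mul]

theorem symbQ_mem {n : ℤ} {q : G.Q l} (hq : q ∈ G.kazhdanQ l n) :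
    symbQ hl hl' q ∈ (basisPL hl').reg {c | c.1 ≤ n} := by
  obtain ⟨u, hu, rfl⟩ := hq
  exact symbU_mem hl hl' hu

/-! ### The symbol of a product of elements of `p ⊕ l'` -/

theorem tl_of_mem_pl {j : ℤ} {x : (G.p ⊔ l' : Submodule ℂ g)} (hx : (x : g) ∈ G.gr j) (f) :
    (polarization hl hl').tl (x : g) f = SuperSym.ι _ x * f := by
  rw [Polarization.tl_apply]
  have h : χ.toLin (x : g) = 0 := by
    by_cases h0 : (x : g) = 0
    · rw [h0, map_zero]
    · have := neg_one_le_of_mem_pl hl' x.2 hx h0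
      exact G.map_eq_zero j (by omega) _ hx
  change SuperSym.ι _ (projPL hl hl' x) * f + χ.toLin (x : g) • f = _
  rw [projPL_coe, h, zero_smul, add_zero]

/-- χ vanishes on p ⊕ l', so every factor acts as multiplication by itself up to lower Kazhdan
degree. Thus `symbU` induces the usual symbol. -/
theorem symbU_prod_sub {n : ℤ} (w : List (ℤ × (G.p ⊔ l' : Submodule ℂ g)))
    (hw : ∀ q ∈ w, q.2 ∈ G.grPL l' q.1) (hn : kazhdanDegree (w.map Prod.fst) ≤ n) :
    symbU hl hl' (w.map fun q => Env.ι (q.2 : g)).prod - (w.map fun q => SuperSym.ι _ q.2).prod ∈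
      (basisPL hl').reg {c | c.1 ≤ n - 1} := by
  induction w generalizing n with
  | nil => simp [symbU_one]
  | cons q w ih =>
    have hq := hw q List.mem_cons_self
    simp only [List.map_cons, kazhdanDegree_cons] at hn
    have ih' := ih (n := n - (q.1 + 2)) (fun q hq => hw q (List.mem_cons_of_mem _ hq)) (by omega)
    have hw' : (w.map fun q => Env.ι (q.2 : g)).prod ∈ G.kazhdanU (n - (q.1 + 2)) := by
      refine Submodule.subset_span ⟨w.map fun q => (q.1, (q.2 : g)), ?_, ?_, ?_⟩
      · intro q hq
        obtain ⟨q', hq', rfl⟩ := List.mem_map.1 hq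
        exact hw q' (List.mem_cons_of_mem _ hq')
      · rw [List.map_map]
        exact (by omega : kazhdanDegree (w.map Prod.fst) ≤ n - (q.1 + 2))
      · simp [Function.comp_def]
    have hq' : (q.2 : g) ∈ G.gr q.1 := hq
    have e1 := actS_ι_sub hl hl' hq' (n := n - (q.1 + 2)) (k := n - 1) (by omega)
      (symbU_mem hl hl' hw')
    have e2 := tl_mem_le hl hl' hq' (n := n - (q.1 + 2) - 1) (k := n - 1) (by omega) ih'
    rw [tl_of_mem_pl hl hl' hq'] at e1 e2
    rw [List.map_cons, List.prod_cons, List.map_cons, List.prod_cons, symbU_mul]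
    have := Submodule.add_mem _ e1 e2
    rwa [mul_sub, sub_add_sub_cancel] at this

/-- The product in `U(g)` of a list of basis vectors of `p ⊕ l'`. -/
def envMon (w : List (Fin (basisPL hl').dim)) : Env g :=
  (w.map fun k => Env.ι ((basisPL hl').e k : g)).prod

theorem kazhdanDegree_wt (w) :
    kazhdanDegree (w.map (basisPL hl').wt) = ((basisPL hl').deg w).1 := by
  induction w with
  | nil => simp
  | cons k w ih =>
    simp only [List.map_cons, kazhdanDegree_cons, HomBasis.deg_cons, Prod.fst_add]
    omega

theorem symbU_envMon_sub {n : ℤ} (w) (hn : ((basisPL hl').deg w).1 = n) :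
    symbU hl hl' (envMon hl' w) - (basisPL hl').mon w ∈ (basisPL hl').reg {c | c.1 ≤ n - 1} := by
  have := symbU_prod_sub hl hl' (n := n) (w.map fun k => ((basisPL hl').wt k, (basisPL hl').e k))
    (by
      intro q hq
      obtain ⟨k, -, rfl⟩ := List.mem_map.1 hq
      exact basisPL_mem_gr hl' k)
    (by
      rw [← hn]
      clear hn
      induction w with
      | nil => simp
      | cons k w ih => simp only [List.map_cons, kazhdanDegree_cons, HomBasis.deg_cons,
          Prod.fst_add]; omega)
  simp only [List.map_map, Function.comp_def] at this
  exact this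

theorem envMon_mem {n : ℤ} (w) (hn : ((basisPL hl').deg w).1 ≤ n) :
    envMon hl' w ∈ G.kazhdanU n := by
  induction w generalizing n with
  | nil => exact one_mem_monomialSpan (by simpa using hn)
  | cons k w ih =>
    simp only [HomBasis.deg_cons, Prod.fst_add] at hn
    exact G.kazhdanU_mul (m := (basisPL hl').wt k + 2) (by omega)
      (G.ι_mem_kazhdanU le_rfl (basisPL_mem_gr hl' k)) (ih le_rfl)

end GoodGrading
end FinW
end

open scoped DirectSum TensorProduct
noncomputable section
namespace FinW
open LieSuperalgebra (part br)
namespace GoodGrading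

variable {g : Type*} [AddCommGroup g] [Module ℂ g] [LieSuperalgebra g]
  {χ : EvenFunctional g} {G : GoodGrading χ} {l l' : Submodule ℂ g}
  [FiniteDimensional ℂ g] (hl : G.IsIsotropic l) (hl' : G.IsAdmissibleComplement l l')

/-! ### Spanning of `Q_χ` by monomials -/

/-- The span of the images of the monomials of bounded Kazhdan degree and length. -/
def monSpanQ (l : Submodule ℂ g) (n : ℤ) (L : ℕ) : Submodule ℂ (G.Q l) :=
  Submodule.span ℂ {q | ∃ w, ((basisPL hl').deg w).1 ≤ n ∧ w.length ≤ L ∧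
    q = G.π l (envMon hl' w)}

theorem monSpanQ_mono {n n' : ℤ} {L L' : ℕ} (hn : n ≤ n') (hL : L ≤ L') :
    monSpanQ hl' l n L ≤ monSpanQ hl' l n' L' :=
  Submodule.span_mono fun _ ⟨w, h1, h2, h3⟩ => ⟨w, h1.trans hn, h2.trans hL, h3⟩

theorem π_envMon_mem {n : ℤ} {L : ℕ} (w) (hn : ((basisPL hl').deg w).1 ≤ n) (hL : w.length ≤ L) :
    G.π l (envMon hl' w) ∈ monSpanQ hl' l n L := Submodule.subset_span ⟨w, hn, hL, rfl⟩

theorem π_ι_mul_envMon_mem {j n : ℤ} {L : ℕ} {x : (G.p ⊔ l' : Submodule ℂ g)}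
    (hx : (x : g) ∈ G.gr j) (w)
    (hn : ((basisPL hl').deg w).1 + j + 2 ≤ n) (hL : w.length < L) :
    G.π l (Env.ι (x : g) * envMon hl' w) ∈ monSpanQ hl' l n L := by
  have e : G.π l (Env.ι (x : g) * envMon hl' w) =
      ∑ k, (basisPL hl').e.repr x k • G.π l (envMon hl' (k :: w)) := by
    conv_lhs => rw [← (basisPL hl').e.sum_repr x]
    rw [Submodule.coe_sum, map_sum, Finset.sum_mul, map_sum]
    refine Finset.sum_congr rfl fun k _ => ?_
    rw [Submodule.coe_smul, map_smul, smul_mul_assoc]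
    exact ((G.π l).restrictScalars ℂ).map_smul _ _
  rw [e]
  refine Submodule.sum_mem _ fun k _ => ?_
  by_cases hk : (basisPL hl').wt k = j
  · refine Submodule.smul_mem _ _ (π_envMon_mem hl' _ ?_ hL)
    simp only [HomBasis.deg_cons, Prod.fst_add]
    omega
  · rw [((isBigraded_pl hl').mem_homBasis_gr (x := x)).2 hx k hk]
    exact (zero_smul ℂ (G.π l (envMon hl' (k :: w)))).symm ▸ Submodule.zero_mem _

/-- The spanning half of the PBW theorem for Q_χ, by induction on the number of factors. The
leftmost factor is split along g = (p ⊕ l') ⊕ m; the first part prolongs a monomial, and the second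
is moved to the right end and absorbed by χ. The length is recorded because the commutators have
fewer factors although their Kazhdan degree need not be controlled by induction. -/
theorem π_prod_mem (hl : G.IsIsotropic l) (hl' : G.IsAdmissibleComplement l l') {n : ℤ} {L : ℕ}
    (w : List (ℤ × g)) (hw : ∀ q ∈ w, q.2 ∈ G.gr q.1)
    (hn : kazhdanDegree (w.map Prod.fst) ≤ n) (hL : w.length ≤ L) :
    G.π l (w.map fun q => Env.ι q.2).prod ∈ monSpanQ hl' l n L := by
  induction L generalizing n w with
  | zero =>
    obtain rfl := List.length_eq_zero_iff.1 (Nat.le_zero.1 hL)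
    exact π_envMon_mem hl' [] (by simpa using hn) le_rfl
  | succ L ih =>
    cases w with
    | nil => exact π_envMon_mem hl' [] (by simpa using hn) (by simp)
    | cons q w =>
      have hq := hw q List.mem_cons_self
      simp only [List.map_cons, kazhdanDegree_cons] at hn
      have ih' := ih w (n := n - (q.1 + 2)) (fun q hq => hw q (List.mem_cons_of_mem _ hq))
        (by omega) (by simpa using hL)
      rw [List.map_cons, List.prod_cons, π_mul]
      -- At the right end a acts by χ(a), which is nonzero only in degree -2, where a contributes
      -- nothing to the Kazhdan degree. The supercommutator consists of products of at most L
      -- factors, to which the induction hypothesis applies.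
      have hm : ∀ (i : ZMod 2) (a : g), a ∈ G.m l → a ∈ G.gr q.1 → a ∈ part i →
          ∀ v, ((basisPL hl').deg v).1 ≤ n - (q.1 + 2) → v.length ≤ L →
          G.π l (Env.ι a * envMon hl' v) ∈ monSpanQ hl' l n (L + 1) := by
        intro i a ha haq hai v hv1 hv2
        have h1 := G.ι_supercomm_list (n := n) haq hai
          (v.map fun k => (((basisPL hl').wt k, (basisPL hl').par k), ((basisPL hl').e k : g)))
          (by
            intro q hq
            obtain ⟨k, -, rfl⟩ := List.mem_map.1 hq
            exact ⟨basisPL_mem_gr hl' k, (basisPL hl').mem_par k⟩)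
          (by
            have : kazhdanDegree (v.map fun k => (basisPL hl').wt k) = ((basisPL hl').deg v).1 :=
              kazhdanDegree_wt hl' v
            simp only [List.map_map, Function.comp_def]
            omega)
        have h2 : monomialSpan Env.ι G.gr (fun js => kazhdanDegree js ≤ n ∧ js.length ≤ L) ≤
            (monSpanQ hl' l n (L + 1)).comap ((G.π l).restrictScalars ℂ) :=
          Submodule.span_le.2 (by
            rintro _ ⟨w, h1, h2, rfl⟩
            exact monSpanQ_mono hl' le_rfl (Nat.le_succ L) (ih w h1 h2.1 (by simpa using h2.2)))
        have h3 : G.π l _ ∈ monSpanQ hl' l n (L + 1) := h2 (monomialSpan_mono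
          (fun js h => ⟨h.1, h.2.trans (by simpa using hv2)⟩) h1)
        simp only [List.map_map, Function.comp_def] at h3
        have h4 : ∀ s : ℂ, s • G.π l (envMon hl' v * Env.ι a) ∈ monSpanQ hl' l n (L + 1) := by
          intro s
          refine Submodule.smul_mem _ _ ?_
          rw [π_mul_ι ha]
          by_cases hq2 : q.1 = -2
          · exact Submodule.smul_mem _ _ (π_envMon_mem hl' v (by omega) (by omega))
          · rw [G.map_eq_zero _ hq2 _ haq]
            exact (zero_smul ℂ (G.π l (envMon hl' v))).symm ▸ Submodule.zero_mem _
        rw [map_sub] at h3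
        exact (Submodule.sub_mem_iff_left _ (h4 _)).1 h3
      have key : monSpanQ hl' l (n - (q.1 + 2)) L ≤
          (monSpanQ hl' l n (L + 1)).comap (Algebra.lsmul ℂ ℂ (G.Q l) (Env.ι q.2)) := by
        refine Submodule.span_le.2 ?_
        rintro _ ⟨v, hv1, hv2, rfl⟩
        change Env.ι q.2 • G.π l (envMon hl' v) ∈ monSpanQ hl' l n (L + 1)
        rw [← π_mul]
        have hp := projPL_gr hl hl' hq
        have ha := sub_projPL_mem hl hl' q.2
        have haq := Submodule.sub_mem _ hq hp
        have e : q.2 = projPL hl hl' q.2 + (parityProj 0 (q.2 - projPL hl hl' q.2) +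
            parityProj 1 (q.2 - projPL hl hl' q.2)) := by
          rw [parityProj_add]; abel
        rw [e, map_add, map_add, add_mul, add_mul, map_add, map_add]
        refine Submodule.add_mem _ (π_ι_mul_envMon_mem hl' hp v (by omega) (by omega))
          (Submodule.add_mem _ (hm 0 _ ?_ ?_ (parityProj_mem _ _) v hv1 hv2)
            (hm 1 _ ?_ ?_ (parityProj_mem _ _) v hv1 hv2))
        · exact (isBigraded_m hl).isSuper.parityProj_mem 0 ha
        · exact (G.isSuperSubspace _).parityProj_mem 0 haq
        · exact (isBigraded_m hl).isSuper.parityProj_mem 1 ha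
        · exact (G.isSuperSubspace _).parityProj_mem 1 haq
      exact key ih'

theorem exists_envMon_of_mem_kazhdanQ (hl : G.IsIsotropic l) {n : ℤ} {q : G.Q l}
    (hq : q ∈ G.kazhdanQ l n) :
    q ∈ Submodule.span ℂ {q | ∃ w, ((basisPL hl').deg w).1 ≤ n ∧ q = G.π l (envMon hl' w)} := by
  obtain ⟨u, hu, rfl⟩ := hq
  have : G.kazhdanU n ≤ (Submodule.span ℂ {q | ∃ w, ((basisPL hl').deg w).1 ≤ n ∧
      q = G.π l (envMon hl' w)}).comap ((G.π l).restrictScalars ℂ) := by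
    refine Submodule.span_le.2 ?_
    rintro _ ⟨w, h1, h2, rfl⟩
    refine Submodule.span_mono ?_ (π_prod_mem hl hl' w h1 h2 le_rfl)
    rintro _ ⟨w, h1, _, h3⟩
    exact ⟨w, h1, h3⟩
  exact this hu

theorem eq_zero_of_mem_kazhdanQ (hl : G.IsIsotropic l) (hl' : G.IsAdmissibleComplement l l')
    {n : ℤ} (hn : n < 0) {q : G.Q l} (hq : q ∈ G.kazhdanQ l n) : q = 0 := by
  have := exists_envMon_of_mem_kazhdanQ hl' hl hq
  have h : {q | ∃ w, ((basisPL hl').deg w).1 ≤ n ∧ q = G.π l (envMon hl' w)} = ∅ := by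
    refine Set.eq_empty_of_forall_notMem ?_
    rintro _ ⟨w, hw, -⟩
    have := length_le_deg hl' w
    omega
  rw [h, Submodule.span_empty] at this
  exact this

/-! ### Comparison of filtrations -/

/-- The map from the symmetric superalgebra of `p ⊕ l'` to the associated graded algebra of
the enveloping superalgebra. -/
def symGrU : G.SymPL l' →ₐ[ℂ] ⨁ n : ℤ, GrPiece G.kazhdanU n :=
  (basisPL hl').constr (fun k => DirectSum.of (GrPiece G.kazhdanU) ((basisPL hl').wt k + 2)
    (GrPiece.cls _ _ ⟨Env.ι ((basisPL hl').e k : g), G.ι_mem_kazhdanU le_rfl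
      (basisPL_mem_gr hl' k)⟩)) (by
    intro k m
    rw [of_cls_mul_of_cls, of_cls_mul_of_cls, smul_of_cls]
    refine of_cls_eq (add_comm _ _) ?_
    exact G.supercomm (G.ι_mem_kazhdanUPar le_rfl (basisPL_mem_gr hl' k) ((basisPL hl').mem_par k))
      (G.ι_mem_kazhdanUPar le_rfl (basisPL_mem_gr hl' m) ((basisPL hl').mem_par m)) (by omega))

theorem symGrU_mon (w) : symGrU hl' ((basisPL hl').mon w) =
    DirectSum.of (GrPiece G.kazhdanU) ((basisPL hl').deg w).1
      (GrPiece.cls _ _ ⟨envMon hl' w, envMon_mem hl' w le_rfl⟩) := by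
  induction w with
  | nil => rw [HomBasis.mon_nil, map_one]; rfl
  | cons k w ih =>
    rw [HomBasis.mon_cons, map_mul, ih, symGrU, HomBasis.constr_X, of_cls_mul_of_cls]
    refine of_cls_eq (by simp) ?_
    simp [envMon]

/-- An element of `Q_χ` whose image in `S(p ⊕ l')` has lower Kazhdan degree has itself lower
Kazhdan degree. -/
theorem mem_kazhdanQ_of_symbQ {n : ℤ} {q : G.Q l} (hq : q ∈ G.kazhdanQ l n)
    (h : symbQ hl hl' q ∈ (basisPL hl').reg {c | c.1 ≤ n - 1}) : q ∈ G.kazhdanQ l (n - 1) := by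
  -- Modulo lower terms q has a representative z whose class in the associated graded algebra of
  -- U(g) is the image of a polynomial f of pure Kazhdan degree n, the symbol of z. That `symGrU` is
  -- well defined replaces independence of the monomials.
  have h1 : ∃ z ∈ G.kazhdanU n, ∃ f ∈ (basisPL hl').reg {c | c.1 = n},
      q - G.π l z ∈ G.kazhdanQ l (n - 1) ∧
      (∀ hz : z ∈ G.kazhdanU n, symGrU hl' f = DirectSum.of _ n (GrPiece.cls _ n ⟨z, hz⟩)) ∧
      symbU hl hl' z - f ∈ (basisPL hl').reg {c | c.1 ≤ n - 1} := by
    have := exists_envMon_of_mem_kazhdanQ hl' hl hq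
    clear h hq
    induction this using Submodule.span_induction with
    | mem q hq =>
      obtain ⟨w, hw, rfl⟩ := hq
      by_cases hw' : ((basisPL hl').deg w).1 = n
      · refine ⟨envMon hl' w, envMon_mem hl' w hw, (basisPL hl').mon w, HomBasis.mon_mem_reg _ hw',
          by simp, fun hz => ?_, symbU_envMon_sub hl hl' w hw'⟩
        rw [symGrU_mon]
        exact of_cls_eq hw' (by simp)
      · refine ⟨0, Submodule.zero_mem _, 0, Submodule.zero_mem _, ?_, fun hz => ?_, by simp⟩
        · rw [map_zero, sub_zero]
          exact ⟨envMon hl' w, envMon_mem hl' w (by omega), rfl⟩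
        · rw [map_zero, cls_eq_zero_iff.2, map_zero]
          exact Submodule.zero_mem _
    | zero =>
      refine ⟨0, Submodule.zero_mem _, 0, Submodule.zero_mem _, by simp, fun hz => ?_, by simp⟩
      rw [map_zero, cls_eq_zero_iff.2, map_zero]
      exact Submodule.zero_mem _
    | add q q' _ _ hq hq' =>
      obtain ⟨z, hz, f, hf, h1, h2, h3⟩ := hq
      obtain ⟨z', hz', f', hf', h1', h2', h3'⟩ := hq'
      refine ⟨z + z', Submodule.add_mem _ hz hz', f + f', Submodule.add_mem _ hf hf', ?_,
        fun _ => ?_, ?_⟩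
      · rw [map_add, add_sub_add_comm]; exact Submodule.add_mem _ h1 h1'
      · rw [map_add, h2 hz, h2' hz', ← map_add, ← map_add]; rfl
      · rw [map_add, add_sub_add_comm]; exact Submodule.add_mem _ h3 h3'
    | smul c q _ hq =>
      obtain ⟨z, hz, f, hf, h1, h2, h3⟩ := hq
      refine ⟨c • z, Submodule.smul_mem _ _ hz, c • f, Submodule.smul_mem _ _ hf, ?_,
        fun _ => ?_, ?_⟩
      · have := Submodule.smul_mem _ c h1
        rw [smul_sub] at this
        exact this
      · rw [map_smul, h2 hz, smul_of_cls]; rfl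
      · have := Submodule.smul_mem _ c h3
        rw [smul_sub] at this
        rw [map_smul]
        exact this
  obtain ⟨z, hz, f, hf, h1, h2, h3⟩ := h1
  have h4 := symbQ_mem hl hl' h1
  rw [map_sub, symbQ_π] at h4
  -- The hypothesis pushes f into degree at most n - 1, so f = 0. Then the class of z is zero, and z
  -- has lower Kazhdan degree.
  have h5 : f ∈ (basisPL hl').reg {c | c.1 ≤ n - 1} := by
    have := Submodule.sub_mem _ h (Submodule.add_mem _ h3 h4)
    simpa using this
  have h6 : f = 0 := (basisPL hl').eq_zero_of_mem_reg_of_disjoint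
    (Set.disjoint_left.2 fun c (hc : c.1 = n) (hc' : c.1 ≤ n - 1) => by omega) hf h5
  have h7 := h2 hz
  rw [h6, map_zero] at h7
  have h8 := cls_eq_zero_iff.1 (DirectSum.of_injective n (h7.symm.trans (map_zero _).symm))
  have := Submodule.add_mem _ h1 ⟨z, h8, rfl⟩
  simpa using this

end GoodGrading
end FinW
end

open scoped DirectSum TensorProduct
noncomputable section
namespace FinW
open LieSuperalgebra (part br)

/-! ### Subspaces of a super vector space -/

/-- An embedding of super vector spaces with homogeneous bases. -/
structure HomEmb {V N : Type*} [AddCommGroup V] [Module ℂ V] [AddCommGroup N] [Module ℂ N]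
    {P : ZMod 2 → Submodule ℂ V} {PN : ZMod 2 → Submodule ℂ N} (B : HomBasis P)
    (BN : HomBasis PN) where
  toFun : N →ₗ[ℂ] V
  inj : Function.Injective toFun
  mem_part_iff : ∀ {i x}, toFun x ∈ P i ↔ x ∈ PN i
  e_mem_gr : ∀ k, toFun (BN.e k) ∈ B.gr (BN.wt k)

theorem HomBasis.iSup_part {V : Type*} [AddCommGroup V] [Module ℂ V]
    {P : ZMod 2 → Submodule ℂ V} (B : HomBasis P) : ⨆ i, P i = ⊤ := by
  refine eq_top_iff.2 fun v _ => ?_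
  rw [← B.e.sum_repr v]
  exact Submodule.sum_mem _ fun k _ => Submodule.smul_mem _ _
    (Submodule.mem_iSup_of_mem _ (B.mem_par k))

theorem HomBasis.iSupIndep_part {V : Type*} [AddCommGroup V] [Module ℂ V]
    {P : ZMod 2 → Submodule ℂ V} (B : HomBasis P) : iSupIndep P := by
  intro i
  refine Submodule.disjoint_def.2 fun x hx hx' => B.e.repr.injective (Finsupp.ext fun k => ?_)
  rw [map_zero, Finsupp.zero_apply]
  by_cases hk : B.par k = i
  · have : (⨆ j, ⨆ (_ : j ≠ i), P j) ≤ LinearMap.ker (B.e.coord k) :=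
      iSup_le fun j => iSup_le fun hj x hx => B.repr_par hx k fun h => hj (h.symm.trans hk)
    exact this hx'
  · exact B.repr_par hx k hk

namespace HomEmb

variable {V N : Type*} [AddCommGroup V] [Module ℂ V] [AddCommGroup N] [Module ℂ N]
  {P : ZMod 2 → Submodule ℂ V} {PN : ZMod 2 → Submodule ℂ N} {B : HomBasis P}
  {BN : HomBasis PN} (E : HomEmb B BN)

/-- The induced homomorphism of symmetric superalgebras. -/
def map : SuperSym PN →ₐ[ℂ] SuperSym P :=
  SuperSym.lift (SuperSym.ι P ∘ₗ E.toFun) fun _ _ _ hx _ hy =>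
    SuperSym.ι_mul_ι P (E.mem_part_iff.2 hx) (E.mem_part_iff.2 hy)

@[simp] theorem map_ι (x) : E.map (SuperSym.ι PN x) = SuperSym.ι P (E.toFun x) := by
  simp [map]

theorem map_mon_mem (w) : E.map (BN.mon w) ∈ B.reg {BN.deg w} := by
  induction w with
  | nil => rw [HomBasis.mon_nil, map_one]; exact B.one_mem_reg (Set.mem_singleton _)
  | cons k w ih =>
    rw [HomBasis.mon_cons, map_mul, HomBasis.deg_cons]
    refine B.mul_mem_reg (R := {(BN.wt k + 2, 1)}) ?_ ?_ ih
    · rintro a ha b hb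
      rw [Set.mem_singleton_iff] at ha hb
      rw [ha, hb]; exact Set.mem_singleton _
    · rw [HomBasis.X, map_ι]
      exact B.ι_mem_reg (Set.mem_singleton _) (E.e_mem_gr k)

theorem map_projOn (R t) : E.map (BN.projOn R t) = B.projOn R (E.map t) := by
  have : E.map.toLinearMap ∘ₗ BN.projOn R = B.projOn R ∘ₗ E.map.toLinearMap :=
    BN.linearMap_ext fun w => by
      change E.map (BN.projOn R (BN.mon w)) = B.projOn R (E.map (BN.mon w))
      rw [HomBasis.projOn_mon]
      split_ifs with h
      · rw [B.projOn_of_mem (Set.singleton_subset_iff.2 h) (E.map_mon_mem w)]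
      · rw [B.projOn_eq_zero (Set.disjoint_singleton_left.2 h) (E.map_mon_mem w), map_zero]
  exact LinearMap.congr_fun this t

/-- A homogeneous basis of `V` containing a basis of the subspace. -/
theorem exists_adapted : ∃ B' : HomBasis P,
    (∀ k, B'.wt k = 0 ∧ B'.e k ∈ LinearMap.range E.toFun ∨ B'.wt k = 1) ∧
      LinearMap.range E.toFun ≤ B'.gr 0 := by
  classical
  let s : Set V := Set.range (E.toFun ∘ BN.e)
  let t : Set V := {v | ∃ i, v ∈ P i}
  have hs : LinearIndepOn ℂ id s :=
    (BN.e.linearIndependent.map' E.toFun (LinearMap.ker_eq_bot.2 E.inj)).linearIndepOn_id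
  have hst : s ⊆ t := by
    rintro _ ⟨k, rfl⟩
    exact ⟨BN.par k, E.mem_part_iff.2 (BN.mem_par k)⟩
  have ht : ⊤ ≤ Submodule.span ℂ t := by
    rw [← B.iSup_part]
    exact iSup_le fun i v hv => Submodule.subset_span ⟨i, hv⟩
  let b := Module.Basis.extendLe hs hst ht
  have hb : ∀ k, b k ∈ t := fun k => Module.Basis.extendLe_subset hs hst ht ⟨k, rfl⟩
  have : Module.Finite ℂ V := Module.Finite.of_basis B.e
  have : Finite _ := Module.Finite.finite_basis b
  let := Fintype.ofFinite ↑(hs.extend hst)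
  let e := b.reindex (Fintype.equivFin _)
  have he : ∀ k, e k ∈ t := fun k => by rw [Module.Basis.reindex_apply]; exact hb _
  choose par hpar using he
  let B' : HomBasis P :=
    { dim := _
      e := e
      par := par
      -- The weight of this auxiliary basis is unrelated to the good grading: it marks the basis
      -- vectors outside the subspace.
      wt := fun k => if e k ∈ LinearMap.range E.toFun then 0 else 1
      mem_par := hpar
      repr_par := fun hx k hk => repr_eq_zero_of_iSupIndep e par B.iSupIndep_part hpar hx hk }
  have hwt : ∀ k, B'.wt k = if e k ∈ LinearMap.range E.toFun then 0 else 1 := fun _ => rfl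
  refine ⟨B', fun k => ?_, ?_⟩
  · rw [hwt]
    split_ifs with h
    · exact Or.inl ⟨rfl, h⟩
    · exact Or.inr rfl
  · rintro _ ⟨x, rfl⟩
    rw [← BN.e.sum_repr x, map_sum]
    refine Submodule.sum_mem _ fun k _ => ?_
    rw [map_smul]
    refine Submodule.smul_mem _ _ ?_
    obtain ⟨m, hm⟩ := Module.Basis.subset_extendLe hs hst ht ⟨k, rfl⟩
    have h1 : B'.e (Fintype.equivFin _ m) = E.toFun (BN.e k) := by
      change e _ = _
      rw [Module.Basis.reindex_apply, Equiv.symm_apply_apply]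
      exact hm
    have h2 := B'.e_mem_gr (Fintype.equivFin _ m)
    rwa [hwt, if_pos (h1.symm ▸ LinearMap.mem_range_self _ _), h1] at h2

/-- The retraction kills the adapted basis vectors outside the subspace. It gives injectivity of the
map of symmetric superalgebras. -/
theorem exists_retraction : ∃ r : SuperSym P →ₐ[ℂ] SuperSym PN, ∀ t, r (E.map t) = t := by
  classical
  obtain ⟨B', h1, h2⟩ := E.exists_adapted
  have hpre : ∀ k, ∃ y ∈ PN (B'.par k), B'.wt k = 0 → E.toFun y = B'.e k := by
    intro k
    rcases h1 k with ⟨h, y, hy⟩ | h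
    · exact ⟨y, E.mem_part_iff.1 (hy ▸ B'.mem_par k), fun _ => hy⟩
    · exact ⟨0, Submodule.zero_mem _, fun h' => by omega⟩
  choose y hy1 hy2 using hpre
  let r := B'.constr (fun k => SuperSym.ι PN (y k)) fun k m =>
    SuperSym.ι_mul_ι PN (hy1 k) (hy1 m)
  refine ⟨r, fun t => ?_⟩
  have : r.comp E.map = AlgHom.id ℂ _ := by
    refine SuperSym.algHom_ext fun x => ?_
    rw [AlgHom.comp_apply, map_ι, B'.ι_eq_sum, map_sum]
    simp only [map_smul, r, HomBasis.constr_X]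
    rw [AlgHom.id_apply]
    simp only [← map_smul]
    rw [← map_sum]
    congr 1
    refine E.inj ?_
    rw [map_sum]
    conv_rhs => rw [← B'.e.sum_repr (E.toFun x)]
    refine Finset.sum_congr rfl fun k _ => ?_
    rw [map_smul]
    by_cases hk : B'.wt k = 0
    · rw [hy2 k hk]
    · rw [h2 (LinearMap.mem_range_self _ x) k hk, zero_smul, zero_smul]
  exact AlgHom.congr_fun this t

/-- An element killed by all derivations vanishing on a subspace lies in the symmetric
superalgebra of the subspace. -/
theorem mem_range_map_of_der {s : SuperSym P}
    (h : ∀ (p : ZMod 2) (φ : V →ₗ[ℂ] ℂ) (hφ : HomBasis.IsOfParity P p φ),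
      (∀ x, φ (E.toFun x) = 0) → B.der hφ s = 0) : s ∈ E.map.range := by
  obtain ⟨B', h1, h2⟩ := E.exists_adapted
  -- By Euler's identity this multiplies a monomial by the number of its factors outside the
  -- subspace. The hypothesis makes s a null vector, as only derivations that vanish on the subspace
  -- enter.
  let T : SuperSym P →ₗ[ℂ] SuperSym P :=
    ∑ k, (B'.wt k : ℂ) • (LinearMap.mulLeft ℂ (B'.X k) ∘ₗ B'.d k)
  -- A partial inverse of T. The total weight is the first degree minus twice the second, since each
  -- factor contributes (wt + 2, 1); where it is zero, T vanishes and the value of the inverse is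
  -- immaterial.
  let J : SuperSym P →ₗ[ℂ] SuperSym P :=
    (Finsupp.lsum ℂ fun c : ℤ × ℤ => ((c.1 - 2 * c.2 : ℤ) : ℂ)⁻¹ • LinearMap.id) ∘ₗ
      { toFun := fun f => (B'.gradeHom f).coeff
        map_add' := by simp
        map_smul' := by simp }
  have hdeg : ∀ w, (B'.deg w).1 - 2 * (B'.deg w).2 = (w.map B'.wt).sum := by
    intro w
    induction w with
    | nil => simp
    | cons k w ih => simp only [HomBasis.deg_cons, Prod.fst_add, Prod.snd_add, List.map_cons,
        List.sum_cons, ← ih]; ring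
  have hT : T s = 0 := by
    simp only [T, LinearMap.sum_apply, LinearMap.smul_apply, LinearMap.comp_apply]
    refine Finset.sum_eq_zero fun k _ => ?_
    rcases h1 k with ⟨h0, -⟩ | h0
    · rw [h0, Int.cast_zero, zero_smul]
    · have : B'.d k s = 0 := by
        rw [HomBasis.d, ← B.der_congr]
        exact h _ _ _ fun x => h2 (LinearMap.mem_range_self _ x) k (by omega)
      rw [this, map_zero, smul_zero]
  have hJT : J ∘ₗ T = B'.projOn {c | c.1 - 2 * c.2 = 0}ᶜ := B'.linearMap_ext fun w => by
    have e1 : T (B'.mon w) = ((w.map B'.wt).sum : ℂ) • B'.mon w := by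
      have := B'.sum_X_mul_d_mon (fun k => (B'.wt k : ℂ)) w
      simp only [T, LinearMap.sum_apply, LinearMap.smul_apply, LinearMap.comp_apply,
        LinearMap.mulLeft_apply, this]
      congr 1
      clear this
      induction w with
      | nil => simp
      | cons k w ih => simp [ih]
    rw [LinearMap.comp_apply, e1, map_smul, HomBasis.projOn_mon]
    simp only [J, LinearMap.comp_apply, LinearMap.coe_mk, AddHom.coe_mk, HomBasis.gradeHom_mon,
      AddMonoidAlgebra.coeff_single, Finsupp.lsum_single, LinearMap.smul_apply, LinearMap.id_apply,
      hdeg, Set.mem_compl_iff, Set.mem_ofPred_eq]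
    split_ifs with h0
    · rw [h0]; simp
    · rw [smul_smul, mul_inv_cancel₀ (by exact_mod_cast h0), one_smul]
  have hs : B'.projOn {c | c.1 - 2 * c.2 = 0} s = s := by
    have := B'.projOn_add_compl {c | c.1 - 2 * c.2 = 0} s
    rwa [← hJT, LinearMap.comp_apply, hT, map_zero, add_zero] at this
  -- The weights are 0 or 1, so a monomial of total weight 0 has all its factors in the subspace.
  have hle : B'.reg {c | c.1 - 2 * c.2 = 0} ≤ Subalgebra.toSubmodule E.map.range :=
    B'.reg_le fun w hw => by
      have hw' : (w.map B'.wt).sum = 0 := by rw [← hdeg]; exact hw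
      have h3 : ∀ w : List (Fin B'.dim), 0 ≤ (w.map B'.wt).sum := fun w =>
        List.sum_nonneg (by
          intro x hx
          obtain ⟨k, -, rfl⟩ := List.mem_map.1 hx
          rcases h1 k with ⟨h0, -⟩ | h0 <;> omega)
      clear hw
      change B'.mon w ∈ E.map.range
      induction w with
      | nil => exact Subalgebra.one_mem _
      | cons k w ih =>
        rw [List.map_cons, List.sum_cons] at hw'
        have := h3 w
        rcases h1 k with ⟨h0, y, hy⟩ | h0
        · rw [HomBasis.mon_cons]
          refine Subalgebra.mul_mem _ ⟨SuperSym.ι PN y, ?_⟩ (ih (by omega))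
          change E.map (SuperSym.ι PN y) = _
          rw [map_ι, hy]; rfl
        · omega
  rw [← hs]
  exact hle (B'.projOn_mem _ _)

end HomEmb

/-! ### Invariants -/

/-- The bidegrees below `(n, d)`: those of Kazhdan degree less than `n`, and those of Kazhdan
degree `n` and polynomial degree at least `d`. -/
def below (n d : ℤ) : Set (ℤ × ℤ) := {c | c.1 ≤ n ∧ (c.1 = n → d ≤ c.2)}

namespace Polarization

variable {g : Type*} [AddCommGroup g] [Module ℂ g] [LieSuperalgebra g]
  {V : Type*} [AddCommGroup V] [Module ℂ V] {P : ZMod 2 → Submodule ℂ V} {B : HomBasis P}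
  (D : Polarization g B)

/-- The functional `v ↦ χ([a, v])`. -/
def pair : g →ₗ[ℂ] V →ₗ[ℂ] ℂ := ((br (g := g)).compr₂ D.χ).compl₂ D.sec

theorem pair_apply (a v) : D.pair a v = D.χ (br a (D.sec v)) := rfl

theorem isOfParity_pair {i : ZMod 2} {a : g} (ha : a ∈ part i) :
    HomBasis.IsOfParity P i (D.pair a) := by
  intro j hj v hv
  refine D.χ_odd _ ?_
  have h := LieSuperalgebra.br_mem ha (D.sec_part hv)
  have hij : ∀ i j : ZMod 2, j ≠ i → i + j = 1 := by decide
  rwa [hij i j hj] at h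

theorem pair_eq_zero {j k : ℤ} {a : g} (ha : a ∈ D.gr j) {v} (hv : v ∈ B.gr k) (h : j + k ≠ -2) :
    D.pair a v = 0 :=
  D.χ_gr _ h _ (D.br_mem_gr ha (D.sec_gr hv))

/-- When a passes a factor X_k, the bracket [a, e_k] contributes the scalar χ([a, e_k]), which is
the derivation, and a vector of V. The derivation has bidegree (K + j, e - 1). The vector replaces
the factor, so it leaves the polynomial degree equal to e in the same Kazhdan degree, and all other
errors have smaller Kazhdan degree. -/
theorem rep_sub_der_mon (hgr : ∀ a, IsSuperSubspace (D.gr a)) (hsec : ∀ v, D.χ (D.sec v) = 0)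
    {i : ZMod 2} {j : ℤ} {a : g} (ha : a ∈ part i)
    (haj : a ∈ D.gr j) (hq : D.q a = 0) (w) {K e : ℤ} (hd : B.deg w = (K, e)) :
    D.rep a (B.mon w) - D.χ a • B.mon w - B.der (D.isOfParity_pair ha) (B.mon w) ∈
      B.reg (below (K + j) e) := by
  have htl : ∀ f, D.tl a f = D.χ a • f := fun f => by rw [tl_apply, hq, map_zero, zero_mul, zero_add]
  induction w generalizing K e with
  | nil =>
    rw [HomBasis.mon_nil, D.rep_one hgr, htl, B.der_one, sub_self, sub_zero]
    exact Submodule.zero_mem _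
  | cons k w ih =>
    have hfw : B.mon w ∈ B.reg {B.deg w} := B.mon_mem_reg (Set.mem_singleton _)
    rw [HomBasis.mon_cons, B.der_X_mul]
    obtain ⟨K, e, hw⟩ : ∃ K e, B.deg w = (K, e) := ⟨_, _, rfl⟩
    rw [HomBasis.deg_cons, hw] at hd
    obtain ⟨rfl, rfl⟩ := Prod.mk.inj hd
    have ih := ih hw
    rw [hw] at hfw
    clear hd hw
    generalize B.mon w = f at *
    have hx : D.sec (B.e k) ∈ D.gr (B.wt k) := D.sec_gr (B.e_mem_gr k)
    have hxp : D.sec (B.e k) ∈ part (B.par k) := D.sec_part (B.mem_par k)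
    have hX : ∀ f, D.tl (D.sec (B.e k)) f = B.X k * f := fun f => by
      rw [tl_apply, D.q_sec, hsec, zero_smul, add_zero]; rfl
    have hcomm := LinearMap.congr_fun (D.rep_comm hgr ha hxp) f
    rw [LinearMap.sub_apply, LinearMap.smul_apply, Module.End.mul_apply, Module.End.mul_apply]
      at hcomm
    have h0 : D.rep (D.sec (B.e k)) f - D.tl (D.sec (B.e k)) f ∈ B.reg {c | c.1 ≤ K + B.wt k} :=
      D.rep_low hgr hx (fun c hc c' h1 _ => by
        rw [Set.mem_singleton_iff] at hc
        subst hc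
        exact (by simpa using h1 : c'.1 ≤ K + B.wt k)) hfw
    have h1 := D.rep_low hgr haj (R' := {c | c.1 ≤ K + B.wt k + j}) (fun c
      (hc : c.1 ≤ K + B.wt k) c' h1 _ => (by omega : c'.1 ≤ K + B.wt k + j)) h0
    have h2 := D.rep_low hgr (D.br_mem_gr haj hx) (R' := {c | c.1 ≤ K + B.wt k + j})
      (fun c hc c' h1 _ => by
        rw [Set.mem_singleton_iff] at hc
        subst hc
        exact (by dsimp only at h1; omega : c'.1 ≤ K + B.wt k + j)) hfw
    -- The only error of the same Kazhdan degree as the derivation; its polynomial degree is larger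
    -- by one.
    have h2' : SuperSym.ι P (D.q (br a (D.sec (B.e k)))) * f ∈
        B.reg {(K + j + B.wt k + 2, e + 1)} :=
      B.mul_mem_reg (R := {(j + B.wt k + 2, 1)}) (by
        rintro a ha b hb
        rw [Set.mem_singleton_iff] at ha hb
        rw [ha, hb, Set.mem_singleton_iff, Prod.mk_add_mk]
        congr 1 <;> ring)
        (B.ι_mem_reg (Set.mem_singleton _) (D.q_gr (D.br_mem_gr haj hx))) hfw
    have hder : B.der (D.isOfParity_pair ha) f ∈ B.reg {c | c.1 ≤ K + j} :=
      B.der_mem_reg _ (j := -2 - j) (fun m hm => D.pair_eq_zero haj (B.e_mem_gr m) (by omega))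
        (by
          intro c hc
          rw [Set.mem_singleton_iff] at hc
          subst hc
          exact (by omega : K - (-2 - j + 2) ≤ K + j)) hfw
    have h3 := D.rep_low hgr hx (R' := {c | c.1 ≤ K + B.wt k + j})
      (fun c (hc : c.1 ≤ K + j) c' h1 _ => (by omega : c'.1 ≤ K + B.wt k + j))
      (Submodule.add_mem _ hder (B.reg_mono (fun c hc => hc.1) ih))
    have h4 : B.X k * (D.rep a f - D.χ a • f - B.der (D.isOfParity_pair ha) f) ∈
        B.reg (below (B.wt k + 2 + K + j) (1 + e)) :=
      B.mul_mem_reg (R := {(B.wt k + 2, 1)}) (by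
        rintro a ha b ⟨hb1, hb2⟩
        rw [Set.mem_singleton_iff] at ha
        rw [ha]
        exact ⟨by simp; omega, fun h => by simp at h ⊢; exact hb2 (by omega)⟩)
        (B.ι_mem_reg (Set.mem_singleton _) (B.e_mem_gr k)) ih
    have hle : B.reg {c | c.1 ≤ K + B.wt k + j} ≤ B.reg (below (B.wt k + 2 + K + j) (1 + e)) :=
      B.reg_mono fun c (hc : c.1 ≤ K + B.wt k + j) => ⟨by omega, fun h => by omega⟩
    have hle2 : B.reg {(K + j + B.wt k + 2, e + 1)} ≤
        B.reg (below (B.wt k + 2 + K + j) (1 + e)) :=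
      B.reg_mono (Set.singleton_subset_iff.2 ⟨by simp; omega, fun h => by simp; omega⟩)
    have hs := D.χ_sign ha (B.par k)
    rw [htl] at h1
    rw [hX] at h0 h1 h3
    rw [tl_apply] at h2
    rw [pair_apply]
    generalize superSign i (B.par k) = t at *
    -- The error terms are X_k times the inductive error, the lower part of the action of e_k on (a
    -- - χ(a)) f, the two parts coming from the bracket, and a - χ(a) applied to the lower part of
    -- the action of e_k on f.
    have key := Submodule.sub_mem _ (Submodule.add_mem _ (Submodule.add_mem _
      (Submodule.smul_mem _ t (Submodule.add_mem _ h4 (hle h3))) (hle2 h2')) (hle h2)) (hle h1)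
    convert key using 1
    simp only [map_sub, map_add, map_smul, mul_sub, mul_add, mul_smul_comm] at hcomm ⊢
    rw [← hcomm]
    simp only [smul_sub, smul_add, smul_smul, hs]
    module

theorem _root_.FinW.HomBasis.der_of_eq (B : HomBasis P) {p : ZMod 2} {φ ψ : V →ₗ[ℂ] ℂ} (h : φ = ψ)
    (hφ : HomBasis.IsOfParity P p φ) (hψ : HomBasis.IsOfParity P p ψ) : B.der hφ = B.der hψ := by
  subst h; rfl

theorem rep_sub_der (hgr : ∀ a, IsSuperSubspace (D.gr a)) (hsec : ∀ v, D.χ (D.sec v) = 0)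
    {i : ZMod 2} {j : ℤ} {a : g} (ha : a ∈ part i) (haj : a ∈ D.gr j) (hq : D.q a = 0)
    {n d : ℤ} {f} (hf : f ∈ B.reg (below n d)) :
    D.rep a f - D.χ a • f - B.der (D.isOfParity_pair ha) f ∈ B.reg (below (n + j) d) := by
  have : B.reg (below n d) ≤ (B.reg (below (n + j) d)).comap
      (D.rep a - D.χ a • LinearMap.id - B.der (D.isOfParity_pair ha)) := B.reg_le fun w hw => by
    refine B.reg_mono ?_ (D.rep_sub_der_mon hgr hsec ha haj hq w rfl)
    have hw1 : (B.deg w).1 ≤ n := hw.1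
    have hw2 : (B.deg w).1 = n → d ≤ (B.deg w).2 := hw.2
    intro c hc
    have hc1 : c.1 ≤ (B.deg w).1 + j := hc.1
    have hc2 : c.1 = (B.deg w).1 + j → (B.deg w).2 ≤ c.2 := hc.2
    exact ⟨by omega, fun h => by have := hw2 (by omega); have := hc2 (by omega); omega⟩
  exact this hf

/-- The derivation depends linearly on a, so vanishing for bihomogeneous elements of the kernel
passes to the parity components of all its elements. -/
theorem der_eq_zero_of_pair {s : SuperSym P}
    (hker : LinearMap.ker D.q ≤ ⨆ j, ⨆ i, LinearMap.ker D.q ⊓ D.gr j ⊓ part i)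
    (h : ∀ i j a, (ha : a ∈ part i) → a ∈ D.gr j → D.q a = 0 →
      B.der (D.isOfParity_pair ha) s = 0) {a : g} (ha : D.q a = 0) (p : ZMod 2) :
    B.der (D.isOfParity_pair (parityProj_mem p a)) s = 0 := by
  let M : Submodule ℂ g :=
    { carrier := {a | B.der (D.isOfParity_pair (parityProj_mem p a)) s = 0}
      zero_mem' := by
        have h0 : D.pair (parityProj p (0 : g)) = 0 := by rw [map_zero, map_zero]
        change B.der _ s = 0
        rw [B.der_of_eq h0 _ fun _ _ _ _ => rfl]
        exact B.der_zero _ s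
      add_mem' := by
        intro a b (ha : _ = 0) (hb : _ = 0)
        have h0 : D.pair (parityProj p (a + b)) = D.pair (parityProj p a) + D.pair (parityProj p b) := by
          rw [map_add, map_add]
        change B.der _ s = 0
        rw [B.der_of_eq h0 _ (h0 ▸ D.isOfParity_pair (parityProj_mem p (a + b))),
          B.der_add (D.isOfParity_pair (parityProj_mem p a))
            (D.isOfParity_pair (parityProj_mem p b)), ha, hb, add_zero]
      smul_mem' := by
        intro c a (ha : _ = 0)
        have h0 : D.pair (parityProj p (c • a)) = c • D.pair (parityProj p a) := by
          rw [map_smul, map_smul]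
        change B.der _ s = 0
        rw [B.der_of_eq h0 _ (h0 ▸ D.isOfParity_pair (parityProj_mem p (c • a))),
          B.der_smul (D.isOfParity_pair (parityProj_mem p a)), ha, smul_zero] }
  have hM : (⨆ j, ⨆ i, LinearMap.ker D.q ⊓ D.gr j ⊓ part i) ≤ M :=
    iSup_le fun j => iSup_le fun i b hb => by
      change B.der (D.isOfParity_pair (parityProj_mem p b)) s = 0
      by_cases hip : i = p
      · subst hip
        rw [B.der_of_eq (congrArg D.pair (parityProj_of_mem hb.2)) _ (D.isOfParity_pair hb.2)]
        exact h i j b hb.2 hb.1.2 hb.1.1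
      · rw [B.der_of_eq (by rw [parityProj_of_mem_ne hip hb.2, map_zero]) _ fun _ _ _ _ => rfl]
        exact B.der_zero _ s
  exact hM (hker ha)

/-- The lowest component of an invariant lies in the symmetric superalgebra of any subspace that
contains the vectors orthogonal to the kernel of `q`. -/
theorem exists_of_invariant (hgr : ∀ a, IsSuperSubspace (D.gr a)) (hsec : ∀ v, D.χ (D.sec v) = 0)
    (hker : LinearMap.ker D.q ≤ ⨆ j, ⨆ i, LinearMap.ker D.q ⊓ D.gr j ⊓ part i)
    {N : Type*} [AddCommGroup N] [Module ℂ N] {PN : ZMod 2 → Submodule ℂ N} {BN : HomBasis PN}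
    (E : HomEmb B BN)
    (hE : ∀ v, (∀ a, D.q a = 0 → D.pair a v = 0) → v ∈ LinearMap.range E.toFun)
    {n d : ℤ} {f} (hf : f ∈ B.reg (below n d)) (hinv : ∀ a, D.q a = 0 → D.rep a f = D.χ a • f) :
    ∃ t ∈ BN.reg {(n, d)}, f - E.map t ∈ B.reg (below n (d + 1)) := by
  have : FiniteDimensional ℂ V := Module.Finite.of_basis B.e
  have hs : f - B.projOn {(n, d)} f ∈ B.reg (below n (d + 1)) := by
    rw [sub_eq_iff_eq_add'.2 (B.projOn_add_compl {(n, d)} f).symm]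
    rw [← B.projOn_of_mem le_rfl hf, B.projOn_projOn]
    refine B.reg_mono ?_ (B.projOn_mem _ _)
    rintro ⟨c1, c2⟩ ⟨hc, hc1, hc2⟩
    refine ⟨hc1, fun h => ?_⟩
    have := hc2 h
    rcases this.lt_or_eq with h' | h'
    · exact h'
    · exact (hc (Prod.ext h h'.symm)).elim
  -- By invariance the derivation of f is an error term, hence in `below (n + j) d`; so is the
  -- derivation of the rest of f. The derivation of the leading component has bidegree (n + j, d -
  -- 1), outside that region, and must be zero.
  have hder : ∀ i j a, (ha : a ∈ part i) → a ∈ D.gr j → D.q a = 0 →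
      B.der (D.isOfParity_pair ha) (B.projOn {(n, d)} f) = 0 := by
    intro i j a ha haj hq
    have h1 := D.rep_sub_der hgr hsec ha haj hq hf
    rw [hinv a hq, sub_self, zero_sub, Submodule.neg_mem_iff] at h1
    have hj : ∀ k, B.wt k ≠ -2 - j → D.pair a (B.e k) = 0 := fun m hm =>
      D.pair_eq_zero haj (B.e_mem_gr m) (by omega)
    have h2 := B.der_mem_reg (D.isOfParity_pair ha) (R' := below (n + j) d) hj (by
      rintro ⟨c1, c2⟩ ⟨hc1, hc2⟩
      exact ⟨(by omega : c1 - (-2 - j + 2) ≤ n + j), fun h => by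
        change c1 - (-2 - j + 2) = n + j at h
        have := hc2 (by omega : c1 = n)
        exact (by omega : d ≤ c2 - 1)⟩) hs
    have h3 := B.der_mem_reg (D.isOfParity_pair ha) (R' := {(n + j, d - 1)}) hj (by
      rintro c hc
      rw [Set.mem_singleton_iff] at hc
      subst hc
      exact Prod.ext (by simp; ring) rfl) (B.projOn_mem {(n, d)} f)
    rw [map_sub] at h2
    refine B.eq_zero_of_mem_reg_of_disjoint ?_ h3 ((Submodule.sub_mem_iff_right _ h1).1 h2)
    refine Set.disjoint_singleton_left.2 fun h => ?_
    have := h.2 rfl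
    omega
  obtain ⟨t, ht⟩ := E.mem_range_map_of_der (s := B.projOn {(n, d)} f) (by
    intro p φ hφ h
    -- V is finite-dimensional, so K is its own double annihilator: a functional that vanishes on
    -- everything orthogonal to the kernel of q is of the form χ([a, ·]) with a in that kernel.
    let K : Submodule ℂ (Module.Dual ℂ V) := (LinearMap.ker D.q).map D.pair
    have h1 : K.dualCoannihilator ≤ LinearMap.range E.toFun := fun v hv =>
      hE v fun a ha => (Submodule.mem_dualCoannihilator v).1 hv _ ⟨a, ha, rfl⟩
    have h2 : φ ∈ K.dualCoannihilator.dualAnnihilator :=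
      (Submodule.mem_dualAnnihilator φ).2 fun v hv => by
        obtain ⟨x, rfl⟩ := h1 hv
        exact h x
    rw [Subspace.dualCoannihilator_dualAnnihilator_eq] at h2
    obtain ⟨a, ha, rfl⟩ := h2
    -- The functional has parity p, so only the component of a of parity p matters; the other
    -- component pairs with vectors of the other parity.
    have h3 : D.pair a = D.pair (parityProj p a) := by
      have h4 : ∀ i v, v ∈ P i → D.pair a v = D.pair (parityProj p a) v := by
        intro i v hv
        by_cases hip : i = p
        · subst hip
          have hpar : ∃ i', i' ≠ i ∧ a = parityProj i a + parityProj i' a := by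
            rcases zmod_two_cases i with rfl | rfl
            · exact ⟨1, by decide, (parityProj_add a).symm⟩
            · exact ⟨0, by decide, by rw [add_comm]; exact (parityProj_add a).symm⟩
          obtain ⟨i', hi', e⟩ := hpar
          conv_lhs => rw [e, map_add, LinearMap.add_apply,
            D.isOfParity_pair (parityProj_mem i' a) i hi'.symm v hv, add_zero]
        · rw [hφ i hip v hv, D.isOfParity_pair (parityProj_mem p a) i hip v hv]
      refine B.e.ext fun k => h4 _ _ (B.mem_par k)
    have h5 := D.der_eq_zero_of_pair hker hder ha p
    rw [B.der_of_eq h3 _ (D.isOfParity_pair (parityProj_mem p a))]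
    exact h5)
  refine ⟨BN.projOn {(n, d)} t, BN.projOn_mem _ _, ?_⟩
  rw [E.map_projOn]
  change E.map t = _ at ht
  rw [ht, B.projOn_projOn, Set.inter_self]
  exact hs

end Polarization
end FinW
end

open scoped DirectSum TensorProduct
noncomputable section
namespace FinW
open LieSuperalgebra (part br)

/-! ### Elements of the finite `W`-algebra -/

namespace GoodGrading

variable {g : Type*} [AddCommGroup g] [Module ℂ g] [LieSuperalgebra g]
  {χ : EvenFunctional g} {G : GoodGrading χ} {l l' : Submodule ℂ g}

theorem toQ_apply (X : G.W l) : G.toQ l X = X.toEnd (G.π l 1) := rfl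

theorem toEnd_π (X : G.W l) (u : Env g) : X.toEnd (G.π l u) = u • G.toQ l X := by
  rw [π_eq_smul, map_smul]; rfl

theorem toQ_injective (l : Submodule ℂ g) : Function.Injective (G.toQ l) := by
  intro X Y h
  refine MulOpposite.unop_injective (LinearMap.ext fun q => ?_)
  obtain ⟨u, rfl⟩ := Submodule.mkQ_surjective _ q
  exact (toEnd_π X u).trans ((congrArg (u • ·) h).trans (toEnd_π Y u).symm)

theorem toQ_mul {X Y : G.W l} {u : Env g} (hX : G.toQ l X = G.π l u) :
    G.toQ l (X * Y) = u • G.toQ l Y := by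
  rw [← toEnd_π, ← hX]; rfl

theorem ι_smul_π_one {a : g} (ha : a ∈ G.m l) :
    Env.ι a • G.π l 1 = (χ.toLin a • (1 : Env g)) • G.π l 1 := by
  have h := π_mul_ι ha 1
  rw [one_mul, π_eq_smul] at h
  rw [h, smul_assoc, one_smul]

theorem ι_smul_toQ (X : G.W l) {a : g} (ha : a ∈ G.m l) :
    Env.ι a • G.toQ l X = (χ.toLin a • (1 : Env g)) • G.toQ l X := by
  rw [toQ_apply, ← map_smul, ι_smul_π_one ha, map_smul]

/-- Q_χ is generated by π(1), whose annihilator is the left ideal I_χ, so an endomorphism may send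
π(1) to any vector on which m acts by χ. -/
theorem exists_toQ_eq {u : Env g}
    (h : ∀ a ∈ G.m l, (Env.ι a - χ.toLin a • (1 : Env g)) * u ∈ G.I l) :
    ∃ X : G.W l, G.toQ l X = G.π l u := by
  refine ⟨MulOpposite.op ((G.I l).liftQ (LinearMap.toSpanSingleton (Env g) (G.Q l) (G.π l u)) ?_), ?_⟩
  · refine Submodule.span_le.2 ?_
    rintro _ ⟨a, ha, rfl⟩
    change (Env.ι a - algebraMap ℂ (Env g) (χ.toLin a)) • G.π l u = 0
    rw [← π_mul, Algebra.algebraMap_eq_smul_one]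
    exact (Submodule.Quotient.mk_eq_zero _).2 (h a ha)
  · exact one_smul (Env g) (G.π l u)

theorem mul_mem_I (X : G.W l) {u : Env g} (hX : G.toQ l X = G.π l u) {a : g} (ha : a ∈ G.m l) :
    (Env.ι a - χ.toLin a • (1 : Env g)) * u ∈ G.I l := by
  have h := ι_smul_toQ X ha
  rw [hX, ← π_mul, ← π_mul, ← sub_eq_zero, ← map_sub, ← sub_mul] at h
  exact (Submodule.Quotient.mk_eq_zero _).1 h

/-! #### The parity automorphism -/

/-- The map `(-1)^|x| x`. -/
def parityFlip : g →ₗ[ℂ] g := parityProj 0 - parityProj 1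

theorem parityFlip_of_mem {i : ZMod 2} {x : g} (hx : x ∈ part i) :
    parityFlip x = superSign i 1 • x := by
  rcases zmod_two_cases i with rfl | rfl
  · rw [parityFlip, LinearMap.sub_apply, parityProj_of_mem hx, parityProj_of_mem_ne (by decide) hx]
    simp
  · rw [parityFlip, LinearMap.sub_apply, parityProj_of_mem hx, parityProj_of_mem_ne (by decide) hx]
    simp

theorem parityFlip_parityFlip (x : g) : parityFlip (parityFlip x) = x := by
  rw [← parityProj_add x, map_add, map_add, parityFlip_of_mem (parityProj_mem 0 x),
    parityFlip_of_mem (parityProj_mem 1 x), map_smul, map_smul,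
    parityFlip_of_mem (parityProj_mem 0 x), parityFlip_of_mem (parityProj_mem 1 x)]
  simp

theorem χ_parityFlip (χ : EvenFunctional g) (x : g) : χ.toLin (parityFlip x) = χ.toLin x := by
  conv_rhs => rw [← parityProj_add x]
  rw [parityFlip, LinearMap.sub_apply, map_sub, map_add, χ.map_odd _ (parityProj_mem 1 x)]
  simp

/-- The parity automorphism of the enveloping superalgebra. -/
def envFlip : Env g →ₐ[ℂ] Env g :=
  RingQuot.liftAlgHom ℂ ⟨TensorAlgebra.lift ℂ (Env.ι ∘ₗ parityFlip), by
    rintro _ _ ⟨hx, hy⟩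
    rename_i i j x y
    simp only [map_sub, map_mul, map_smul, TensorAlgebra.lift_ι_apply, LinearMap.comp_apply,
      parityFlip_of_mem hx, parityFlip_of_mem hy, parityFlip_of_mem (LieSuperalgebra.br_mem hx hy),
      superSign_add_left, ← env_ι_mul_ι hx hy, smul_mul_smul_comm, smul_sub]
    rw [mul_comm (superSign j 1), smul_comm (superSign i j)]⟩

theorem envFlip_ι (x : g) : envFlip (Env.ι x) = Env.ι (parityFlip x) := by
  simp [envFlip, Env.ι]

theorem envFlip_of_mem {n : ℤ} {i : ZMod 2} {u : Env g} (hu : u ∈ G.kazhdanUPar n i) :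
    envFlip u = superSign i 1 • u := by
  induction hu using Submodule.span_induction with
  | mem u hu =>
    obtain ⟨w, h1, ⟨-, h3⟩, rfl⟩ := hu
    rw [← h3]
    clear h3
    induction w with
    | nil => simp
    | cons q w ih =>
      rw [List.map_cons, List.prod_cons, map_mul, envFlip_ι,
        ih fun q hq => h1 q (List.mem_cons_of_mem _ hq),
        parityFlip_of_mem (h1 q List.mem_cons_self).2, map_smul, smul_mul_smul_comm,
        List.map_cons, List.map_cons, List.sum_cons, superSign_add_left]
  | zero => simp
  | add u v _ _ hu hv => rw [map_add, hu, hv, smul_add]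
  | smul c v _ hv => rw [map_smul, hv, smul_comm]

theorem envFlip_mem_I (hl : G.IsIsotropic l) {u : Env g} (hu : u ∈ G.I l) :
    envFlip u ∈ G.I l := by
  induction hu using Submodule.span_induction with
  | mem u hu =>
    obtain ⟨a, ha, rfl⟩ := hu
    refine Submodule.subset_span ⟨parityFlip a, ?_, ?_⟩
    · exact Submodule.sub_mem _ ((isBigraded_m hl).isSuper.parityProj_mem 0 ha)
        ((isBigraded_m hl).isSuper.parityProj_mem 1 ha)
    · rw [map_sub, envFlip_ι, AlgHom.commutes, χ_parityFlip]
  | zero => simp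
  | add u v _ _ hu hv => rw [map_add]; exact Submodule.add_mem _ hu hv
  | smul c v _ hv => rw [smul_eq_mul, map_mul]; exact Submodule.smul_mem _ _ hv

/-- The elements of `W_χ` of Kazhdan degree at most `n` and parity `i`. -/
def kazhdanWPar (l : Submodule ℂ g) (n : ℤ) (i : ZMod 2) : Submodule ℂ (G.W l) :=
  ((G.kazhdanUPar n i).map ((G.π l).restrictScalars ℂ)).comap (G.toQ l)

theorem kazhdanWPar_le_kazhdanW (n : ℤ) (i : ZMod 2) :
    G.kazhdanWPar l n i ≤ G.kazhdanW l n :=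
  Submodule.comap_mono (Submodule.map_mono (G.kazhdanUPar_le_kazhdanU n i))

theorem kazhdanWPar_le_parityW (n : ℤ) (i : ZMod 2) :
    G.kazhdanWPar l n i ≤ G.parityW l i :=
  Submodule.comap_mono (Submodule.map_mono (G.kazhdanUPar_le_parity n i))

/-- The parity automorphism of U(g) preserves I_χ, because m is a super subspace and χ is even. So
with u₀ + u₁ also u₀ - u₁ represents an element of W_χ, and half the sum and half the difference are
the two components. -/
theorem exists_parity_components (hl : G.IsIsotropic l) {n : ℤ} {X : G.W l}
    (hX : X ∈ G.kazhdanW l n) :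
    ∃ X₀ ∈ G.kazhdanWPar l n 0, ∃ X₁ ∈ G.kazhdanWPar l n 1, X = X₀ + X₁ := by
  obtain ⟨u, hu, hu'⟩ := hX
  obtain ⟨u₀, h₀, u₁, h₁, rfl⟩ := Submodule.mem_sup.1 (G.kazhdanU_le_sup n hu)
  have h : ∀ a ∈ G.m l, (Env.ι a - χ.toLin a • (1 : Env g)) * (u₀ + u₁) ∈ G.I l := fun a ha =>
    mul_mem_I X hu'.symm ha
  have h' : ∀ a ∈ G.m l, (Env.ι a - χ.toLin a • (1 : Env g)) * (u₀ - u₁) ∈ G.I l := by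
    intro a ha
    have := envFlip_mem_I hl (h (parityFlip a) (Submodule.sub_mem _
      ((isBigraded_m hl).isSuper.parityProj_mem 0 ha)
      ((isBigraded_m hl).isSuper.parityProj_mem 1 ha)))
    rw [map_mul, map_sub, map_smul, map_one, envFlip_ι, parityFlip_parityFlip, χ_parityFlip,
      map_add, envFlip_of_mem h₀, envFlip_of_mem h₁] at this
    have e : superSign 1 1 • u₁ = -u₁ := by rw [superSign_one_one]; module
    rwa [e, superSign_zero_left, one_smul, ← sub_eq_add_neg] at this
  have e₀ : ∀ b : Env g, b * u₀ = (2⁻¹ : ℂ) • (b * (u₀ + u₁) + b * (u₀ - u₁)) := fun b => by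
    rw [← mul_add, ← mul_smul_comm]
    congr 1
    module
  have e₁ : ∀ b : Env g, b * u₁ = (2⁻¹ : ℂ) • (b * (u₀ + u₁) - b * (u₀ - u₁)) := fun b => by
    rw [← mul_sub, ← mul_smul_comm]
    congr 1
    module
  have hI : ∀ (c : ℂ) u, u ∈ G.I l → c • u ∈ G.I l := fun c u hu =>
    ((G.I l).restrictScalars ℂ).smul_mem c hu
  obtain ⟨X₀, hX₀⟩ := exists_toQ_eq (u := u₀) fun a ha => by
    rw [e₀]; exact hI _ _ (Submodule.add_mem _ (h a ha) (h' a ha))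
  obtain ⟨X₁, hX₁⟩ := exists_toQ_eq (u := u₁) fun a ha => by
    rw [e₁]; exact hI _ _ (Submodule.sub_mem _ (h a ha) (h' a ha))
  refine ⟨X₀, ⟨u₀, h₀, hX₀.symm⟩, X₁, ⟨u₁, h₁, hX₁.symm⟩, toQ_injective l ?_⟩
  rw [map_add, hX₀, hX₁, ← hu']
  exact map_add _ _ _

theorem parityW_mul {i j : ZMod 2} {X Y : G.W l} (hX : X ∈ G.parityW l i) (hY : Y ∈ G.parityW l j) :
    X * Y ∈ G.parityW l (i + j) := by
  obtain ⟨u, hu, hu'⟩ := hX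
  obtain ⟨v, hv, hv'⟩ := hY
  refine ⟨u * v, mul_mem_monomialSpan (fun l m h1 h2 => by rw [List.sum_append, h1, h2]) hu hv, ?_⟩
  change G.π l u = _ at hu'
  change G.π l v = _ at hv'
  rw [toQ_mul hu'.symm, ← hv']
  exact π_mul l u v

theorem W_supercomm {m n k : ℤ} {i s : ZMod 2} {X Y : G.W l} (hX : X ∈ G.kazhdanWPar l m i)
    (hY : Y ∈ G.kazhdanWPar l n s) (hk : m + n - 2 ≤ k) :
    X * Y - superSign i s • (Y * X) ∈ G.kazhdanW l k := by
  obtain ⟨u, hu, hu'⟩ := hX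
  obtain ⟨v, hv, hv'⟩ := hY
  refine ⟨_, G.supercomm hu hv hk, ?_⟩
  change G.π l u = _ at hu'
  change G.π l v = _ at hv'
  rw [map_sub, map_smul, map_sub, map_smul, toQ_mul hu'.symm, toQ_mul hv'.symm, ← hu', ← hv',
    ← π_mul, ← π_mul]
  rfl

variable [FiniteDimensional ℂ g] (hl : G.IsIsotropic l) (hl' : G.IsAdmissibleComplement l l')

/-- If X is the class of u, then X Y is u applied to Y; thus products in W_χ have multiplicative
leading terms by `actS_sub`. -/
theorem symbQ_toQ_mul {m n k : ℤ} (hk : m + n - 1 ≤ k) {X Y : G.W l} (hX : X ∈ G.kazhdanW l m)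
    (hY : Y ∈ G.kazhdanW l n) :
    symbQ hl hl' (G.toQ l (X * Y)) - symbQ hl hl' (G.toQ l X) * symbQ hl hl' (G.toQ l Y) ∈
      (basisPL hl').reg {c | c.1 ≤ k} := by
  obtain ⟨u, hu, hu'⟩ := hX
  change G.π l u = _ at hu'
  rw [toQ_mul hu'.symm, symbQ_smul, ← hu', symbQ_π]
  exact actS_sub hl hl' hk hu (symbQ_mem hl hl' hY)

/-- This makes the images of elements of W_χ invariants in the sense of `exists_of_invariant`. -/
theorem rep_symbQ_toQ (X : G.W l) {a : g} (ha : a ∈ G.m l) :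
    (polarization hl hl').rep a (symbQ hl hl' (G.toQ l X)) =
      χ.toLin a • symbQ hl hl' (G.toQ l X) := by
  rw [← actS_ι, ← symbQ_smul, ι_smul_toQ X ha, symbQ_smul, map_smul, map_one]
  rfl

/-! #### Parity of symbols -/

/-- The parity automorphism of the symmetric superalgebra of `p ⊕ l'`. -/
def symFlip : G.SymPL l' →ₐ[ℂ] G.SymPL l' :=
  (basisPL hl').constr (fun k => superSign ((basisPL hl').par k) 1 • (basisPL hl').X k) (by
    intro k m
    rw [smul_mul_smul_comm, smul_mul_smul_comm, HomBasis.X_mul_X, smul_comm,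
      mul_comm (superSign ((basisPL hl').par k) 1)])

theorem symFlip_ι {i : ZMod 2} {x : (G.p ⊔ l' : Submodule ℂ g)} (hx : (x : g) ∈ part i) :
    symFlip hl' (SuperSym.ι _ x) = superSign i 1 • SuperSym.ι _ x := by
  rw [(basisPL hl').ι_eq_sum, map_sum, Finset.smul_sum]
  refine Finset.sum_congr rfl fun k _ => ?_
  rw [map_smul, symFlip, HomBasis.constr_X, smul_comm]
  by_cases hk : (basisPL hl').par k = i
  · rw [hk]
  · rw [(basisPL hl').repr_par hx k hk, zero_smul, smul_zero, smul_zero]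

theorem symFlip_mem {R : Set (ℤ × ℤ)} {f} (hf : f ∈ (basisPL hl').reg R) :
    symFlip hl' f ∈ (basisPL hl').reg R := by
  have : (basisPL hl').reg R ≤ ((basisPL hl').reg R).comap (symFlip hl').toLinearMap :=
    HomBasis.reg_le _ fun w hw => by
      have : ∃ c : ℂ, symFlip hl' ((basisPL hl').mon w) = c • (basisPL hl').mon w := by
        clear hw
        induction w with
        | nil => exact ⟨1, by simp⟩
        | cons k w ih =>
          obtain ⟨c, hc⟩ := ih
          refine ⟨superSign ((basisPL hl').par k) 1 * c, ?_⟩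
          rw [HomBasis.mon_cons, map_mul, hc, symFlip, HomBasis.constr_X, smul_mul_smul_comm]
      obtain ⟨c, hc⟩ := this
      change symFlip hl' _ ∈ (basisPL hl').reg R
      rw [hc]
      exact Submodule.smul_mem _ _ (HomBasis.mon_mem_reg _ hw)
  exact this hf

theorem symFlip_tl {i : ZMod 2} {x : g} (hx : x ∈ part i) (f) :
    symFlip hl' ((polarization hl hl').tl x f) =
      superSign i 1 • (polarization hl hl').tl x (symFlip hl' f) := by
  have h := (polarization hl hl').χ_sign hx 1
  have h2 : symFlip hl' (SuperSym.ι _ ((polarization hl hl').q x)) =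
      superSign i 1 • SuperSym.ι _ ((polarization hl hl').q x) :=
    symFlip_ι hl' (i := i) (projPL_part hl hl' hx)
  rw [Polarization.tl_apply, Polarization.tl_apply, map_add, map_mul, map_smul, h2, smul_add,
    smul_mul_assoc, smul_smul, h]

/-- The sign automorphisms are compatible with the leading operators `tl`. Agreement up to lower
Kazhdan degree suffices, since only leading terms are compared. -/
theorem symFlip_symbU {n : ℤ} {i : ZMod 2} {u : Env g} (hu : u ∈ G.kazhdanUPar n i) :
    symFlip hl' (symbU hl hl' u) - superSign i 1 • symbU hl hl' u ∈
      (basisPL hl').reg {c | c.1 ≤ n - 1} := by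
  induction hu using Submodule.span_induction with
  | mem u hu =>
    obtain ⟨w, h1, ⟨h2, h3⟩, rfl⟩ := hu
    rw [← h3]
    clear h3
    induction w generalizing n with
    | nil => simp [symbU_one]
    | cons q w ih =>
      have hq := h1 q List.mem_cons_self
      have h1' : ∀ q ∈ w, q.2 ∈ G.gr q.1.1 ⊓ part q.1.2 :=
        fun q hq => h1 q (List.mem_cons_of_mem _ hq)
      simp only [List.map_cons, kazhdanDegree_cons] at h2
      have ih' := ih (n := n - (q.1.1 + 2)) h1' (by omega)
      have hw : (w.map fun q => Env.ι q.2).prod ∈ G.kazhdanU (n - (q.1.1 + 2)) :=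
        G.kazhdanUPar_le_kazhdanU _ _ (Submodule.subset_span ⟨w, h1', ⟨by omega, rfl⟩, rfl⟩)
      rw [List.map_cons, List.prod_cons, symbU_mul, List.map_cons, List.map_cons, List.sum_cons,
        superSign_add_left]
      generalize (w.map fun q => Env.ι q.2).prod = v at *
      generalize (List.map Prod.snd (List.map Prod.fst w)).sum = s at *
      have e1 := actS_ι_sub hl hl' hq.1 (k := n - 1) (by omega) (symbU_mem hl hl' hw)
      have e2 := symFlip_mem hl' e1
      have e3 := tl_mem_le hl hl' hq.1 (k := n - 1) (by omega) ih'
      rw [map_sub, symFlip_tl hl hl' hq.2] at e2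
      rw [map_sub, map_smul] at e3
      have := Submodule.sub_mem _ (Submodule.add_mem _ e2
        (Submodule.smul_mem _ (superSign q.1.2 1) e3))
        (Submodule.smul_mem _ (superSign q.1.2 1 * superSign s 1) e1)
      convert this using 1
      module
  | zero => simp
  | add u v _ _ hu hv =>
    have := Submodule.add_mem _ hu hv
    rw [map_add, map_add, smul_add, add_sub_add_comm]
    exact this
  | smul c v _ hv =>
    have := Submodule.smul_mem _ c hv
    rw [smul_sub, smul_comm] at this
    rw [map_smul, map_smul]
    exact this

theorem symFlip_symbQ {n : ℤ} {i : ZMod 2} {X : G.W l} (hX : X ∈ G.kazhdanWPar l n i) :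
    symFlip hl' (symbQ hl hl' (G.toQ l X)) - superSign i 1 • symbQ hl hl' (G.toQ l X) ∈
      (basisPL hl').reg {c | c.1 ≤ n - 1} := by
  obtain ⟨u, hu, hu'⟩ := hX
  rw [← hu']
  exact symFlip_symbU hl hl' hu

/-- An element of `W_χ` whose symbol starts with an element of `p ⊕ l'` of parity `i` may be
replaced by its component of parity `i`. -/
theorem exists_parity_component {j : ℤ} {i : ZMod 2} {x : (G.p ⊔ l' : Submodule ℂ g)}
    (hx : (x : g) ∈ part i) {X : G.W l} (hX : X ∈ G.kazhdanW l (j + 2))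
    (h : symbQ hl hl' (G.toQ l X) - SuperSym.ι _ x ∈ (basisPL hl').reg (below (j + 2) 2)) :
    ∃ X' ∈ G.kazhdanWPar l (j + 2) i,
      symbQ hl hl' (G.toQ l X') - SuperSym.ι _ x ∈ (basisPL hl').reg (below (j + 2) 2) := by
  obtain ⟨X₀, h₀, X₁, h₁, rfl⟩ := exists_parity_components hl hX
  have hle : (basisPL hl').reg {c | c.1 ≤ j + 2 - 1} ≤ (basisPL hl').reg (below (j + 2) 2) :=
    HomBasis.reg_mono _ fun c (hc : c.1 ≤ j + 2 - 1) => ⟨by omega, fun h => by omega⟩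
  have k₀ := hle (symFlip_symbQ hl hl' h₀)
  have k₁ := hle (symFlip_symbQ hl hl' h₁)
  have h' := symFlip_mem hl' h
  rw [map_sub, symFlip_ι hl' hx] at h'
  rw [map_add, map_add] at h h'
  rw [map_add] at h'
  -- Up to admissible errors the symbols of X₀ and X₁ have sum x and difference x or -x according to
  -- the parity i. Averaging isolates the component of parity i.
  have key := Submodule.sub_mem _ h' (Submodule.add_mem _ k₀ k₁)
  generalize symFlip hl' (symbQ hl hl' (G.toQ l X₀)) = a₀ at *
  generalize symFlip hl' (symbQ hl hl' (G.toQ l X₁)) = a₁ at *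
  rcases zmod_two_cases i with rfl | rfl
  · refine ⟨X₀, h₀, ?_⟩
    have := Submodule.smul_mem _ (2⁻¹ : ℂ) (Submodule.add_mem _ key h)
    convert this using 1
    simp only [superSign_zero_left, superSign_one_one]
    module
  · refine ⟨X₁, h₁, ?_⟩
    have := Submodule.smul_mem _ (2⁻¹ : ℂ) (Submodule.sub_mem _ h key)
    convert this using 1
    simp only [superSign_zero_left, superSign_one_one]
    module

end GoodGrading
end FinW
end

/-! ### Generation of W_χ by lifts of a basis -/

open scoped DirectSum TensorProduct
noncomputable section
namespace FinW
open LieSuperalgebra (part br)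

theorem HomBasis.mul_mem_below {V : Type*} [AddCommGroup V] [Module ℂ V]
    {P : ZMod 2 → Submodule ℂ V} (B : HomBasis P) {n d n' d' m e : ℤ} (h1 : n + n' ≤ m)
    (h2 : e ≤ d + d') {f f'} (hf : f ∈ B.reg (below n d)) (hf' : f' ∈ B.reg (below n' d')) :
    f * f' ∈ B.reg (below m e) := by
  refine B.mul_mem_reg ?_ hf hf'
  rintro a ⟨ha1, ha2⟩ b ⟨hb1, hb2⟩
  refine ⟨by simp; omega, fun h => ?_⟩
  simp only [Prod.fst_add, Prod.snd_add] at h ⊢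
  have := ha2 (by omega)
  have := hb2 (by omega)
  omega

theorem below_subset {n d n' d' : ℤ} (h : n < n' ∨ n ≤ n' ∧ d' ≤ d) : below n d ⊆ below n' d' := by
  rintro c ⟨h1, h2⟩
  refine ⟨by omega, fun h' => ?_⟩
  have := h2 (by omega)
  omega

namespace GoodGrading

variable {g : Type*} [AddCommGroup g] [Module ℂ g] [LieSuperalgebra g]
  {χ : EvenFunctional g} {G : GoodGrading χ} {l l' : Submodule ℂ g}

theorem χ_pl (hl' : G.IsAdmissibleComplement l l') {x : g} (hx : x ∈ G.p ⊔ l') :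
    χ.toLin x = 0 := by
  have : G.p ⊔ l' ≤ LinearMap.ker χ.toLin := sup_le
    (iSup_le fun j => iSup_le fun hj => G.map_eq_zero j (by omega))
    (hl'.le.trans (G.map_eq_zero (-1) (by norm_num)))
  exact this hx

variable [FiniteDimensional ℂ g] (hl : G.IsIsotropic l) (hl' : G.IsAdmissibleComplement l l')
  {N : Submodule ℂ g} (hN : G.IsBigraded N)

/-- The inclusion of a bigraded subspace into `p ⊕ l'`. -/
def emb (le : N ≤ G.p ⊔ l') : HomEmb (basisPL hl') hN.homBasis where
  toFun := Submodule.inclusion le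
  inj := Submodule.inclusion_injective le
  mem_part_iff := Iff.rfl
  e_mem_gr k := (isBigraded_pl hl').mem_homBasis_gr.2
    (hN.mem_homBasis_gr.1 (HomBasis.e_mem_gr _ k))

/-- Elements of `W_χ` whose symbols start with the elements of a basis of a subspace of `p ⊕ l'`
containing all vectors orthogonal to `m`. -/
structure Generators where
  le : N ≤ G.p ⊔ l'
  orth : ∀ v ∈ G.p ⊔ l', (∀ a ∈ G.m l, χ.toLin (br a v) = 0) → v ∈ N
  θ : Fin hN.homBasis.dim → G.W l
  mem : ∀ k, θ k ∈ G.kazhdanW l (hN.homBasis.wt k + 2)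
  symb : ∀ k, symbQ hl hl' (G.toQ l (θ k)) - SuperSym.ι _ (Submodule.inclusion le (hN.homBasis.e k)) ∈
    (basisPL hl').reg (below (hN.homBasis.wt k + 2) 2)

theorem mem_kazhdanW_of_symbQ {n : ℤ} {X : G.W l} (hX : X ∈ G.kazhdanW l n)
    (h : symbQ hl hl' (G.toQ l X) ∈ (basisPL hl').reg {c | c.1 ≤ n - 1}) :
    X ∈ G.kazhdanW l (n - 1) :=
  mem_kazhdanQ_of_symbQ hl hl' hX h

theorem deg_snd_le (w) : ((basisPL hl').deg w).2 ≤ ((basisPL hl').deg w).1 := by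
  rw [HomBasis.deg_snd]
  exact length_le_deg hl' w

namespace Generators

variable {hl hl' hN} (Γ : Generators hl hl' hN)

/-- The inclusion into `p ⊕ l'`. -/
abbrev E : HomEmb (basisPL hl') hN.homBasis := emb hl' hN Γ.le

/-- The product of a list of generators. -/
def mon (w : List (Fin hN.homBasis.dim)) : G.W l := (w.map Γ.θ).prod

theorem mon_mem {n d : ℤ} (w) (hd : hN.homBasis.deg w = (n, d)) : Γ.mon w ∈ G.kazhdanW l n := by
  induction w generalizing n d with
  | nil =>
    obtain ⟨rfl, rfl⟩ := Prod.mk.inj hd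
    exact IsMulFiltration.one_mem
  | cons k w ih =>
    obtain ⟨K, e, hw⟩ : ∃ K e, hN.homBasis.deg w = (K, e) := ⟨_, _, rfl⟩
    rw [HomBasis.deg_cons, hw] at hd
    obtain ⟨rfl, rfl⟩ := Prod.mk.inj hd
    exact IsMulFiltration.mul_mem (F := G.kazhdanW l) (Γ.mem k) (ih hw)

/-- Leading terms multiply: replacing one factor by its error term raises the polynomial degree by
at least one or lowers the Kazhdan degree, and the noncommutativity only lowers the Kazhdan degree.
-/
theorem symb_mon {n d : ℤ} (w) (hd : hN.homBasis.deg w = (n, d)) :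
    symbQ hl hl' (G.toQ l (Γ.mon w)) - Γ.E.map (hN.homBasis.mon w) ∈
      (basisPL hl').reg (below n (d + 1)) := by
  induction w generalizing n d with
  | nil =>
    have : symbQ hl hl' (G.toQ l (Γ.mon [])) = 1 := symbU_one hl hl'
    rw [this, HomBasis.mon_nil, map_one, sub_self]
    exact Submodule.zero_mem _
  | cons k w ih =>
    have hm := Γ.E.map_mon_mem w
    obtain ⟨K, e, hw⟩ : ∃ K e, hN.homBasis.deg w = (K, e) := ⟨_, _, rfl⟩
    rw [HomBasis.deg_cons, hw] at hd
    rw [hw] at hm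
    obtain ⟨rfl, rfl⟩ := Prod.mk.inj hd
    have e1 := symbQ_toQ_mul hl hl' le_rfl (Γ.mem k) (Γ.mon_mem w hw)
    have e2 := HomBasis.mul_mem_below _ (m := hN.homBasis.wt k + 2 + K) (e := 1 + e + 1) le_rfl
      (by omega) (Γ.symb k)
      (show symbQ hl hl' (G.toQ l (Γ.mon w)) ∈ (basisPL hl').reg (below K e) by
        rw [← sub_add_cancel (symbQ hl hl' (G.toQ l (Γ.mon w))) (Γ.E.map (hN.homBasis.mon w))]
        exact Submodule.add_mem _ (HomBasis.reg_mono _ (below_subset (Or.inr ⟨le_rfl, by omega⟩))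
          (ih hw)) (HomBasis.reg_mono _ (R' := below K e)
            (Set.singleton_subset_iff.2 ⟨le_rfl, fun _ => le_rfl⟩) hm))
    have e3 := HomBasis.mul_mem_below _ (m := hN.homBasis.wt k + 2 + K) (e := 1 + e + 1) le_rfl
      (by omega) (HomBasis.ι_mem_reg _ (R := below (hN.homBasis.wt k + 2) 1)
        ⟨le_rfl, fun _ => le_rfl⟩ (Γ.E.e_mem_gr k)) (ih hw)
    have e4 := HomBasis.reg_mono (basisPL hl') (R' := below (hN.homBasis.wt k + 2 + K) (1 + e + 1))
      (fun c (hc : c.1 ≤ hN.homBasis.wt k + 2 + K - 1) => ⟨by omega, fun h => by omega⟩) e1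
    have := Submodule.add_mem _ (Submodule.add_mem _ e4 e2) e3
    convert this using 1
    have h1 : Γ.E.toFun (hN.homBasis.e k) = Submodule.inclusion Γ.le (hN.homBasis.e k) := rfl
    have h2 : Γ.mon (k :: w) = Γ.θ k * Γ.mon w := by simp [mon]
    rw [HomBasis.mon_cons, map_mul, HomBasis.X, HomEmb.map_ι, sub_mul, mul_sub, h1, h2]
    abel

/-- The span of the products of generators of Kazhdan degree `n`. -/
def monSpan (n : ℤ) : Submodule ℂ (G.W l) :=
  Submodule.span ℂ (Γ.mon '' {w | (hN.homBasis.deg w).1 = n})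

theorem monSpan_le (n : ℤ) : Γ.monSpan n ≤ G.kazhdanW l n := by
  refine Submodule.span_le.2 ?_
  rintro _ ⟨w, rfl, rfl⟩
  exact Γ.mon_mem w rfl

/-- The linear combination of the products of generators with given coefficients. -/
abbrev comb : (List (Fin hN.homBasis.dim) →₀ ℂ) →ₗ[ℂ] G.W l := Finsupp.linearCombination ℂ Γ.mon

theorem comb_mem {n d : ℤ} {c : List (Fin hN.homBasis.dim) →₀ ℂ}
    (hc : c ∈ Finsupp.supported ℂ ℂ {w | (hN.homBasis.deg w).1 = n ∧ d ≤ (hN.homBasis.deg w).2}) :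
    Γ.comb c ∈ Γ.monSpan n ∧ symbQ hl hl' (G.toQ l (Γ.comb c)) -
      Γ.E.map (Finsupp.linearCombination ℂ hN.homBasis.mon c) ∈
        (basisPL hl').reg (below n (d + 1)) := by
  rw [Finsupp.supported_eq_span_single] at hc
  refine ⟨?_, ?_⟩
  · have : Submodule.span ℂ ((fun w => Finsupp.single w (1 : ℂ)) ''
        {w | (hN.homBasis.deg w).1 = n ∧ d ≤ (hN.homBasis.deg w).2}) ≤ (Γ.monSpan n).comap Γ.comb := Submodule.span_le.2 (by
      rintro _ ⟨w, hw, rfl⟩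
      change Γ.comb _ ∈ Γ.monSpan n
      rw [comb, Finsupp.linearCombination_single, one_smul]
      exact Submodule.subset_span ⟨w, hw.1, rfl⟩)
    exact this hc
  · have : Submodule.span ℂ ((fun w => Finsupp.single w (1 : ℂ)) ''
        {w | (hN.homBasis.deg w).1 = n ∧ d ≤ (hN.homBasis.deg w).2}) ≤ ((basisPL hl').reg (below n (d + 1))).comap
        (symbQ hl hl' ∘ₗ G.toQ l ∘ₗ Γ.comb -
          Γ.E.map.toLinearMap ∘ₗ Finsupp.linearCombination ℂ hN.homBasis.mon) :=
      Submodule.span_le.2 (by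
        rintro _ ⟨w, hw, rfl⟩
        change symbQ hl hl' (G.toQ l (Γ.comb _)) - Γ.E.map _ ∈
          (basisPL hl').reg (below n (d + 1))
        rw [comb, Finsupp.linearCombination_single, one_smul, Finsupp.linearCombination_single,
          one_smul]
        exact HomBasis.reg_mono _ (below_subset (Or.inr ⟨hw.1.le, add_le_add_left hw.2 1⟩))
          (Γ.symb_mon w rfl))
    exact this hc

theorem exists_comb {n d : ℤ} {t} (ht : t ∈ hN.homBasis.reg {c | c.1 = n ∧ d ≤ c.2}) :
    ∃ c ∈ Finsupp.supported ℂ ℂ {w | (hN.homBasis.deg w).1 = n ∧ d ≤ (hN.homBasis.deg w).2},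
      Finsupp.linearCombination ℂ hN.homBasis.mon c = t :=
  (Finsupp.mem_span_image_iff_linearCombination ℂ).1 ht

/-- The component of bidegree (n, d) of the symbol lies in S(N) by `exists_of_invariant`, so a
combination of products of generators removes it and d increases. The process stops because the
polynomial degree is at most the Kazhdan degree. -/
theorem mem_sup_of_symbQ {n d : ℤ} {X : G.W l} (hX : X ∈ G.kazhdanW l n)
    (h : symbQ hl hl' (G.toQ l X) ∈ (basisPL hl').reg (below n d)) :
    X ∈ Γ.monSpan n ⊔ G.kazhdanW l (n - 1) := by
  -- m bounds the number of steps left: for m = 0 one has d > n, so the symbol has nothing in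
  -- Kazhdan degree n.
  obtain ⟨m, hm⟩ : ∃ m : ℕ, n < d + m := ⟨(n + 1 - d).toNat, by omega⟩
  induction m generalizing d X with
  | zero =>
    refine Submodule.mem_sup_right (mem_kazhdanW_of_symbQ hl hl' hX ?_)
    refine HomBasis.reg_le _ (fun w hw => HomBasis.mon_mem_reg _ ?_) h
    have h1 := hw.1
    have h2 := hw.2
    have h3 := deg_snd_le hl' w
    change ((basisPL hl').deg w).1 ≤ n at h1
    change ((basisPL hl').deg w).1 = n → d ≤ ((basisPL hl').deg w).2 at h2
    change ((basisPL hl').deg w).1 ≤ n - 1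
    by_contra h4
    have := h2 (by omega)
    push_cast at hm
    omega
  | succ m ih =>
    obtain ⟨t, ht, ht'⟩ := (polarization hl hl').exists_of_invariant G.isSuperSubspace
      (n := n) (d := d) (f := symbQ hl hl' (G.toQ l X))
      (fun v => χ_pl hl' v.2)
      (by
        have hk : LinearMap.ker (polarization hl hl').q = G.m l := by
          ext a; exact projPL_eq_zero_iff hl hl'
        rw [hk]
        exact (isBigraded_m hl).le_iSup)
      Γ.E
      (by
        intro v hv
        refine ⟨⟨v, Γ.orth v v.2 fun a ha => hv a ((projPL_eq_zero_iff hl hl').2 ha)⟩, rfl⟩)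
      h (fun a ha => rep_symbQ_toQ hl hl' X ((projPL_eq_zero_iff hl hl').1 ha))
    obtain ⟨c, hc, rfl⟩ := exists_comb (n := n) (d := d) (HomBasis.reg_mono _
      (R' := {c | c.1 = n ∧ d ≤ c.2}) (Set.singleton_subset_iff.2 ⟨rfl, le_rfl⟩) ht)
    obtain ⟨h1, h2⟩ := Γ.comb_mem hc
    -- X and the combination have the same component of bidegree (n, d), so their difference starts
    -- at d + 1.
    have h3 := Submodule.sub_mem _ ht' h2
    rw [sub_sub_sub_cancel_right, ← map_sub, ← map_sub] at h3
    have h4 := ih (Submodule.sub_mem _ hX (Γ.monSpan_le n h1)) h3 (by push_cast at hm ⊢; omega)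
    have := Submodule.add_mem _ h4 (Submodule.mem_sup_left h1)
    simpa using this

theorem mem_sup {n : ℤ} {X : G.W l} (hX : X ∈ G.kazhdanW l n) :
    X ∈ Γ.monSpan n ⊔ G.kazhdanW l (n - 1) :=
  Γ.mem_sup_of_symbQ (d := 0) hX (HomBasis.reg_le _ (fun w hw => HomBasis.mon_mem_reg _
    (R := below n 0) ⟨hw, fun _ => HomBasis.deg_snd_nonneg _ w⟩) (symbQ_mem hl hl' hX))

/-- Each element is a combination of products of generators up to smaller Kazhdan degree, and the
filtration is zero in negative degrees. -/
theorem adjoin_eq_top : Algebra.adjoin ℂ (Set.range Γ.θ) = ⊤ := by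
  have key : ∀ (m : ℕ) (n : ℤ), n < m → ∀ X ∈ G.kazhdanW l n, X ∈ Algebra.adjoin ℂ (Set.range Γ.θ) := by
    intro m
    induction m with
    | zero =>
      intro n hn X hX
      have : X = 0 := toQ_injective l
        ((eq_zero_of_mem_kazhdanQ hl hl' (by simpa using hn) hX).trans (map_zero _).symm)
      rw [this]
      exact Subalgebra.zero_mem _
    | succ m ih =>
      intro n hn X hX
      obtain ⟨T, hT, X', hX', rfl⟩ := Submodule.mem_sup.1 (Γ.mem_sup hX)
      refine Subalgebra.add_mem _ ?_ (ih (n - 1) (by push_cast at hn; omega) X' hX')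
      have : Γ.monSpan n ≤ Subalgebra.toSubmodule (Algebra.adjoin ℂ (Set.range Γ.θ)) := by
        refine Submodule.span_le.2 ?_
        rintro _ ⟨w, -, rfl⟩
        refine Subalgebra.list_prod_mem _ fun x hx => ?_
        obtain ⟨k, -, rfl⟩ := List.mem_map.1 hx
        exact Algebra.subset_adjoin ⟨k, rfl⟩
      exact this hT
  refine eq_top_iff.2 fun X _ => ?_
  obtain ⟨n, hn⟩ := exists_mem_kazhdanQ (G.toQ l X)
  exact key (n + 1).toNat n (by omega) X hn

end Generators
end GoodGrading
end FinW
end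

open scoped DirectSum TensorProduct
noncomputable section
namespace FinW
open LieSuperalgebra (part br)

/-- `M js` is the place assigned to images of monomials with indices js. The same scheme serves for
Kazhdan degree and for parity. -/
theorem map_mem_of_mem_monomialSpan {κ V A A' : Type*} [AddCommGroup V] [Module ℂ V] [Ring A]
    [Algebra ℂ A] [Ring A'] [Algebra ℂ A'] {f : V →ₗ[ℂ] A} {piece : κ → Submodule ℂ V}
    {P : List κ → Prop} (φ : A →ₐ[ℂ] A') (M : List κ → Submodule ℂ A') (h0 : 1 ∈ M [])
    (h1 : ∀ j js x y, x ∈ piece j → y ∈ M js → φ (f x) * y ∈ M (j :: js)) {T : Submodule ℂ A'}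
    (hT : ∀ js, P js → M js ≤ T) {s : A} (hs : s ∈ monomialSpan f piece P) : φ s ∈ T := by
  have key : ∀ w : List (κ × V), (∀ q ∈ w, q.2 ∈ piece q.1) →
      φ (w.map fun q => f q.2).prod ∈ M (w.map Prod.fst) := by
    intro w hw
    induction w with
    | nil => simpa using h0
    | cons q w ih =>
      have e : φ ((q :: w).map fun q => f q.2).prod =
          φ (f q.2) * φ (w.map fun q => f q.2).prod := by simp
      rw [e, List.map_cons]
      exact h1 _ _ _ _ (hw q List.mem_cons_self)
        (ih fun q hq => hw q (List.mem_cons_of_mem _ hq))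
  have : monomialSpan f piece P ≤ T.comap φ.toLinearMap := by
    refine Submodule.span_le.2 ?_
    rintro _ ⟨w, hw, hP, rfl⟩
    exact hT _ hP (key w hw)
  exact this hs

namespace GoodGrading

variable {g : Type*} [AddCommGroup g] [Module ℂ g] [LieSuperalgebra g]
  {χ : EvenFunctional g} {G : GoodGrading χ} {l l' : Submodule ℂ g}

/-! ### Gradings of `Gr W_χ` -/

theorem degree_mul {m n : ℤ} {x y : G.GrW l} (hx : x ∈ GrW.degree G l m)
    (hy : y ∈ GrW.degree G l n) : x * y ∈ GrW.degree G l (m + n) := by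
  obtain ⟨x, rfl⟩ := hx
  obtain ⟨y, rfl⟩ := hy
  exact ⟨GradedMonoid.GMul.mul x y, (DirectSum.of_mul_of x y).symm⟩

theorem one_mem_degree : (1 : G.GrW l) ∈ GrW.degree G l 0 := ⟨_, rfl⟩

theorem of_cls_mem_parity {n : ℤ} {i : ZMod 2} {X : G.W l} (hX : X ∈ G.kazhdanW l n)
    (hi : X ∈ G.parityW l i) :
    DirectSum.of (GrPiece (G.kazhdanW l)) n (GrPiece.cls _ n ⟨X, hX⟩) ∈ GrW.parity G l i :=
  Submodule.mem_iSup_of_mem n ⟨⟨X, hX⟩, hi, rfl⟩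

theorem parity_mul {i j : ZMod 2} {x y : G.GrW l} (hx : x ∈ GrW.parity G l i)
    (hy : y ∈ GrW.parity G l j) : x * y ∈ GrW.parity G l (i + j) := by
  have : GrW.parity G l i * GrW.parity G l j ≤ GrW.parity G l (i + j) := by
    rw [GrW.parity, GrW.parity, Submodule.iSup_mul]
    refine iSup_le fun m => ?_
    rw [Submodule.mul_iSup]
    refine iSup_le fun n => Submodule.mul_le.2 ?_
    rintro _ ⟨X, hX, rfl⟩ _ ⟨Y, hY, rfl⟩
    exact (of_cls_mul_of_cls X Y).symm ▸ of_cls_mem_parity _ (parityW_mul hX hY)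
  exact this (Submodule.mul_mem_mul hx hy)

theorem one_mem_parity : (1 : G.GrW l) ∈ GrW.parity G l 0 :=
  of_cls_mem_parity (X := 1) (IsMulFiltration.one_mem (F := G.kazhdanW l))
    ⟨1, one_mem_monomialSpan (by simp), rfl⟩

theorem preservesGradings_of_ι {φ : SuperSym (partOn χ.annihilator) →ₐ[ℂ] G.GrW l}
    (h1 : ∀ j (x : χ.annihilator), (x : g) ∈ G.gr j →
      φ (SuperSym.ι _ x) ∈ GrW.degree G l (j + 2))
    (h2 : ∀ i (x : χ.annihilator), (x : g) ∈ part i →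
      φ (SuperSym.ι _ x) ∈ GrW.parity G l i) : G.PreservesGradings l φ.toLinearMap := by
  refine ⟨fun n s hs => ?_, fun i s hs => ?_⟩
  · refine map_mem_of_mem_monomialSpan φ (fun js => GrW.degree G l (kazhdanDegree js))
      one_mem_degree (fun j js x y hx hy => ?_) (fun js h => h ▸ le_rfl) hs
    rw [kazhdanDegree_cons]
    exact degree_mul (h1 _ _ hx) hy
  · refine map_mem_of_mem_monomialSpan φ (fun js => GrW.parity G l js.sum)
      one_mem_parity (fun j js x y hx hy => ?_) (fun js h => h ▸ le_rfl) hs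
    rw [List.sum_cons]
    exact parity_mul (h2 _ _ hx) hy

/-! ### The isomorphism -/

variable [FiniteDimensional ℂ g] {hl : G.IsIsotropic l} {hl' : G.IsAdmissibleComplement l l'}
  {N : Submodule ℂ g} {hN : G.IsBigraded N}

theorem _root_.FinW.HomBasis.eq_zero_of_projOn {V : Type*} [AddCommGroup V] [Module ℂ V]
    {P : ZMod 2 → Submodule ℂ V} (B : HomBasis P) (hB : ∀ w, 0 ≤ (B.deg w).1) {t}
    (h : ∀ n : ℤ, B.projOn {c | c.1 = n} t = 0) : t = 0 := by
  have h1 : ∃ M : ℤ, t ∈ B.reg {c | c.1 ≤ M} := by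
    clear h
    have ht : t ∈ Submodule.span ℂ (Set.range B.mon) := B.span_mon ▸ Submodule.mem_top
    induction ht using Submodule.span_induction with
    | mem t ht =>
      obtain ⟨w, rfl⟩ := ht
      exact ⟨(B.deg w).1, B.mon_mem_reg (le_refl (B.deg w).1)⟩
    | zero => exact ⟨0, Submodule.zero_mem _⟩
    | add s t _ _ hs ht =>
      obtain ⟨M, hM⟩ := hs
      obtain ⟨M', hM'⟩ := ht
      exact ⟨max M M', Submodule.add_mem _
        (B.reg_mono (fun c (hc : c.1 ≤ M) => hc.trans (le_max_left _ _)) hM)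
        (B.reg_mono (fun c (hc : c.1 ≤ M') => hc.trans (le_max_right _ _)) hM')⟩
    | smul c t _ ht => exact ht.imp fun M hM => Submodule.smul_mem _ _ hM
  obtain ⟨M, hM⟩ := h1
  have h2 : ∀ m : ℕ, t ∈ B.reg {c | c.1 ≤ M - m} := by
    intro m
    induction m with
    | zero => simpa using hM
    | succ m ih =>
      have h3 := B.projOn_add_compl {c | c.1 = M - m} t
      rw [h, zero_add, ← B.projOn_of_mem le_rfl ih, B.projOn_projOn] at h3
      rw [← B.projOn_of_mem le_rfl ih, ← h3]
      refine B.reg_mono ?_ (B.projOn_mem _ _)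
      rintro c ⟨hc1, hc2⟩
      change ¬ c.1 = M - m at hc1
      change c.1 ≤ M - m at hc2
      change c.1 ≤ M - (m + 1 : ℕ)
      push_cast
      omega
  have h3 := h2 (M + 1).toNat
  have h4 : B.reg {c | c.1 ≤ M - (M + 1).toNat} ≤ ⊥ := B.reg_le fun w hw => by
    have := hB w
    change (B.deg w).1 ≤ _ at hw
    omega
  exact h4 h3

theorem deg_le_of_le {hl' : G.IsAdmissibleComplement l l'} (le : N ≤ G.p ⊔ l') (w) :
    (hN.homBasis.deg w).2 ≤ (hN.homBasis.deg w).1 := by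
  induction w with
  | nil => simp
  | cons k w ih =>
    have := neg_one_le_of_mem_pl hl' (le (hN.homBasis.e k).2)
      (hN.mem_homBasis_gr.1 (HomBasis.e_mem_gr _ k))
      fun h => hN.homBasis.e.ne_zero k (Subtype.ext h)
    simp only [HomBasis.deg_cons, Prod.fst_add, Prod.snd_add]
    omega

namespace Generators

variable (Γ : Generators hl hl' hN)
  (hpar : ∀ k, Γ.θ k ∈ G.kazhdanWPar l (hN.homBasis.wt k + 2) (hN.homBasis.par k))

/-- The homomorphism from a symmetric superalgebra to `Gr W_χ` given by generators homogeneous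
for the parity. -/
def toGrW : SuperSym (partOn N) →ₐ[ℂ] G.GrW l :=
  hN.homBasis.constr (fun k => DirectSum.of (GrPiece (G.kazhdanW l)) (hN.homBasis.wt k + 2)
    (GrPiece.cls _ _ ⟨Γ.θ k, Γ.mem k⟩)) (by
    intro k m
    rw [of_cls_mul_of_cls, of_cls_mul_of_cls, smul_of_cls]
    exact of_cls_eq (add_comm _ _) (W_supercomm (hpar k) (hpar m) (by omega)))

theorem toGrW_X (k) : Γ.toGrW hpar (hN.homBasis.X k) =
    DirectSum.of (GrPiece (G.kazhdanW l)) (hN.homBasis.wt k + 2)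
      (GrPiece.cls _ _ ⟨Γ.θ k, Γ.mem k⟩) := HomBasis.constr_X _ _ _ _

theorem toGrW_mon (w) : Γ.toGrW hpar (hN.homBasis.mon w) =
    DirectSum.of (GrPiece (G.kazhdanW l)) (hN.homBasis.deg w).1
      (GrPiece.cls _ _ ⟨Γ.mon w, Γ.mon_mem w rfl⟩) := by
  induction w with
  | nil => rw [HomBasis.mon_nil, map_one]; rfl
  | cons k w ih =>
    rw [HomBasis.mon_cons, map_mul, ih, toGrW_X, of_cls_mul_of_cls]
    refine of_cls_eq (by simp) ?_
    simp [mon]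

theorem toGrW_ι_mem_degree {j : ℤ} {x : N} (hx : (x : g) ∈ G.gr j) :
    Γ.toGrW hpar (SuperSym.ι _ x) ∈ GrW.degree G l (j + 2) := by
  rw [hN.homBasis.ι_eq_sum, map_sum]
  refine Submodule.sum_mem _ fun k _ => ?_
  rw [map_smul]
  by_cases hk : hN.homBasis.wt k = j
  · refine Submodule.smul_mem _ _ ?_
    rw [toGrW_X]
    exact hk ▸ ⟨_, rfl⟩
  · rw [hN.mem_homBasis_gr.2 hx k hk, zero_smul]
    exact Submodule.zero_mem _

theorem toGrW_ι_mem_parity {i : ZMod 2} {x : N} (hx : (x : g) ∈ part i) :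
    Γ.toGrW hpar (SuperSym.ι _ x) ∈ GrW.parity G l i := by
  rw [hN.homBasis.ι_eq_sum, map_sum]
  refine Submodule.sum_mem _ fun k _ => ?_
  rw [map_smul]
  by_cases hk : hN.homBasis.par k = i
  · refine Submodule.smul_mem _ _ ?_
    rw [toGrW_X]
    exact hk ▸ (of_cls_mem_parity _ (kazhdanWPar_le_parityW _ _ (hpar k)))
  · rw [hN.homBasis.repr_par hx k hk, zero_smul]
    exact Submodule.zero_mem _

theorem toGrW_comb {n d : ℤ} {c : List (Fin hN.homBasis.dim) →₀ ℂ}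
    (hc : c ∈ Finsupp.supported ℂ ℂ {w | (hN.homBasis.deg w).1 = n ∧ d ≤ (hN.homBasis.deg w).2})
    (hT : Γ.comb c ∈ G.kazhdanW l n) :
    Γ.toGrW hpar (Finsupp.linearCombination ℂ hN.homBasis.mon c) =
      DirectSum.of (GrPiece (G.kazhdanW l)) n (GrPiece.cls _ n ⟨Γ.comb c, hT⟩) := by
  have hc' := hc
  rw [Finsupp.supported_eq_span_single] at hc'
  induction hc' using Submodule.span_induction with
  | mem c hc' =>
    obtain ⟨w, hw, rfl⟩ := hc'
    rw [Finsupp.linearCombination_single, one_smul, toGrW_mon]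
    refine of_cls_eq hw.1 ?_
    simp [comb]
  | zero =>
    have : (⟨Γ.comb 0, hT⟩ : G.kazhdanW l n) = 0 := Subtype.ext (map_zero Γ.comb)
    rw [this, map_zero, map_zero, map_zero, map_zero]
  | add c c' h h' ih ih' =>
    rw [← Finsupp.supported_eq_span_single] at h h'
    have h1 := Γ.monSpan_le n (Γ.comb_mem h).1
    have h2 := Γ.monSpan_le n (Γ.comb_mem h').1
    have : (⟨Γ.comb (c + c'), hT⟩ : G.kazhdanW l n) = ⟨_, h1⟩ + ⟨_, h2⟩ :=
      Subtype.ext (map_add Γ.comb _ _)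
    rw [this, map_add, map_add, ih h h1, ih' h' h2, ← map_add, ← map_add]
  | smul a c h ih =>
    rw [← Finsupp.supported_eq_span_single] at h
    have h1 := Γ.monSpan_le n (Γ.comb_mem h).1
    have : (⟨Γ.comb (a • c), hT⟩ : G.kazhdanW l n) = a • (⟨_, h1⟩ : G.kazhdanW l n) :=
      Subtype.ext (map_smul Γ.comb a c)
    rw [this, map_smul, map_smul, ih h h1, smul_of_cls]

/-- This is `mem_sup` read in the associated graded algebra. -/
theorem toGrW_surjective : Function.Surjective (Γ.toGrW hpar) := by
  have key : ∀ (n : ℤ) (x : GrPiece (G.kazhdanW l) n),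
      DirectSum.of (GrPiece (G.kazhdanW l)) n x ∈ (Γ.toGrW hpar).range := by
    intro n x
    obtain ⟨⟨X, hX⟩, rfl⟩ := GrPiece.cls_surjective _ n x
    obtain ⟨T, hT, X', hX', rfl⟩ := Submodule.mem_sup.1 (Γ.mem_sup hX)
    obtain ⟨c, hc, rfl⟩ := (Finsupp.mem_span_image_iff_linearCombination ℂ).1 hT
    have hc' : c ∈ Finsupp.supported ℂ ℂ
        {w | (hN.homBasis.deg w).1 = n ∧ 0 ≤ (hN.homBasis.deg w).2} :=
      fun w hw => ⟨hc hw, HomBasis.deg_snd_nonneg _ w⟩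
    refine ⟨Finsupp.linearCombination ℂ hN.homBasis.mon c, ?_⟩
    refine (Γ.toGrW_comb hpar hc' (Γ.monSpan_le n (Γ.comb_mem hc').1)).trans (of_cls_eq rfl ?_)
    have : Γ.comb c - (Γ.comb c + X') = -X' := by abel
    rw [this]
    exact Submodule.neg_mem _ hX'
  intro x
  change x ∈ (Γ.toGrW hpar).range
  induction x using DirectSum.induction_on with
  | zero => exact Subalgebra.zero_mem _
  | of n x => exact key n x
  | add x y hx hy => exact Subalgebra.add_mem _ hx hy

theorem toGrW_projOn (n : ℤ) (t) : Γ.toGrW hpar (hN.homBasis.projOn {c | c.1 = n} t) =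
    DirectSum.of (GrPiece (G.kazhdanW l)) n (Γ.toGrW hpar t n) := by
  have : (Γ.toGrW hpar).toLinearMap ∘ₗ hN.homBasis.projOn {c | c.1 = n} =
      DirectSum.lof ℂ ℤ (GrPiece (G.kazhdanW l)) n ∘ₗ
        DirectSum.component ℂ ℤ (GrPiece (G.kazhdanW l)) n ∘ₗ (Γ.toGrW hpar).toLinearMap :=
    hN.homBasis.linearMap_ext fun w => by
      change Γ.toGrW hpar (hN.homBasis.projOn {c | c.1 = n} (hN.homBasis.mon w)) =
        DirectSum.of _ n (Γ.toGrW hpar (hN.homBasis.mon w) n)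
      rw [HomBasis.projOn_mon, toGrW_mon]
      split_ifs with h
      · obtain rfl : (hN.homBasis.deg w).1 = n := h
        rw [toGrW_mon, DirectSum.of_eq_same]
      · rw [DirectSum.of_eq_of_ne _ _ _ (Ne.symm h), map_zero, map_zero]
  exact LinearMap.congr_fun this t

/-- If t of Kazhdan degree n maps to zero, the corresponding combination of products has smaller
Kazhdan degree. Its symbol nevertheless starts with the component of t of lowest polynomial degree,
so that component is zero. Repeating this pushes the polynomial degree of t beyond n, which is
impossible for t ≠ 0. -/
theorem toGrW_injective : Function.Injective (Γ.toGrW hpar) := by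
  obtain ⟨r, hr⟩ := Γ.E.exists_retraction
  have key : ∀ (n : ℤ) t, t ∈ hN.homBasis.reg {c | c.1 = n} → Γ.toGrW hpar t = 0 → t = 0 := by
    intro n t ht h0
    have h1 : ∀ d : ℕ, t ∈ hN.homBasis.reg {c | c.1 = n ∧ (d : ℤ) ≤ c.2} := by
      intro d
      induction d with
      | zero =>
        exact HomBasis.reg_le _ (fun w hw => HomBasis.mon_mem_reg _
          (R := {c | c.1 = n ∧ ((0 : ℕ) : ℤ) ≤ c.2})
          ⟨hw, by simpa using HomBasis.deg_snd_nonneg _ w⟩) ht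
      | succ d ih =>
        obtain ⟨c, hc, rfl⟩ := exists_comb ih
        have h2 := (Γ.comb_mem hc).2
        rw [Γ.toGrW_comb hpar hc (Γ.monSpan_le n (Γ.comb_mem hc).1)] at h0
        have h3 := cls_eq_zero_iff.1 (DirectSum.of_injective n (h0.trans (map_zero _).symm))
        have h4 := HomBasis.reg_mono (basisPL hl') (R' := below n (d + 1))
          (fun c (hc : c.1 ≤ n - 1) => ⟨by omega, fun h => by omega⟩) (symbQ_mem hl hl' h3)
        have h5 := (Submodule.sub_mem_iff_right _ h4).1 h2
        clear h0 h2 h3 h4 ht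
        generalize Finsupp.linearCombination ℂ hN.homBasis.mon c = t at ih h5 ⊢
        -- In S(p ⊕ l') the image of t lies in `below n (d + 1)`, which does not contain (n, d). The
        -- retraction carries the vanishing back to S(N).
        have h6 : hN.homBasis.projOn {(n, (d : ℤ))} t = 0 := by
          rw [← hr (hN.homBasis.projOn _ t), Γ.E.map_projOn, HomBasis.projOn_eq_zero _ ?_ h5,
            map_zero]
          refine Set.disjoint_singleton_right.2 fun h => ?_
          have := h.2 rfl
          omega
        have h7 := hN.homBasis.projOn_add_compl {(n, (d : ℤ))} t
        rw [h6, zero_add, ← HomBasis.projOn_of_mem _ le_rfl ih, HomBasis.projOn_projOn] at h7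
        rw [← HomBasis.projOn_of_mem _ le_rfl ih, ← h7]
        refine HomBasis.reg_mono _ ?_ (HomBasis.projOn_mem _ _ _)
        rintro ⟨c1, c2⟩ ⟨hc1, rfl, hc2⟩
        refine ⟨rfl, ?_⟩
        change (d : ℤ) ≤ c2 at hc2
        change ((d + 1 : ℕ) : ℤ) ≤ c2
        have : c2 ≠ d := fun h => hc1 (by rw [h]; exact Set.mem_singleton _)
        push_cast
        omega
    have h2 : hN.homBasis.reg {c | c.1 = n ∧ ((n + 1).toNat : ℤ) ≤ c.2} ≤ ⊥ :=
      hN.homBasis.reg_le fun w hw => by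
        have h3 := deg_le_of_le (hl' := hl') (hN := hN) Γ.le w
        have h4 : (hN.homBasis.deg w).1 = n := hw.1
        have h5 : ((n + 1).toNat : ℤ) ≤ (hN.homBasis.deg w).2 := hw.2
        omega
    exact h2 (h1 _)
  refine (injective_iff_map_eq_zero _).2 fun t ht => ?_
  refine hN.homBasis.eq_zero_of_projOn (fun w => ?_) fun n => ?_
  · exact (HomBasis.deg_snd_nonneg _ w).trans (deg_le_of_le (hl' := hl') Γ.le w)
  · refine key n _ (HomBasis.projOn_mem _ _ _) ?_
    rw [toGrW_projOn, ht, DirectSum.zero_apply, map_zero]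

/-- The isomorphism of a symmetric superalgebra with `Gr W_χ` given by generators. -/
def equivGrW : SuperSym (partOn N) ≃ₐ[ℂ] G.GrW l :=
  AlgEquiv.ofBijective (Γ.toGrW hpar) ⟨Γ.toGrW_injective hpar, Γ.toGrW_surjective hpar⟩

end Generators
end GoodGrading
end FinW
end

open scoped DirectSum TensorProduct
noncomputable section
namespace FinW
open LieSuperalgebra (part br)

/-! ### Symbols -/

/-- Weight is Kazhdan degree minus twice polynomial degree. Since v is nonzero of bidegree (j + 2,
1), its weight is j and s must have Kazhdan degree j + 2. In that degree weight less than j means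
polynomial degree at least 2. -/
theorem HomBasis.sub_mem_below {V : Type*} [AddCommGroup V] [Module ℂ V]
    {P : ZMod 2 → Submodule ℂ V} (B : HomBasis P) {j n w : ℤ} {v s : SuperSym P} (hv : v ≠ 0)
    (h1 : v ∈ B.reg {(j + 2, 1)}) (h2 : v ∈ B.reg {c | c.1 - 2 * c.2 = w})
    (h3 : s - v ∈ B.reg {c | c.1 - 2 * c.2 < w}) (h4 : s ∈ B.reg {c | c.1 = n}) :
    n = j + 2 ∧ s - v ∈ B.reg (below (j + 2) 2) := by
  obtain rfl : w = j := by
    by_contra hw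
    refine hv (B.eq_zero_of_mem_reg_of_disjoint (Set.disjoint_singleton_left.2 ?_) h1 h2)
    intro h
    rw [Set.mem_ofPred_eq] at h
    omega
  obtain rfl : n = w + 2 := by
    by_contra hn
    refine hv ?_
    have d1 : ((w + 2, 1) : ℤ × ℤ) ∉ {c : ℤ × ℤ | c.1 = n} := fun h => hn h.symm
    have d2 : ((w + 2, 1) : ℤ × ℤ) ∉ {c : ℤ × ℤ | c.1 - 2 * c.2 < w} := by simp
    have e1 := B.projOn_eq_zero (Set.disjoint_singleton_right.2 d1) h4
    have e2 := B.projOn_eq_zero (Set.disjoint_singleton_right.2 d2) h3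
    rw [map_sub, e1, zero_sub, B.projOn_of_mem subset_rfl h1, neg_eq_zero] at e2
    exact e2
  refine ⟨rfl, ?_⟩
  have h5 : s - v ∈ B.reg {c | c.1 = w + 2} ⊓ B.reg {c | c.1 - 2 * c.2 < w} :=
    ⟨Submodule.sub_mem _ h4 (B.reg_mono (by simp) h1), h3⟩
  rw [B.reg_inf] at h5
  refine B.reg_mono ?_ h5
  rintro c ⟨hc1, hc2⟩
  change c.1 = w + 2 at hc1
  change c.1 - 2 * c.2 < w at hc2
  exact ⟨hc1.le, fun _ => by omega⟩

namespace GoodGrading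

variable {g : Type*} [AddCommGroup g] [Module ℂ g] [LieSuperalgebra g]
  {χ : EvenFunctional g} {G : GoodGrading χ} {l l' : Submodule ℂ g}

variable [FiniteDimensional ℂ g] (hl : G.IsIsotropic l) (hl' : G.IsAdmissibleComplement l l')

theorem prod_ι_mem_reg (w : List (ℤ × (G.p ⊔ l' : Submodule ℂ g)))
    (hw : ∀ q ∈ w, q.2 ∈ G.grPL l' q.1) :
    (w.map fun q => SuperSym.ι (partOn (G.p ⊔ l')) q.2).prod ∈ (basisPL hl').reg
      {c | c.1 = kazhdanDegree (w.map Prod.fst) ∧ c.1 - 2 * c.2 = (w.map Prod.fst).sum} := by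
  induction w with
  | nil => exact HomBasis.one_mem_reg _ (by simp)
  | cons q w ih =>
    simp only [List.map_cons, List.prod_cons, kazhdanDegree_cons, List.sum_cons]
    refine HomBasis.mul_mem_reg _ (R := {(q.1 + 2, 1)}) ?_
      (HomBasis.ι_mem_reg _ (Set.mem_singleton _)
        ((isBigraded_pl hl').mem_homBasis_gr.2 (hw q List.mem_cons_self)))
      (ih fun q hq => hw q (List.mem_cons_of_mem _ hq))
    rintro _ rfl b ⟨hb1, hb2⟩
    refine ⟨?_, ?_⟩
    · simp [hb1]
    · rw [← hb2]
      simp only [Prod.fst_add, Prod.snd_add]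
      ring

theorem symWeight_le (w : ℤ) : G.symWeight l' w ≤ (basisPL hl').reg {c | c.1 - 2 * c.2 = w} := by
  refine Submodule.span_le.2 ?_
  rintro _ ⟨v, hv, rfl, rfl⟩
  exact HomBasis.reg_mono _ (fun c hc => hc.2) (prod_ι_mem_reg hl' v hv)

/-- Passes from the description of symbols by tensors to the map `symbQ`, with which the rest of the
argument is formulated. -/
theorem IsSymbol.mem {n : ℤ} {X : G.Q l} {s : G.SymPL l'} (h : G.IsSymbol l l' n X s) :
    X ∈ G.kazhdanQ l n ∧ s ∈ (basisPL hl').reg {c | c.1 = n} ∧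
      symbQ hl hl' X - s ∈ (basisPL hl').reg {c | c.1 ≤ n - 1} := by
  obtain ⟨t, ht, rfl, hX⟩ := h
  have key : TensorAlgebra.lift ℂ (Env.ι ∘ₗ (G.p ⊔ l').subtype) t ∈ G.kazhdanU n ∧
      SuperSym.proj _ t ∈ (basisPL hl').reg {c | c.1 = n} ∧
      symbU hl hl' (TensorAlgebra.lift ℂ (Env.ι ∘ₗ (G.p ⊔ l').subtype) t) - SuperSym.proj _ t ∈
        (basisPL hl').reg {c | c.1 ≤ n - 1} := by
    clear hX
    induction ht using Submodule.span_induction with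
    | mem t ht =>
      obtain ⟨w, hw, rfl, rfl⟩ := ht
      have e1 : TensorAlgebra.lift ℂ (Env.ι ∘ₗ (G.p ⊔ l').subtype)
          (w.map fun q => TensorAlgebra.ι ℂ q.2).prod = (w.map fun q => Env.ι (q.2 : g)).prod := by
        rw [map_list_prod, List.map_map]
        congr 1
        exact List.map_congr_left fun q _ => by simp
      have e2 : SuperSym.proj (partOn (G.p ⊔ l')) (w.map fun q => TensorAlgebra.ι ℂ q.2).prod =
          (w.map fun q => SuperSym.ι _ q.2).prod := by
        rw [map_list_prod, List.map_map]
        congr 1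
      rw [e1, e2]
      refine ⟨Submodule.subset_span ⟨w.map fun q => (q.1, (q.2 : g)), ?_, ?_, ?_⟩,
        HomBasis.reg_mono _ (fun c hc => hc.1) (prod_ι_mem_reg hl' w hw),
        symbU_prod_sub hl hl' w hw le_rfl⟩
      · intro q hq
        obtain ⟨q', hq', rfl⟩ := List.mem_map.1 hq
        exact hw q' hq'
      · rw [List.map_map]; exact le_refl (kazhdanDegree (w.map Prod.fst))
      · rw [List.map_map]; rfl
    | zero => simp
    | add s t _ _ hs ht =>
      rw [map_add, map_add, map_add, add_sub_add_comm]
      exact ⟨Submodule.add_mem _ hs.1 ht.1, Submodule.add_mem _ hs.2.1 ht.2.1,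
        Submodule.add_mem _ hs.2.2 ht.2.2⟩
    | smul c t _ ht =>
      have h3 := Submodule.smul_mem _ c ht.2.2
      rw [smul_sub] at h3
      rw [map_smul, map_smul, map_smul]
      exact ⟨Submodule.smul_mem _ _ ht.1, Submodule.smul_mem _ _ ht.2.1, h3⟩
  refine ⟨?_, key.2.1, ?_⟩
  · have := Submodule.add_mem _ (kazhdanQ_mono (by omega) hX)
      (show G.π l (TensorAlgebra.lift ℂ (Env.ι ∘ₗ (G.p ⊔ l').subtype) t) ∈ G.kazhdanQ l n from
        ⟨_, key.1, rfl⟩)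
    rwa [sub_add_cancel] at this
  · have := Submodule.add_mem _ (symbQ_mem hl hl' hX) key.2.2
    rwa [map_sub, symbQ_π, sub_add_sub_cancel] at this

/-- The element `X` of `W_χ` has Kazhdan degree `j + 2`, and its symbol is `x` plus terms of
higher polynomial degree. -/
structure Lifts (j : ℤ) (x : (G.p ⊔ l' : Submodule ℂ g)) (X : G.W l) : Prop where
  mem : X ∈ G.kazhdanW l (j + 2)
  symb : symbQ hl hl' (G.toQ l X) - SuperSym.ι _ x ∈ (basisPL hl').reg (below (j + 2) 2)

variable {hl hl'}

theorem Lifts.add {j : ℤ} {x x' : (G.p ⊔ l' : Submodule ℂ g)} {X X' : G.W l}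
    (h : Lifts hl hl' j x X) (h' : Lifts hl hl' j x' X') : Lifts hl hl' j (x + x') (X + X') := by
  refine ⟨Submodule.add_mem _ h.mem h'.mem, ?_⟩
  rw [map_add, map_add, map_add, add_sub_add_comm]
  exact Submodule.add_mem _ h.symb h'.symb

theorem Lifts.smul {j : ℤ} {x : (G.p ⊔ l' : Submodule ℂ g)} {X : G.W l}
    (h : Lifts hl hl' j x X) (c : ℂ) : Lifts hl hl' j (c • x) (c • X) := by
  refine ⟨Submodule.smul_mem _ _ h.mem, ?_⟩
  have h1 := Submodule.smul_mem _ c h.symb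
  rw [smul_sub] at h1
  rw [map_smul, map_smul, map_smul]
  exact h1

variable (hl hl') in
theorem Lifts.zero (j : ℤ) : Lifts hl hl' j 0 0 :=
  ⟨Submodule.zero_mem _, by simp⟩

theorem Lifts.sum {ι : Type*} (s : Finset ι) {j : ℤ} {x : ι → (G.p ⊔ l' : Submodule ℂ g)}
    {X : ι → G.W l} (h : ∀ i, Lifts hl hl' j (x i) (X i)) :
    Lifts hl hl' j (∑ i ∈ s, x i) (∑ i ∈ s, X i) := by
  classical
  induction s using Finset.induction_on with
  | empty => exact Lifts.zero hl hl' j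
  | insert i s hi ih =>
    rw [Finset.sum_insert hi, Finset.sum_insert hi]
    exact (h i).add ih

theorem HasTopSymbol.lifts {j : ℤ} {x : χ.annihilator} (hx : (x : g) ∈ G.gr j) {X : G.W l}
    (h : G.HasTopSymbol l l' (G.toQ l X) (G.annihilatorToSym l' x)) :
    Lifts hl hl' j (Submodule.inclusion (le_trans G.annihilator_le le_sup_left) x) X := by
  obtain ⟨n, w, s, hs, hv0, hv, hsv⟩ := h
  obtain ⟨h1, h2, h3⟩ := hs.mem hl hl'
  have hv' : G.annihilatorToSym l' x ∈ (basisPL hl').reg {(j + 2, 1)} :=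
    HomBasis.ι_mem_reg _ (Set.mem_singleton _) ((isBigraded_pl hl').mem_homBasis_gr.2 hx)
  have hsv' : s - G.annihilatorToSym l' x ∈ (basisPL hl').reg {c | c.1 - 2 * c.2 < w} := by
    have : (⨆ w' : ℤ, ⨆ _ : w' < w, G.symWeight l' w') ≤
        (basisPL hl').reg {c | c.1 - 2 * c.2 < w} := iSup_le fun w' => iSup_le fun hw' =>
      (symWeight_le hl' w').trans (HomBasis.reg_mono _ fun c (hc : c.1 - 2 * c.2 = w') =>
        hc.trans_lt hw')
    exact this hsv
  obtain ⟨rfl, h4⟩ := (basisPL hl').sub_mem_below hv0 hv' (symWeight_le hl' w hv) hsv' h2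
  refine ⟨h1, ?_⟩
  have h7 := HomBasis.reg_mono (basisPL hl') (R' := below (j + 2) 2)
    (fun c (hc : c.1 ≤ j + 2 - 1) => ⟨by omega, fun _ => by omega⟩) h3
  have := Submodule.add_mem _ h7 h4
  rw [sub_add_sub_cancel] at this
  exact this

/-- Linear combinations of the given lifts of a homogeneous basis lift all homogeneous
elements. -/
theorem exists_lifts_of_basis {r : ℕ} (y : Module.Basis (Fin r) ℂ χ.annihilator)
    (hy : ∀ i, ∃ j : ℤ, (y i : g) ∈ G.gr j) (Y : Fin r → G.W l)
    (hY : ∀ i, G.HasTopSymbol l l' (G.toQ l (Y i)) (G.annihilatorToSym l' (y i)))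
    {j : ℤ} {x : χ.annihilator} (hx : (x : g) ∈ G.gr j) :
    ∃ X ∈ Submodule.span ℂ (Set.range Y),
      Lifts hl hl' j (Submodule.inclusion (le_trans G.annihilator_le le_sup_left) x) X := by
  choose lab hlab using hy
  rw [← y.sum_repr x]
  have key : ∀ i, Lifts hl hl' j (Submodule.inclusion (le_trans G.annihilator_le le_sup_left)
      (y.repr x i • y i)) (y.repr x i • Y i) := by
    intro i
    by_cases hi : lab i = j
    · rw [map_smul]
      exact (HasTopSymbol.lifts (hi ▸ hlab i) (hY i)).smul _
    · rw [repr_eq_zero_of_iSupIndep y lab (iSupIndep_comap_subtype χ.annihilator G.iSupIndep_gr)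
        hlab hx hi, zero_smul, zero_smul, map_zero]
      exact Lifts.zero hl hl' j
  refine ⟨∑ i, y.repr x i • Y i, Submodule.sum_mem _ fun i _ =>
    Submodule.smul_mem _ _ (Submodule.subset_span ⟨i, rfl⟩), ?_⟩
  rw [map_sum]
  exact Lifts.sum Finset.univ key

/-- If the elements of a subspace `N` of `p ⊕ l'` that contains all vectors orthogonal to `m` have
lifts in `T`, then `T` generates `W_χ`, and `Gr W_χ` is isomorphic to `S(N)`. -/
theorem adjoin_eq_top_and_exists_equiv {N : Submodule ℂ g} (hN : G.IsBigraded N)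
    (le : N ≤ G.p ⊔ l')
    (orth : ∀ v ∈ G.p ⊔ l', (∀ a ∈ G.m l, χ.toLin (br a v) = 0) → v ∈ N)
    (T : Set (G.W l)) (hT : ∀ j (x : N), (x : g) ∈ G.gr j →
      ∃ X ∈ Submodule.span ℂ T, Lifts hl hl' j (Submodule.inclusion le x) X) :
    Algebra.adjoin ℂ T = ⊤ ∧ ∃ Φ : SuperSym (partOn N) ≃ₐ[ℂ] G.GrW l,
      (∀ j (x : N), (x : g) ∈ G.gr j → Φ (SuperSym.ι _ x) ∈ GrW.degree G l (j + 2)) ∧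
      ∀ i (x : N), (x : g) ∈ part i → Φ (SuperSym.ι _ x) ∈ GrW.parity G l i := by
  have h := fun k => hT _ (hN.homBasis.e k) (hN.mem_homBasis_gr.1 (HomBasis.e_mem_gr _ k))
  choose θ h1 h2 using h
  have h' := fun k => exists_parity_component hl hl' (i := hN.homBasis.par k)
    (x := Submodule.inclusion le (hN.homBasis.e k))
    (hN.homBasis.mem_par k) (h2 k).mem (h2 k).symb
  choose θ' h3 h4 using h'
  -- Two families are needed. The lifts taken in the span of T show that T generates; their parity
  -- components may leave that span, but they supercommute in the graded algebra and define the
  -- isomorphism.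
  let Γ : Generators hl hl' hN := ⟨le, orth, θ, fun k => (h2 k).mem, fun k => (h2 k).symb⟩
  let Γ' : Generators hl hl' hN :=
    ⟨le, orth, θ', fun k => kazhdanWPar_le_kazhdanW _ _ (h3 k), h4⟩
  refine ⟨eq_top_iff.2 ?_, Γ'.equivGrW h3, fun j x hx => Γ'.toGrW_ι_mem_degree h3 hx,
    fun i x hx => Γ'.toGrW_ι_mem_parity h3 hx⟩
  rw [← Γ.adjoin_eq_top]
  refine Algebra.adjoin_le ?_
  rintro _ ⟨k, rfl⟩
  have : Submodule.span ℂ T ≤ Subalgebra.toSubmodule (Algebra.adjoin ℂ T) :=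
    Submodule.span_le.2 Algebra.subset_adjoin
  exact this (h1 k)

end GoodGrading
end FinW
end

open scoped DirectSum TensorProduct
noncomputable section
namespace FinW
open LieSuperalgebra (part br)

/-! ### The form `χ([x, y])` on `g₋₁` -/

/-- χ sees only even brackets, so x and y contribute with equal parities. The sign (-1)^(|x||y|)
then depends on y alone and is absorbed by `parityFlip`. -/
theorem χ_br_swap {g : Type*} [AddCommGroup g] [Module ℂ g] [LieSuperalgebra g]
    (χ : EvenFunctional g) (x y : g) :
    χ.toLin (br x y) = -χ.toLin (br (GoodGrading.parityFlip y) x) := by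
  have h : ∀ i j, ∀ x ∈ part (g := g) i, ∀ y ∈ part (g := g) j,
      χ.toLin (br x y) = -(superSign j 1 * χ.toLin (br y x)) := by
    intro i j x hx y hy
    have h1 : i + j = 1 → χ.toLin (br x y) = 0 ∧ χ.toLin (br y x) = 0 := fun hij =>
      ⟨χ.map_odd _ (hij ▸ LieSuperalgebra.br_mem hx hy),
        χ.map_odd _ (hij ▸ add_comm j i ▸ LieSuperalgebra.br_mem hy hx)⟩
    have h2 := congrArg χ.toLin (LieSuperalgebra.br_skew hx hy)
    rw [map_neg, map_smul, smul_eq_mul] at h2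
    rcases zmod_two_cases i with rfl | rfl <;> rcases zmod_two_cases j with rfl | rfl
    · simpa using h2
    · rw [(h1 (by decide)).1, (h1 (by decide)).2]; simp
    · rw [(h1 (by decide)).1, (h1 (by decide)).2]; simp
    · exact h2
  obtain ⟨x₀, hx₀, x₁, hx₁, rfl⟩ := exists_even_add_odd x
  obtain ⟨y₀, hy₀, y₁, hy₁, rfl⟩ := exists_even_add_odd y
  rw [map_add GoodGrading.parityFlip, GoodGrading.parityFlip_of_mem hy₀,
    GoodGrading.parityFlip_of_mem hy₁]
  simp only [map_add, map_smul, LinearMap.add_apply, LinearMap.smul_apply, smul_eq_mul,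
    h _ _ _ hx₀ _ hy₀, h _ _ _ hx₁ _ hy₀, h _ _ _ hx₀ _ hy₁, h _ _ _ hx₁ _ hy₁]
  ring

theorem IsSuperSubspace.parityFlip_mem {g : Type*} [AddCommGroup g] [Module ℂ g]
    [LieSuperalgebra g] {N : Submodule ℂ g} (hN : IsSuperSubspace N) {x : g} (hx : x ∈ N) :
    GoodGrading.parityFlip x ∈ N :=
  Submodule.sub_mem _ (hN.parityProj_mem 0 hx) (hN.parityProj_mem 1 hx)

namespace GoodGrading

variable {g : Type*} [AddCommGroup g] [Module ℂ g] [LieSuperalgebra g]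
  {χ : EvenFunctional g} {G : GoodGrading χ} {l l' : Submodule ℂ g}

theorem _root_.FinW.EvenFunctional.mem_annihilator_of_left {x : g}
    (h : ∀ y, χ.toLin (br y x) = 0) : x ∈ χ.annihilator :=
  EvenFunctional.mem_annihilator.2 fun y => by rw [χ_br_swap, h, neg_zero]

variable (χ) in
/-- The vectors of `l'` orthogonal to `l`. -/
def orthIn (l l' : Submodule ℂ g) : Submodule ℂ g where
  carrier := {x | x ∈ l' ∧ ∀ a ∈ l, χ.toLin (br a x) = 0}
  add_mem' hx hy := ⟨Submodule.add_mem _ hx.1 hy.1, fun a ha => by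
    rw [map_add, map_add, hx.2 a ha, hy.2 a ha, add_zero]⟩
  zero_mem' := ⟨Submodule.zero_mem _, fun a _ => by simp⟩
  smul_mem' c x hx := ⟨Submodule.smul_mem _ _ hx.1, fun a ha => by
    rw [map_smul, map_smul, hx.2 a ha, smul_zero]⟩

theorem χ_br_parityProj_right {i : ZMod 2} {a : g} (ha : a ∈ part i) (x : g) :
    χ.toLin (br a (parityProj i x)) = χ.toLin (br a x) := by
  have h : ∀ j, i + j = 1 → χ.toLin (br a (parityProj j x)) = 0 := fun j hij =>
    χ.map_odd _ (hij ▸ LieSuperalgebra.br_mem ha (parityProj_mem j x))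
  conv_rhs => rw [← parityProj_add x]
  rw [map_add, map_add]
  rcases zmod_two_cases i with rfl | rfl
  · rw [h 1 (by decide), add_zero]
  · rw [h 0 (by decide), zero_add]

theorem χ_br_parityProj (i : ZMod 2) (a x : g) :
    χ.toLin (br a (parityProj i x)) = χ.toLin (br (parityProj i a) x) := by
  rw [← χ_br_parityProj_right (parityProj_mem i a) x]
  conv_lhs => rw [← parityProj_add a]
  have h : ∀ j, j + i = 1 → χ.toLin (br (parityProj j a) (parityProj i x)) = 0 := fun j hij =>
    χ.map_odd _ (hij ▸ LieSuperalgebra.br_mem (parityProj_mem j a) (parityProj_mem i x))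
  rw [map_add, LinearMap.add_apply, map_add]
  rcases zmod_two_cases i with rfl | rfl
  · rw [h 1 (by decide), add_zero]
  · rw [h 0 (by decide), zero_add]

theorem parityProj_mem_orthIn (hl : IsSuperSubspace l) (hl' : IsSuperSubspace l') (i : ZMod 2)
    {x : g} (hx : x ∈ orthIn χ l l') : parityProj i x ∈ orthIn χ l l' :=
  ⟨hl'.parityProj_mem i hx.1, fun a ha => by
    rw [χ_br_parityProj]; exact hx.2 _ (hl.parityProj_mem i ha)⟩

theorem IsIsotropic.χ_br_right (hl : IsSuperSubspace l) {x : g}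
    (hx : ∀ a ∈ l, χ.toLin (br a x) = 0) {a : g} (ha : a ∈ l) : χ.toLin (br x a) = 0 := by
  rw [χ_br_swap, hx _ (hl.parityFlip_mem ha), neg_zero]

theorem mem_orthIn_of_right (hl : IsSuperSubspace l) {x : g} (hx : x ∈ l')
    (h : ∀ a ∈ l, χ.toLin (br x a) = 0) : x ∈ orthIn χ l l' := by
  refine ⟨hx, fun a ha => ?_⟩
  have h2 := χ_br_swap χ x (parityFlip a)
  rw [h _ (hl.parityFlip_mem ha), parityFlip_parityFlip] at h2
  exact neg_eq_zero.1 h2.symm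

/-- A homogeneous vector of `l'` orthogonal to `l` and to itself vanishes. -/
theorem eq_zero_of_mem_orthIn (hl : G.IsMaximalIsotropic l) (hl' : G.IsAdmissibleComplement l l')
    {i : ZMod 2} {x : g} (hx : x ∈ orthIn χ l l') (hxi : x ∈ part i)
    (hxx : χ.toLin (br x x) = 0) : x = 0 := by
  -- Adding x keeps l isotropic, so maximality puts x into l, which meets l' only in zero.
  have h : G.IsIsotropic (l ⊔ ℂ ∙ x) := by
    refine ⟨sup_le hl.prop.1 ?_, ?_, ?_⟩
    · rw [Submodule.span_singleton_le_iff_mem]; exact hl'.le hx.1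
    · refine .of_parityProj fun z hz => ?_
      obtain ⟨a, ha, b, hb, rfl⟩ := Submodule.mem_sup.1 hz
      obtain ⟨c, rfl⟩ := Submodule.mem_span_singleton.1 hb
      rw [map_add, map_smul]
      refine Submodule.add_mem_sup (hl.prop.2.1.parityProj_mem 0 ha) (Submodule.smul_mem _ _ ?_)
      rcases zmod_two_cases i with rfl | rfl
      · rw [parityProj_of_mem hxi]; exact Submodule.mem_span_singleton_self x
      · rw [parityProj_of_mem_ne (by decide) hxi]; exact Submodule.zero_mem _
    · intro z hz z' hz'
      obtain ⟨a, ha, b, hb, rfl⟩ := Submodule.mem_sup.1 hz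
      obtain ⟨c, rfl⟩ := Submodule.mem_span_singleton.1 hb
      obtain ⟨a', ha', b', hb', rfl⟩ := Submodule.mem_sup.1 hz'
      obtain ⟨c', rfl⟩ := Submodule.mem_span_singleton.1 hb'
      simp [hl.prop.2.2 a ha a' ha', hx.2 a ha, hxx,
        IsIsotropic.χ_br_right hl.prop.2.1 hx.2 ha']
  have h1 : x ∈ l := hl.le_of_ge h le_sup_left
    (Submodule.mem_sup_right (Submodule.mem_span_singleton_self x))
  have h2 : x ∈ l ⊓ l' := ⟨h1, hx.1⟩
  rw [hl'.inf_eq_bot] at h2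
  exact h2

/-- On even vectors the form is skew-symmetric, so the even component of a vector in this space is
orthogonal to itself and vanishes. -/
theorem orthIn_le_part_one (hl : G.IsMaximalIsotropic l) (hl' : G.IsAdmissibleComplement l l') :
    orthIn χ l l' ≤ part 1 := by
  intro x hx
  have h0 := parityProj_mem_orthIn hl.prop.2.1 hl'.isSuperSubspace 0 hx
  have h1 : parityProj 0 x = 0 := by
    refine eq_zero_of_mem_orthIn hl hl' h0 (parityProj_mem 0 x) ?_
    have := χ_br_swap χ (parityProj 0 x) (parityProj 0 x)
    rw [parityFlip_of_mem (parityProj_mem 0 x), superSign_zero_left, one_smul] at this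
    exact self_eq_neg.1 this
  rw [← parityProj_add x, h1, zero_add]
  exact parityProj_mem 1 x

/-- A plane in this odd space would contain a nonzero null vector, since a quadratic equation over ℂ
has a root; there is none. -/
theorem orthIn_le_span (hl : G.IsMaximalIsotropic l) (hl' : G.IsAdmissibleComplement l l')
    {x : g} (hx : x ∈ orthIn χ l l') (h0 : x ≠ 0) : orthIn χ l l' ≤ ℂ ∙ x := by
  intro y hy
  have hx1 := orthIn_le_part_one hl hl' hx
  have hy1 := orthIn_le_part_one hl hl' hy
  have hxx : χ.toLin (br x x) ≠ 0 := fun h => h0 (eq_zero_of_mem_orthIn hl hl' hx hx1 h)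
  obtain ⟨t, ht⟩ := exists_quadratic_eq_zero (b := χ.toLin (br x y) + χ.toLin (br y x))
    (c := χ.toLin (br y y)) hxx (IsAlgClosed.exists_eq_mul_self _)
  have h : y + t • x = 0 := by
    refine eq_zero_of_mem_orthIn hl hl' (Submodule.add_mem _ hy (Submodule.smul_mem _ t hx))
      (Submodule.add_mem _ hy1 (Submodule.smul_mem _ t hx1)) ?_
    simp only [map_add, map_smul, LinearMap.add_apply, LinearMap.smul_apply, smul_eq_mul]
    linear_combination ht
  rw [eq_neg_of_add_eq_zero_left h]
  exact Submodule.neg_mem _ (Submodule.smul_mem _ _ (Submodule.mem_span_singleton_self x))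

/-- The form on `g₋₁` is nondegenerate. -/
theorem eq_zero_of_χ_br {x : g} (hx : x ∈ G.gr (-1))
    (h : ∀ y ∈ G.gr (-1), χ.toLin (br x y) = 0) : x = 0 := by
  have h1 : x ∈ χ.annihilator := EvenFunctional.mem_annihilator.2 fun y => by
    rw [χ_br_grProj_right (k := -1) (by norm_num) hx]
    exact h _ (G.grProj_mem _ _)
  rw [← G.grProj_of_mem hx]
  exact grProj_p (by norm_num) (G.annihilator_le h1)

/-- On the odd part of g₋₁ the form is nondegenerate. The orthogonal of the odd part l₁ of l is the
direct sum of l₁ and `orthIn χ l l'`, so k = dim l₁ works. -/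
theorem finrank_odd_part [FiniteDimensional ℂ g] (hl : G.IsMaximalIsotropic l)
    (hl' : G.IsAdmissibleComplement l l') : ∃ k,
    Module.finrank ℂ (G.gr (-1) ⊓ part 1 : Submodule ℂ g) =
      2 * k + Module.finrank ℂ (orthIn χ l l') := by
  let E : Submodule ℂ g := G.gr (-1) ⊓ part 1
  let B : LinearMap.BilinForm ℂ E := ((br (g := g)).compr₂ χ.toLin).domRestrict₁₂ E E
  have hB : ∀ x y : E, B x y = χ.toLin (br (x : g) (y : g)) := fun _ _ => rfl
  have hker : LinearMap.ker B = ⊥ := by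
    refine (Submodule.eq_bot_iff _).2 fun x hx => Subtype.ext ?_
    refine eq_zero_of_χ_br x.2.1 fun y hy => ?_
    rw [← χ_br_parityProj_right x.2.2]
    exact (hB x ⟨parityProj 1 y, (G.isSuperSubspace (-1)).parityProj_mem 1 hy,
      parityProj_mem 1 y⟩).symm.trans (LinearMap.congr_fun (LinearMap.mem_ker.1 hx) _)
  have h1 := LinearMap.BilinForm.finrank_add_finrank_orthogonal' (B := B) (l.comap E.subtype)
  -- A vector orthogonal to l₁ is split along l ⊕ l'. Its l-part is orthogonal to l₁ by isotropy,
  -- hence so is its l'-part; that part is odd and therefore orthogonal to all of l.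
  have horth : B.orthogonal (l.comap E.subtype) =
      l.comap E.subtype ⊔ (orthIn χ l l').comap E.subtype := by
    refine le_antisymm (fun x hx => ?_) (sup_le (fun x hx a ha => ?_) fun x hx a ha => hx.2 _ ha)
    · have hx' : (x : g) ∈ l ⊔ l' := hl'.sup_eq ▸ x.2.1
      obtain ⟨a, ha, b, hb, hab⟩ := Submodule.mem_sup.1 hx'
      have ha1 := hl.prop.2.1.parityProj_mem 1 ha
      have hb1 := hl'.isSuperSubspace.parityProj_mem 1 hb
      have hab1 : parityProj 1 a + parityProj 1 b = x := by
        rw [← map_add, hab, parityProj_of_mem x.2.2]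
      refine Submodule.mem_sup.2 ⟨⟨parityProj 1 a, hl.prop.1 ha1, parityProj_mem 1 a⟩, ha1,
        ⟨parityProj 1 b, hl'.le hb1, parityProj_mem 1 b⟩, ⟨hb1, fun c hc => ?_⟩,
        Subtype.ext hab1⟩
      have hc1 := hl.prop.2.1.parityProj_mem 1 hc
      change χ.toLin (br c (parityProj 1 b)) = 0
      have e1 : χ.toLin (br (parityProj 1 c) (x : g)) = 0 :=
        hx ⟨parityProj 1 c, hl.prop.1 hc1, parityProj_mem 1 c⟩ hc1
      have e2 := hl.prop.2.2 _ hc1 _ ha1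
      rw [← hab1, map_add, map_add, e2, zero_add] at e1
      have e3 := χ_br_parityProj (χ := χ) 1 c (parityProj 1 b)
      rw [parityProj_of_mem (parityProj_mem 1 b)] at e3
      rw [e3, e1]
    · exact hl.prop.2.2 _ ha _ hx
  have h2 := Submodule.finrank_sup_add_finrank_inf_eq (l.comap E.subtype)
    ((orthIn χ l l').comap E.subtype)
  have h3 : l.comap E.subtype ⊓ (orthIn χ l l').comap E.subtype = ⊥ := by
    refine (Submodule.eq_bot_iff _).2 fun x hx => Subtype.ext ?_
    have : (x : g) ∈ l ⊓ l' := ⟨hx.1, hx.2.1⟩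
    rw [hl'.inf_eq_bot] at this
    exact this
  have h4 : Module.finrank ℂ ((orthIn χ l l').comap E.subtype) =
      Module.finrank ℂ (orthIn χ l l') :=
    (Submodule.comapSubtypeEquivOfLe (le_inf (fun x (hx : x ∈ orthIn χ l l') => hl'.le hx.1)
      (orthIn_le_part_one hl hl'))).finrank_eq
  rw [horth, hker, inf_bot_eq, finrank_bot] at h1
  rw [h3, finrank_bot] at h2
  refine ⟨Module.finrank ℂ (l.comap E.subtype), ?_⟩
  change Module.finrank ℂ E = _
  omega

theorem orthIn_eq_bot [FiniteDimensional ℂ g] (hl : G.IsMaximalIsotropic l)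
    (hl' : G.IsAdmissibleComplement l l')
    (h : Even (Module.finrank ℂ (G.gr (-1) ⊓ part 1 : Submodule ℂ g))) :
    orthIn χ l l' = ⊥ := by
  by_contra hne
  obtain ⟨x, hx, h0⟩ := Submodule.exists_mem_ne_zero_of_ne_bot hne
  obtain ⟨k, hk⟩ := finrank_odd_part hl hl'
  have h1 : orthIn χ l l' = ℂ ∙ x := le_antisymm (orthIn_le_span hl hl' hx h0)
    ((Submodule.span_singleton_le_iff_mem _ _).2 hx)
  rw [hk, h1, finrank_span_singleton h0] at h
  exact (Nat.not_even_iff_odd.2 ⟨k, rfl⟩) h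

theorem exists_mem_orthIn [FiniteDimensional ℂ g] (hl : G.IsMaximalIsotropic l)
    (hl' : G.IsAdmissibleComplement l l')
    (h : Odd (Module.finrank ℂ (G.gr (-1) ⊓ part 1 : Submodule ℂ g))) :
    ∃ θ ∈ orthIn χ l l', χ.toLin (br θ θ) = 2 := by
  have hne : orthIn χ l l' ≠ ⊥ := by
    intro hb
    obtain ⟨k, hk⟩ := finrank_odd_part hl hl'
    rw [hb, finrank_bot, add_zero] at hk
    rw [hk] at h
    exact (Nat.not_odd_iff_even.2 ⟨k, two_mul k⟩) h
  obtain ⟨x, hx, h0⟩ := Submodule.exists_mem_ne_zero_of_ne_bot hne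
  have hxx : χ.toLin (br x x) ≠ 0 := fun h =>
    h0 (eq_zero_of_mem_orthIn hl hl' hx (orthIn_le_part_one hl hl' hx) h)
  -- Scaling by c multiplies the value of the form by c squared.
  obtain ⟨c, hc⟩ := IsAlgClosed.exists_eq_mul_self (2 / χ.toLin (br x x))
  refine ⟨c • x, Submodule.smul_mem _ _ hx, ?_⟩
  simp only [map_smul, LinearMap.smul_apply, smul_eq_mul]
  rw [← mul_assoc, ← hc, div_mul_cancel₀ _ hxx]

/-- In v + b with v in p and b in l', degrees at most -2 pair only with v, while v is orthogonal to
all degrees at least -1. So orthogonality to the first part of m puts v into g^χ, and orthogonality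
to l becomes a condition on b alone. -/
theorem mem_annihilator_sup_orthIn (hl : G.IsIsotropic l) (hl' : G.IsAdmissibleComplement l l')
    {v : g} (hv : v ∈ G.p ⊔ l') (h : ∀ a ∈ G.m l, χ.toLin (br a v) = 0) :
    v ∈ χ.annihilator ⊔ orthIn χ l l' := by
  obtain ⟨v, hvp, b, hb, rfl⟩ := Submodule.mem_sup.1 hv
  have hp : ∀ j, -1 ≤ j → ∀ y ∈ G.gr j, χ.toLin (br y v) = 0 := fun j hj y hy => by
    rw [χ_br_grProj_right (k := -2 - j) (by ring) hy, grProj_p (by omega) hvp, map_zero, map_zero]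
  refine Submodule.add_mem_sup (EvenFunctional.mem_annihilator_of_left fun y => ?_)
    ⟨hb, fun a ha => ?_⟩
  · have : (⨆ j, G.gr j) ≤ LinearMap.ker (χ.toLin ∘ₗ (br (g := g)).flip v) :=
      iSup_le fun j y hy => by
        change χ.toLin (br y v) = 0
        by_cases hj : -1 ≤ j
        · exact hp j hj y hy
        · have := h y (gr_le_m l (by omega) hy)
          rwa [map_add, map_add, χ_br_of_ne (by omega) hy (hl'.le hb), add_zero] at this
    exact this (G.iSup_gr ▸ Submodule.mem_top)
  · have := h a (Submodule.mem_sup_right ha)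
    rwa [map_add, map_add, hp (-1) le_rfl a (hl.1 ha), zero_add] at this

/-! ### The generator in the orthogonal complement of `l` -/

/-- θ has degree -1, so its brackets with degrees at most -2 lie in degrees at most -3. Its brackets
with l lie in degree -2, and χ kills them by orthogonality. -/
theorem br_mem_m_of_mem_orthIn (hl : G.IsIsotropic l) (hl' : G.IsAdmissibleComplement l l')
    {θ : g} (hθ : θ ∈ orthIn χ l l') {a : g} (ha : a ∈ G.m l) :
    br a θ ∈ G.m l ∧ χ.toLin (br a θ) = 0 := by
  have h1 : ∀ j ≤ -2, ∀ z ∈ G.gr j, br z θ ∈ G.m l ⊓ LinearMap.ker χ.toLin := fun j hj z hz =>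
    ⟨gr_le_m l (by omega) (G.br_mem hz (hl'.le hθ.1)),
      χ_br_of_ne (by omega) hz (hl'.le hθ.1)⟩
  have h2 : G.m l ≤ (G.m l ⊓ LinearMap.ker χ.toLin).comap ((br (g := g)).flip θ) :=
    sup_le (iSup_le fun j => iSup_le fun hj z hz => h1 j hj z hz) fun z hz =>
      ⟨gr_le_m l (by norm_num) (G.br_mem (hl.1 hz) (hl'.le hθ.1)), hθ.2 z hz⟩
  exact h2 ha

theorem exists_toQ_eq_π_ι (hl : G.IsIsotropic l) (hl' : G.IsAdmissibleComplement l l') {θ : g}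
    (hθ : θ ∈ orthIn χ l l') (h1 : θ ∈ part 1) : ∃ Θ : G.W l, G.toQ l Θ = G.π l (Env.ι θ) := by
  refine exists_toQ_eq fun a ha => ?_
  have hI : ∀ b ∈ G.m l, ∀ u : Env g, u * (Env.ι b - χ.toLin b • (1 : Env g)) ∈ G.I l := by
    intro b hb u
    refine Submodule.smul_mem _ u (Submodule.subset_span ⟨b, hb, ?_⟩)
    rw [Algebra.algebraMap_eq_smul_one]
  -- As θ is odd, moving a past it flips the sign of the odd part of a; χ does not notice this. Both
  -- terms on the right lie in the left ideal.
  have e : (Env.ι a - χ.toLin a • (1 : Env g)) * Env.ι θ =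
      Env.ι θ * (Env.ι (parityFlip a) - χ.toLin (parityFlip a) • (1 : Env g)) +
        1 * (Env.ι (br a θ) - χ.toLin (br a θ) • (1 : Env g)) := by
    rw [χ_parityFlip, (br_mem_m_of_mem_orthIn hl hl' hθ ha).2, zero_smul, sub_zero, one_mul]
    obtain ⟨a₀, h₀, a₁, h₁, rfl⟩ := exists_even_add_odd a
    rw [map_add br, LinearMap.add_apply, map_add Env.ι (br a₀ θ), ← env_ι_mul_ι h₀ h1, ← env_ι_mul_ι h₁ h1,
      map_add parityFlip, parityFlip_of_mem h₀, parityFlip_of_mem h₁]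
    simp only [map_add, map_smul, sub_mul, mul_sub, add_mul, mul_add, mul_smul_comm,
      smul_mul_assoc, mul_one, one_mul, superSign_zero_left, superSign_one_one]
    module
  rw [e]
  exact Submodule.add_mem _ (hI _ ((isBigraded_m hl).isSuper.parityFlip_mem ha) _)
    (hI _ (br_mem_m_of_mem_orthIn hl hl' hθ ha).1 _)

theorem lifts_ι [FiniteDimensional ℂ g] (hl : G.IsIsotropic l)
    (hl' : G.IsAdmissibleComplement l l') {j : ℤ} {x : (G.p ⊔ l' : Submodule ℂ g)}
    (hx : (x : g) ∈ G.gr j) {X : G.W l} (hX : G.toQ l X = G.π l (Env.ι (x : g))) :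
    Lifts hl hl' j x X := by
  refine ⟨⟨Env.ι (x : g), G.ι_mem_kazhdanU le_rfl hx, hX.symm⟩, ?_⟩
  have : symbQ hl hl' (G.toQ l X) = SuperSym.ι _ x := by
    rw [hX, symbQ_π, ← actS_one, actS_ι, Polarization.rep_one _ G.isSuperSubspace,
      tl_of_mem_pl hl hl' hx, mul_one]
  rw [this, sub_self]
  exact Submodule.zero_mem _

end GoodGrading
end FinW
end

open scoped DirectSum TensorProduct
noncomputable section
namespace FinW
open LieSuperalgebra (part br)

/-! ### Adjoining an odd vector -/

theorem units_smul_eq_superSign {C : Type*} [AddCommGroup C] [Module ℂ C] (i j : ZMod 2) (x : C) :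
    ((-1 : ℤˣ) ^ (j * i)) • x = superSign i j • x := by
  rcases zmod_two_cases i with rfl | rfl <;> rcases zmod_two_cases j with rfl | rfl <;>
    simp

section AdjoinOdd

variable {g : Type*} [AddCommGroup g] [Module ℂ g] [LieSuperalgebra g] {A : Submodule ℂ g}
  {θ : g}

theorem SuperSym.ι_mul_self {N : Submodule ℂ g} {x : N} (hx : (x : g) ∈ part 1) :
    SuperSym.ι (partOn N) x * SuperSym.ι (partOn N) x = 0 := by
  have h := SuperSym.ι_mul_ι (partOn N) (i := 1) (j := 1) hx hx
  have e : ∀ z : SuperSym (partOn N), (-1 : ℂ) • z = -z := fun z => by module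
  rw [superSign_one_one, e] at h
  have h2 : (2 : ℂ) • (SuperSym.ι (partOn N) x * SuperSym.ι (partOn N) x) = 0 := by
    rw [two_smul]
    exact add_eq_zero_iff_eq_neg.2 h
  exact (smul_eq_zero.1 h2).resolve_left two_ne_zero

/-- The homomorphism of symmetric superalgebras induced by an inclusion. -/
def SuperSym.incl {N : Submodule ℂ g} (le : A ≤ N) :
    SuperSym (partOn A) →ₐ[ℂ] SuperSym (partOn N) :=
  SuperSym.lift (SuperSym.ι _ ∘ₗ Submodule.inclusion le) fun _ _ _ hx _ hy =>
    SuperSym.ι_mul_ι (partOn N) hx hy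

theorem SuperSym.incl_ι {N : Submodule ℂ g} (le : A ≤ N) (x : A) :
    SuperSym.incl le (SuperSym.ι _ x) = SuperSym.ι _ (Submodule.inclusion le x) := by
  rw [SuperSym.incl, SuperSym.lift_ι]; rfl

theorem SuperSym.incl_mul_ι {N : Submodule ℂ g} (le : A ≤ N) {i j : ZMod 2}
    {a : SuperSym (partOn A)} (ha : a ∈ SuperSym.parity (partOn A) i) {x : N}
    (hx : (x : g) ∈ part j) : SuperSym.incl le a * SuperSym.ι _ x =
      superSign i j • (SuperSym.ι _ x * SuperSym.incl le a) := by
  induction ha using Submodule.span_induction with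
  | mem a ha =>
    obtain ⟨w, hw, rfl, rfl⟩ := ha
    induction w with
    | nil => simp
    | cons q w ih =>
      have h := SuperSym.ι_mul_ι (partOn N) (x := Submodule.inclusion le q.2)
        (hw q List.mem_cons_self) (show x ∈ partOn N j from hx)
      simp only [List.map_cons, List.prod_cons, List.sum_cons, map_mul, SuperSym.incl_ι]
      rw [mul_assoc, ih fun q hq => hw q (List.mem_cons_of_mem _ hq), mul_smul_comm, ← mul_assoc,
        h, superSign_add_left, smul_mul_assoc, smul_smul, mul_comm, mul_assoc]
  | zero => simp
  | add a b _ _ ha hb => rw [map_add, add_mul, ha, hb, mul_add, smul_add]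
  | smul c a _ ha => rw [map_smul, smul_mul_assoc, ha, mul_smul_comm, smul_comm]

/-- The homomorphism from the exterior algebra that sends the generator to an odd vector. -/
def extLift {N : Submodule ℂ g} {x : N} (hx : (x : g) ∈ part 1) :
    ExteriorAlgebra ℂ ℂ →ₐ[ℂ] SuperSym (partOn N) :=
  ExteriorAlgebra.lift ℂ ⟨LinearMap.toSpanSingleton ℂ _ (SuperSym.ι _ x), fun m => by
    rw [LinearMap.toSpanSingleton_apply, smul_mul_smul_comm, SuperSym.ι_mul_self hx, smul_zero]⟩

theorem extLift_ι {N : Submodule ℂ g} {x : N} (hx : (x : g) ∈ part 1) (m : ℂ) :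
    extLift hx (ExteriorAlgebra.ι ℂ m) = m • SuperSym.ι _ x := by
  simp [extLift]

/-- On multiples of ξ this is the sign rule for the odd vector x; products of two multiples of ξ are
sent to zero because x squares to zero. -/
theorem SuperSym.incl_mul_extLift {N : Submodule ℂ g} (le : A ≤ N) {x : N}
    (hx : (x : g) ∈ part 1) {i j : ZMod 2} {a : SuperSym (partOn A)}
    (ha : a ∈ SuperSym.parity (partOn A) i) {b : ExteriorAlgebra ℂ ℂ} (hb : b ∈ extParity j) :
    SuperSym.incl le a * extLift hx b = superSign i j • (extLift hx b * SuperSym.incl le a) := by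
  induction b, hb using CliffordAlgebra.evenOdd_induction with
  | range_ι_pow v h =>
    rcases zmod_two_cases j with rfl | rfl
    · rw [ZMod.val_zero, pow_zero] at h
      obtain ⟨c, rfl⟩ := Submodule.mem_one.1 h
      rw [AlgHom.commutes, superSign_zero_right, one_smul, Algebra.commutes]
    · rw [ZMod.val_one, pow_one] at h
      obtain ⟨m, rfl⟩ := h
      have e : extLift hx (CliffordAlgebra.ι 0 m) = m • SuperSym.ι _ x := extLift_ι hx m
      rw [e, mul_smul_comm, SuperSym.incl_mul_ι le ha hx, smul_mul_assoc, smul_comm]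
  | add b b' _ _ h h' => rw [map_add, mul_add, h, h', add_mul, smul_add]
  | ι_mul_ι_mul m₁ m₂ b _ _ =>
    have e : ∀ m, extLift hx (CliffordAlgebra.ι 0 m) = m • SuperSym.ι _ x := extLift_ι hx
    rw [map_mul, map_mul, e, e, smul_mul_smul_comm, SuperSym.ι_mul_self hx]
    simp

variable (A) in
theorem includeLeft_mul_ξ [DirectSum.Decomposition (partOn A)] {i : ZMod 2} {a : SuperSym (partOn A)}
    (ha : a ∈ SuperSym.parity (partOn A) i) :
    GradedTensorProduct.includeLeft (SuperSym.parity (partOn A)) extParity a *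
      GradedTensorProduct.includeRight (SuperSym.parity (partOn A)) extParity ξ =
    superSign i 1 • (GradedTensorProduct.includeRight (SuperSym.parity (partOn A)) extParity ξ *
      GradedTensorProduct.includeLeft (SuperSym.parity (partOn A)) extParity a) := by
  have hξ : ξ ∈ extParity 1 := CliffordAlgebra.ι_mem_evenOdd_one _ _
  have := ((GradedTensorProduct.liftEquiv (SuperSym.parity (partOn A)) extParity).symm
    (AlgHom.id ℂ _)).prop ⟨a, ha⟩ ⟨ξ, hξ⟩
  rw [units_smul_eq_superSign] at this
  exact this

theorem ξ_mul_ξ : ξ * ξ = 0 := ExteriorAlgebra.ι_sq_zero _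

/-- Adjoining an odd vector to a super vector space amounts to tensoring the symmetric superalgebra
with an exterior algebra on one generator. -/
theorem exists_equiv_adjoin_odd [DirectSum.Decomposition (partOn A)] (hθ : θ ∈ part 1) (φ : g →ₗ[ℂ] ℂ) 
    (hA : A ≤ LinearMap.ker φ) (h0 : part 0 ≤ LinearMap.ker φ) (h1 : φ θ = 1) :
    ∃ Ψ : (SuperSym.parity (partOn A) ᵍ⊗[ℂ] extParity) ≃ₐ[ℂ] SuperSym (partOn (A ⊔ ℂ ∙ θ)),
      (∀ x, Ψ (GradedTensorProduct.includeLeft (SuperSym.parity (partOn A)) extParity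
        (SuperSym.ι _ x)) = SuperSym.ι _ (Submodule.inclusion le_sup_left x)) ∧
      Ψ (GradedTensorProduct.includeRight (SuperSym.parity (partOn A)) extParity ξ) =
        SuperSym.ι _ ⟨θ, Submodule.mem_sup_right (Submodule.mem_span_singleton_self θ)⟩ := by
  let N : Submodule ℂ g := A ⊔ ℂ ∙ θ
  let t : N := ⟨θ, Submodule.mem_sup_right (Submodule.mem_span_singleton_self θ)⟩
  have le : A ≤ N := le_sup_left
  let Ψ := GradedTensorProduct.lift (SuperSym.parity (partOn A)) extParity (SuperSym.incl le)
    (extLift (x := t) hθ) fun i j a b => by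
      rw [units_smul_eq_superSign]
      exact SuperSym.incl_mul_extLift le hθ a.2 b.2
  let L := GradedTensorProduct.includeLeft (SuperSym.parity (partOn A)) extParity
  let R := GradedTensorProduct.includeRight (SuperSym.parity (partOn A)) extParity
  have hΨL : ∀ a, Ψ (L a) = SuperSym.incl le a := fun a => by
    change GradedTensorProduct.lift _ _ _ _ _ (_ ᵍ⊗ₜ[ℂ] 1) = _
    rw [GradedTensorProduct.lift_tmul, map_one, mul_one]
  have hΨR : ∀ b, Ψ (R b) = extLift (x := t) hθ b := fun b => by
    change GradedTensorProduct.lift _ _ _ _ _ (1 ᵍ⊗ₜ[ℂ] _) = _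
    rw [GradedTensorProduct.lift_tmul, map_one, one_mul]
  -- The functional φ splits N as A ⊕ ℂθ: it vanishes on A and is 1 on θ, so x - φ(x) θ is the
  -- component in A.
  let pr : N →ₗ[ℂ] A := (N.subtype - (φ ∘ₗ N.subtype).smulRight θ).codRestrict A (by
    rintro ⟨x, hx⟩
    obtain ⟨a, ha, b, hb, rfl⟩ := Submodule.mem_sup.1 hx
    obtain ⟨c, rfl⟩ := Submodule.mem_span_singleton.1 hb
    have ha' : φ a = 0 := hA ha
    simpa [ha', h1] using ha)
  have hpr : ∀ x : N, (pr x : g) = x - φ x • θ := fun _ => rfl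
  -- The inverse on generators: the component in A goes to the left factor and θ goes to ξ. Since φ
  -- is odd, f respects parity and the relations hold.
  let f := L.toLinearMap ∘ₗ SuperSym.ι _ ∘ₗ pr + (φ ∘ₗ N.subtype).smulRight (R ξ)
  have hf : ∀ x : N, f x = L (SuperSym.ι _ (pr x)) + φ x • R ξ := fun _ => rfl
  have hL : ∀ {i j} {x y : A}, (x : g) ∈ part i → (y : g) ∈ part j →
      L (SuperSym.ι _ x) * L (SuperSym.ι _ y) =
        superSign i j • (L (SuperSym.ι _ y) * L (SuperSym.ι _ x)) := fun hx hy => by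
    rw [← map_mul, SuperSym.ι_mul_ι (partOn A) hx hy, map_smul, map_mul]
  have hLR : ∀ {i} {x : A}, (x : g) ∈ part i →
      L (SuperSym.ι _ x) * R ξ = superSign i 1 • (R ξ * L (SuperSym.ι _ x)) := fun hx =>
    includeLeft_mul_ξ A (SuperSym.ι_mem_parity (partOn A) hx)
  have hRR : R ξ * R ξ = 0 := by rw [← map_mul, ξ_mul_ξ, map_zero]
  have hpart : ∀ i, ∀ x ∈ partOn N i, (pr x : g) ∈ part i ∧ (i = 0 → φ x = 0) := by
    intro i x hx
    have hx' : (x : g) ∈ part i := hx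
    rw [hpr]
    rcases zmod_two_cases i with rfl | rfl
    · have : φ x = 0 := h0 hx'
      rw [this, zero_smul, sub_zero]
      exact ⟨hx', fun _ => rfl⟩
    · exact ⟨Submodule.sub_mem _ hx' (Submodule.smul_mem _ _ hθ), fun h => absurd h (by decide)⟩
  let Λ : SuperSym (partOn N) →ₐ[ℂ] _ := SuperSym.lift f (by
    intro i j x hx y hy
    obtain ⟨hx1, hx2⟩ := hpart i x hx
    obtain ⟨hy1, hy2⟩ := hpart j y hy
    have e1 := hL hx1 hy1
    have e2 := hLR hx1
    have e3 := hLR hy1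
    rw [hf, hf]
    generalize L (SuperSym.ι _ (pr x)) = X at *
    generalize L (SuperSym.ι _ (pr y)) = Y at *
    rcases zmod_two_cases i with rfl | rfl <;> rcases zmod_two_cases j with rfl | rfl
    · rw [hx2 rfl, hy2 rfl]
      simpa using e1
    · rw [hx2 rfl]
      simp only [superSign_zero_left, one_smul] at e1 e2 ⊢
      simp [mul_add, add_mul, e1, e2]
    · rw [hy2 rfl]
      simp only [superSign_zero_right, superSign_zero_left, one_smul] at e1 e3 ⊢
      simp [mul_add, add_mul, e1, e3]
    · simp only [superSign_one_one] at e1 e2 e3 ⊢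
      simp only [mul_add, add_mul, mul_smul_comm, smul_mul_assoc, e1, e2, e3, hRR]
      module)
  have hΛ : ∀ x, Λ (SuperSym.ι _ x) = f x := fun x => SuperSym.lift_ι _ _ _
  refine ⟨AlgEquiv.ofAlgHom Ψ Λ ?_ ?_, fun x => (hΨL _).trans (SuperSym.incl_ι le x), ?_⟩
  · refine SuperSym.algHom_ext fun x => ?_
    rw [AlgHom.comp_apply, hΛ, hf, map_add, map_smul, hΨL, hΨR, SuperSym.incl_ι, ξ, extLift_ι,
      one_smul, ← map_smul, ← map_add]
    refine congrArg (SuperSym.ι (partOn N)) (Subtype.ext ?_)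
    change (pr x : g) + φ x • θ = x
    rw [hpr, sub_add_cancel]
  · refine GradedTensorProduct.algHom_ext _ _ (SuperSym.algHom_ext fun x => ?_)
      (ExteriorAlgebra.hom_ext (LinearMap.ext fun m => ?_))
    · change Λ (Ψ (L _)) = L _
      have e1 : φ x = 0 := hA x.2
      have e2 : pr (Submodule.inclusion le x) = x := Subtype.ext (by
        rw [hpr]
        change (x : g) - φ x • θ = x
        rw [e1, zero_smul, sub_zero])
      rw [hΨL, SuperSym.incl_ι, hΛ, hf, e2]
      change _ + φ x • _ = _
      rw [e1, zero_smul, add_zero]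
    · change Λ (Ψ (R (ExteriorAlgebra.ι ℂ m))) = R (ExteriorAlgebra.ι ℂ m)
      have e2 : pr t = 0 := Subtype.ext (by
        rw [hpr]
        change θ - φ θ • θ = 0
        rw [h1, one_smul, sub_self])
      have e3 : m • ξ = ExteriorAlgebra.ι ℂ m := by
        rw [ξ, ← map_smul, smul_eq_mul, mul_one]
      rw [hΨR, extLift_ι, map_smul, hΛ, hf, e2, map_zero, map_zero, zero_add]
      change m • φ θ • R ξ = _
      rw [h1, one_smul, ← map_smul, e3]
  · refine (hΨR _).trans ?_
    rw [ξ, extLift_ι, one_smul]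

end AdjoinOdd

/-! ### The even and odd cases -/

namespace GoodGrading

variable {g : Type*} [AddCommGroup g] [Module ℂ g] [LieSuperalgebra g]
  {χ : EvenFunctional g} {G : GoodGrading χ} {l l' : Submodule ℂ g}

variable [FiniteDimensional ℂ g]

theorem adjoin_eq_top_of_even (hl : G.IsMaximalIsotropic l)
    (hl' : G.IsAdmissibleComplement l l') {r : ℕ} (y : Module.Basis (Fin r) ℂ χ.annihilator)
    (hy : ∀ i, ∃ j : ℤ, (y i : g) ∈ G.gr j) (Y : Fin r → G.W l)
    (hY : ∀ i, G.HasTopSymbol l l' (G.toQ l (Y i)) (G.annihilatorToSym l' (y i)))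
    (h : Even (Module.finrank ℂ (G.gr (-1) ⊓ part 1 : Submodule ℂ g))) :
    Algebra.adjoin ℂ (Set.range Y) = ⊤ ∧
      ∃ Φ : χ.SymAnnihilator ≃ₐ[ℂ] G.GrW l, G.PreservesGradings l Φ.toLinearMap := by
  obtain ⟨h1, Φ, h2, h3⟩ := adjoin_eq_top_and_exists_equiv (hl := hl.prop) (hl' := hl')
    isBigraded_annihilator (le_trans G.annihilator_le le_sup_left)
    -- In the even case no vector of l' other than zero is orthogonal to l, so the orthogonal of m
    -- is contained in g^χ.
    (fun v hv hm => by
      have := mem_annihilator_sup_orthIn hl.prop hl' hv hm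
      rwa [orthIn_eq_bot hl hl' h, sup_bot_eq] at this)
    (Set.range Y) (fun j x hx => exists_lifts_of_basis y hy Y hY hx)
  exact ⟨h1, Φ, preservesGradings_of_ι (φ := (Φ : χ.SymAnnihilator →ₐ[ℂ] G.GrW l)) h2 h3⟩

theorem adjoin_eq_top_of_orthIn (hl : G.IsMaximalIsotropic l)
    (hl' : G.IsAdmissibleComplement l l') {r : ℕ} (y : Module.Basis (Fin r) ℂ χ.annihilator)
    (hy : ∀ i, ∃ j : ℤ, (y i : g) ∈ G.gr j) (Y : Fin r → G.W l)
    (hY : ∀ i, G.HasTopSymbol l l' (G.toQ l (Y i)) (G.annihilatorToSym l' (y i)))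
    {θ : g} (hθ : θ ∈ orthIn χ l l') (hθθ : χ.toLin (br θ θ) = 2) :
    (∃ Θ : G.W l, G.toQ l Θ = G.π l (Env.ι θ) ∧
      Algebra.adjoin ℂ (insert Θ (Set.range Y)) = ⊤) ∧
    ∃ Φ : SymTensorExt χ ≃ₐ[ℂ] G.GrW l,
      G.PreservesGradings l (Φ.toLinearMap ∘ₗ
        (GradedTensorProduct.includeLeft
          (SuperSym.parity (partOn χ.annihilator)) extParity).toLinearMap) ∧
      Φ (GradedTensorProduct.includeRight
          (SuperSym.parity (partOn χ.annihilator)) extParity ξ) ∈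
        GoodGrading.GrW.degree G l 1 ⊓ GoodGrading.GrW.parity G l 1 := by
  have h0 : θ ≠ 0 := by
    rintro rfl
    simp at hθθ
  have hθ1 := orthIn_le_part_one hl hl' hθ
  have hθg := hl'.le hθ.1
  have hsup : ∀ x ∈ χ.annihilator ⊔ ℂ ∙ θ, ∃ a ∈ χ.annihilator, ∃ c : ℂ, a + c • θ = x := by
    intro x hx
    obtain ⟨a, ha, b, hb, rfl⟩ := Submodule.mem_sup.1 hx
    obtain ⟨c, rfl⟩ := Submodule.mem_span_singleton.1 hb
    exact ⟨a, ha, c, rfl⟩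
  have leA : χ.annihilator ≤ G.p ⊔ l' := le_trans G.annihilator_le le_sup_left
  have le : χ.annihilator ⊔ ℂ ∙ θ ≤ G.p ⊔ l' := sup_le leA
    ((Submodule.span_singleton_le_iff_mem _ _).2 (Submodule.mem_sup_right hθ.1))
  have hsθ : G.IsBigraded (ℂ ∙ θ) := by
    refine .of_le_gr ((Submodule.span_singleton_le_iff_mem _ _).2 hθg) (.of_parityProj ?_)
    intro x hx
    obtain ⟨c, rfl⟩ := Submodule.mem_span_singleton.1 hx
    rw [map_smul, parityProj_of_mem_ne (by decide) hθ1, smul_zero]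
    exact Submodule.zero_mem _
  obtain ⟨Θ, hΘ⟩ := exists_toQ_eq_π_ι hl.prop hl' hθ hθ1
  obtain ⟨h1, Φ, h2, h3⟩ := adjoin_eq_top_and_exists_equiv (hl := hl.prop) (hl' := hl')
    (isBigraded_annihilator.sup hsθ) le
    -- The vectors of l' orthogonal to l form the line ℂθ, so g^χ ⊕ ℂθ contains the orthogonal of m.
    (fun v hv hm => sup_le_sup_left (orthIn_le_span hl hl' hθ h0) _
      (mem_annihilator_sup_orthIn hl.prop hl' hv hm))
    (insert Θ (Set.range Y)) (fun j x hx => by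
      obtain ⟨a, ha, c, hac⟩ := hsup x x.2
      obtain ⟨X, hX, hX'⟩ := exists_lifts_of_basis (hl := hl.prop) (hl' := hl') y hy Y hY
        (x := ⟨_, isBigraded_annihilator.grProj_mem j a ha⟩) (G.grProj_mem j a)
      have hX1 : X ∈ Submodule.span ℂ (insert Θ (Set.range Y)) :=
        Submodule.span_mono (Set.subset_insert _ _) hX
      have hxe := G.grProj_of_mem hx
      rw [← hac, map_add, map_smul] at hxe
      -- A homogeneous x = a + c θ is its own component of degree j. The component of a is lifted by
      -- combinations of the Y i, and θ enters only in degree -1, where Θ is an exact lift.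
      by_cases hj : j = -1
      · subst hj
        refine ⟨X + c • Θ, Submodule.add_mem _ hX1 (Submodule.smul_mem _ _
          (Submodule.subset_span (Set.mem_insert _ _))), ?_⟩
        have hl2 := hX'.add ((lifts_ι hl.prop hl' (x := ⟨θ, Submodule.mem_sup_right hθ.1⟩)
          hθg hΘ).smul c)
        rw [G.grProj_of_mem hθg] at hxe
        rwa [show Submodule.inclusion le x =
          Submodule.inclusion leA ⟨_, isBigraded_annihilator.grProj_mem (-1) a ha⟩ +
            c • ⟨θ, Submodule.mem_sup_right hθ.1⟩ from Subtype.ext (hac.symm.trans hxe.symm)]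
      · refine ⟨X, hX1, ?_⟩
        rw [G.grProj_of_mem_ne (Ne.symm hj) hθg, smul_zero, add_zero] at hxe
        rwa [show Submodule.inclusion le x =
          Submodule.inclusion leA ⟨_, isBigraded_annihilator.grProj_mem j a ha⟩ from Subtype.ext (hac.symm.trans hxe.symm)])
  refine ⟨⟨Θ, hΘ, h1⟩, ?_⟩
  obtain ⟨Ψ, h4, h5⟩ := exists_equiv_adjoin_odd (A := χ.annihilator) hθ1
    -- Half of χ([θ, ·]) is the functional that separates θ from g^χ: it vanishes on g^χ, on the
    -- even part because θ is odd, and equals 1 on θ because χ([θ, θ]) = 2.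
    ((2⁻¹ : ℂ) • χ.toLin ∘ₗ br θ)
    (fun a ha => by
      have h := χ_br_swap χ θ a
      rw [EvenFunctional.mem_annihilator.1
        (χ.isSuperSubspace_annihilator.parityFlip_mem ha), neg_zero] at h
      simp [h])
    (fun a ha => by
      have h : χ.toLin (br θ a) = 0 := χ.map_odd _ (LieSuperalgebra.br_mem hθ1 ha)
      simp [h])
    (by simp [hθθ])
  refine ⟨Ψ.trans Φ, preservesGradings_of_ι
    (φ := ((Ψ.trans Φ : SymTensorExt χ ≃ₐ[ℂ] G.GrW l) : SymTensorExt χ →ₐ[ℂ] G.GrW l).comp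
      (GradedTensorProduct.includeLeft (SuperSym.parity (partOn χ.annihilator)) extParity))
    (fun j x hx => ?_) (fun i x hx => ?_), ?_⟩
  · have := h2 j (Submodule.inclusion le_sup_left x) hx
    rw [← h4] at this
    exact this
  · have := h3 i (Submodule.inclusion le_sup_left x) hx
    rw [← h4] at this
    exact this
  · have e1 := h2 (-1) ⟨θ, Submodule.mem_sup_right (Submodule.mem_span_singleton_self θ)⟩ hθg
    have e2 := h3 1 ⟨θ, Submodule.mem_sup_right (Submodule.mem_span_singleton_self θ)⟩ hθ1
    rw [← h5] at e1 e2
    rw [show (-1 : ℤ) + 2 = 1 by norm_num] at e1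
    exact ⟨e1, e2⟩

end GoodGrading
end FinW
end

open FinW LieSuperalgebra in
theorem mainTheorem10 {g : Type*} [AddCommGroup g] [Module ℂ g] [LieSuperalgebra g]
    [FiniteDimensional ℂ g] (hg : EvenPartReductive g)
    (χ : EvenFunctional g) (hχ : χ.IsNilpotent) (G : GoodGrading χ)
    (l l' : Submodule ℂ g) (hl : G.IsMaximalIsotropic l) (hl' : G.IsAdmissibleComplement l l')
    {r : ℕ} (y : Module.Basis (Fin r) ℂ χ.annihilator)
    (hy : ∀ i, ∃ j : ℤ, (y i : g) ∈ G.gr j)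
    (Y : Fin r → G.W l)
    (hY : ∀ i, G.HasTopSymbol l l' (G.toQ l (Y i)) (G.annihilatorToSym l' (y i))) :
    (Even (Module.finrank ℂ (G.gr (-1) ⊓ part 1 : Submodule ℂ g)) →
      Algebra.adjoin ℂ (Set.range Y) = ⊤ ∧
      ∃ Φ : χ.SymAnnihilator ≃ₐ[ℂ] G.GrW l, G.PreservesGradings l Φ.toLinearMap) ∧
    (Odd (Module.finrank ℂ (G.gr (-1) ⊓ part 1 : Submodule ℂ g)) →
      (∀ θ ∈ l', (∀ x ∈ l, χ.toLin (br θ x) = 0) → χ.toLin (br θ θ) = 2 →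
        ∃ Θ : G.W l, G.toQ l Θ = G.π l (Env.ι θ) ∧
          Algebra.adjoin ℂ (insert Θ (Set.range Y)) = ⊤) ∧
      ∃ Φ : SymTensorExt χ ≃ₐ[ℂ] G.GrW l,
        G.PreservesGradings l (Φ.toLinearMap ∘ₗ
          (GradedTensorProduct.includeLeft
            (SuperSym.parity (partOn χ.annihilator)) extParity).toLinearMap) ∧
        Φ (GradedTensorProduct.includeRight
            (SuperSym.parity (partOn χ.annihilator)) extParity ξ) ∈
          GoodGrading.GrW.degree G l 1 ⊓ GoodGrading.GrW.parity G l 1) := by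
  refine ⟨fun h => GoodGrading.adjoin_eq_top_of_even hl hl' y hy Y hY h, fun h => ⟨?_, ?_⟩⟩
  · intro θ hθ hθl hθθ
    exact (GoodGrading.adjoin_eq_top_of_orthIn hl hl' y hy Y hY
      (GoodGrading.mem_orthIn_of_right hl.prop.2.1 hθ hθl) hθθ).1
  · obtain ⟨θ, hθ, hθθ⟩ := GoodGrading.exists_mem_orthIn hl hl' h
    exact (GoodGrading.adjoin_eq_top_of_orthIn hl hl' y hy Y hY hθ hθθ).2
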